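/- Let $\log$ denote the natural logarithm. For vectors $a_1,\dots,a_n\in\mathbb R^d$ and an integer $t\ge 1$, put $$P_t(x)=t!\sum_{S\subseteq[n],\,|S|=t}\ \prod_{i\in S}\langle a_i,x\rangle^4\qquad(x\in\mathbb R^d).$$ Algorithms are programs of a unit-cost real RAM (integer registers and memory with constants, addition, truncated subtraction and comparison; real registers and memory with exact $+,-,\times,\div$, comparison and conversion from integers; indirect addressing; one step per instruction or test). The input is $(n,d,t)$ together with the entries of $a_1,\dots,a_n$. A program accepts if it halts with verdict $1$. For every $c\in\mathbb N$ there are a single program and constants $C,K\in\mathbb N$ such that the following holds for all integers $1\le t\le d\le n$ with $$t\log^6 n\ \le\ n+\frac{d^2}{t}\log^2 n .$$ 1. (Running time) On every input $a_1,\dots,a_n\in\mathbb R^d$ the program halts after at most $K\,n^{Kt}$ steps; that is, it runs in time $n^{O(t)}$. 2. (Soundness) For every input $a_1,\dots,a_n\in\mathbb R^d$ that the program accepts, $$P_t(x)\ \le\ \Bigl(C\Bigl(n+\frac{d^2}{t}\log^2 n\Bigr)\Bigr)^t\qquad\text{for all unit vectors }x\in\mathbb R^d .$$ 3. (Completeness)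 If $a_1,\dots,a_n\in\mathbb R^d$ are random vectors with i.i.d. $\mathcal N(0,1)$ entries, then the program accepts with probability at least $1-n^{-c}$. -/

import Mathlib

/-! # A real RAM with unit cost

The machine has integer registers and real registers (a program mentions only finitely many of
them) and two unbounded memories, one with natural-number cells and one with real cells, which are
addressed through the integer registers. Every instruction and every test costs one step. There is
no integer multiplication, no rounding of reals to integers and there are no real constants other
than those that arithmetic produces from integers. -/

namespace RealRAM

/-- The contents of the registers and of the memories. -/
structure Store where
  ireg : ℕ → ℕ
  rreg : ℕ → ℝ
  imem : ℕ → ℕ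
  rmem : ℕ → ℝ

/-- The elementary instructions. The first argument is the target register, except for
`istore i j` and `rstore i j`, which write register `j` to the memory cell whose address is held
by integer register `i`. -/
inductive Instr where
  | iconst (i c : ℕ)
  | iadd (i j k : ℕ)
  | isub (i j k : ℕ)
  | iload (i j : ℕ)
  | istore (i j : ℕ)
  | rcast (i j : ℕ)
  | radd (i j k : ℕ)
  | rsub (i j k : ℕ)
  | rmul (i j k : ℕ)
  | rdiv (i j k : ℕ)
  | rload (i j : ℕ)
  | rstore (i j : ℕ)

/-- The effect of an instruction. Integer subtraction is truncated at `0`, and division by the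
real number `0` returns `0`. -/
noncomputable def Instr.eval : Instr → Store → Store
  | .iconst i c, s => { s with ireg := Function.update s.ireg i c }
  | .iadd i j k, s => { s with ireg := Function.update s.ireg i (s.ireg j + s.ireg k) }
  | .isub i j k, s => { s with ireg := Function.update s.ireg i (s.ireg j - s.ireg k) }
  | .iload i j, s => { s with ireg := Function.update s.ireg i (s.imem (s.ireg j)) }
  | .istore i j, s => { s with imem := Function.update s.imem (s.ireg i) (s.ireg j) }
  | .rcast i j, s => { s with rreg := Function.update s.rreg i (s.ireg j : ℝ) }
  | .radd i j k, s => { s with rreg := Function.update s.rreg i (s.rreg j + s.rreg k) }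
  | .rsub i j k, s => { s with rreg := Function.update s.rreg i (s.rreg j - s.rreg k) }
  | .rmul i j k, s => { s with rreg := Function.update s.rreg i (s.rreg j * s.rreg k) }
  | .rdiv i j k, s => { s with rreg := Function.update s.rreg i (s.rreg j / s.rreg k) }
  | .rload i j, s => { s with rreg := Function.update s.rreg i (s.rmem (s.ireg j)) }
  | .rstore i j, s => { s with rmem := Function.update s.rmem (s.ireg i) (s.rreg j) }

/-- The tests on which a program can branch: comparison of two integer registers or of two real
registers. -/
inductive Test where
  | ilt (i j : ℕ)
  | rle (i j : ℕ)

/-- When a test succeeds. -/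
def Test.Holds : Test → Store → Prop
  | .ilt i j, s => s.ireg i < s.ireg j
  | .rle i j, s => s.rreg i ≤ s.rreg j

/-- Programs: finite structured combinations of instructions and tests. -/
inductive Prog where
  | instr (a : Instr)
  | seq (p q : Prog)
  | ite (b : Test) (p q : Prog)
  | while (b : Test) (p : Prog)

/-- `Exec p s s' k`: the program `p`, started in the store `s`, halts in the store `s'` after
exactly `k` steps, where each executed instruction and each evaluated test is one step. -/
inductive Exec : Prog → Store → Store → ℕ → Prop
  | instr (a : Instr) (s : Store) : Exec (.instr a) s (a.eval s) 1
  | seq {p q : Prog} {s₁ s₂ s₃ : Store} {k l : ℕ} :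
      Exec p s₁ s₂ k → Exec q s₂ s₃ l → Exec (.seq p q) s₁ s₃ (k + l)
  | iteTrue {b : Test} {p q : Prog} {s s' : Store} {k : ℕ} :
      b.Holds s → Exec p s s' k → Exec (.ite b p q) s s' (k + 1)
  | iteFalse {b : Test} {p q : Prog} {s s' : Store} {k : ℕ} :
      ¬ b.Holds s → Exec q s s' k → Exec (.ite b p q) s s' (k + 1)
  | whileFalse {b : Test} {p : Prog} {s : Store} :
      ¬ b.Holds s → Exec (.while b p) s s 1
  | whileTrue {b : Test} {p : Prog} {s₁ s₂ s₃ : Store} {k l : ℕ} :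
      b.Holds s₁ → Exec p s₁ s₂ k → Exec (.while b p) s₂ s₃ l →
        Exec (.while b p) s₁ s₃ (k + l + 1)

/-- Execution is deterministic: the final store and the number of steps are unique. -/
theorem Exec.unique {p : Prog} {s s₁ s₂ : Store} {k₁ k₂ : ℕ}
    (h₁ : Exec p s s₁ k₁) (h₂ : Exec p s s₂ k₂) : s₁ = s₂ ∧ k₁ = k₂ := by
  induction h₁ generalizing s₂ k₂ with
  | instr a s => cases h₂; exact ⟨rfl, rfl⟩
  | seq _ _ ih₁ ih₂ =>
    cases h₂ with
    | seq a b =>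
      obtain ⟨rfl, rfl⟩ := ih₁ a
      obtain ⟨rfl, rfl⟩ := ih₂ b
      exact ⟨rfl, rfl⟩
  | iteTrue hb _ ih =>
    cases h₂ with
    | iteTrue _ a => obtain ⟨rfl, rfl⟩ := ih a; exact ⟨rfl, rfl⟩
    | iteFalse hb' _ => exact absurd hb hb'
  | iteFalse hb _ ih =>
    cases h₂ with
    | iteTrue hb' _ => exact absurd hb' hb
    | iteFalse _ a => obtain ⟨rfl, rfl⟩ := ih a; exact ⟨rfl, rfl⟩
  | whileFalse hb =>
    cases h₂ with
    | whileFalse _ => exact ⟨rfl, rfl⟩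
    | whileTrue hb' _ _ => exact absurd hb' hb
  | whileTrue hb _ _ ih₁ ih₂ =>
    cases h₂ with
    | whileFalse hb' => exact absurd hb hb'
    | whileTrue _ a b =>
      obtain ⟨rfl, rfl⟩ := ih₁ a
      obtain ⟨rfl, rfl⟩ := ih₂ b
      exact ⟨rfl, rfl⟩

/-- The initial store on the input `(n, d, t, a)`: the integer registers `0, 1, 2` hold `n, d, t`,
the first `n * d` cells of the real memory hold the rows `a₁, …, aₙ ∈ ℝᵈ` one after the other, and
everything else is `0`. -/
def input (n d t : ℕ) (a : Fin n → Fin d → ℝ) : Store where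
  ireg i := if i = 0 then n else if i = 1 then d else if i = 2 then t else 0
  rreg _ := 0
  imem _ := 0
  rmem m := if h : m / d < n ∧ m % d < d then a ⟨m / d, h.1⟩ ⟨m % d, h.2⟩ else 0

/-- The program halts on the input `(n, d, t, a)` within `T` steps. -/
def HaltsWithin (p : Prog) (n d t : ℕ) (a : Fin n → Fin d → ℝ) (T : ℕ) : Prop :=
  ∃ s k, Exec p (input n d t a) s k ∧ k ≤ T

/-- The program accepts the input `(n, d, t, a)`: it halts with the value `1` in the integer
register `0`. -/
def Accepts (p : Prog) (n d t : ℕ) (a : Fin n → Fin d → ℝ) : Prop :=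
  ∃ s k, Exec p (input n d t a) s k ∧ s.ireg 0 = 1

end RealRAM

/-- `P_t(x) = t! ∑_{S ⊆ [n], |S| = t} ∏_{i ∈ S} ⟨a_i, x⟩⁴`. -/
noncomputable def distinctProducts {n d : ℕ} (t : ℕ) (a : Fin n → Fin d → ℝ)
    (x : EuclideanSpace ℝ (Fin d)) : ℝ :=
  (t.factorial : ℝ) *
    ∑ S ∈ Finset.powersetCard t (Finset.univ : Finset (Fin n)),
      ∏ i ∈ S, (∑ j : Fin d, a i j * x j) ^ 4

/-- The joint law of `n` random vectors in `ℝᵈ` whose entries are independent standard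
Gaussians. -/
noncomputable def gaussianVectors (n d : ℕ) : MeasureTheory.Measure (Fin n → Fin d → ℝ) :=
  MeasureTheory.Measure.pi fun _ : Fin n =>
    MeasureTheory.Measure.pi fun _ : Fin d => ProbabilityTheory.gaussianReal 0 1

/-- The quantity `n + (d² / t) log² n`. -/
noncomputable def rateBound (n d t : ℕ) : ℝ :=
  (n : ℝ) + (d : ℝ) ^ 2 / (t : ℝ) * Real.log (n : ℝ) ^ 2

/-! ### Traces of powers of positive semidefinite matrices -/

section TraceInequalities

open Matrix

variable {ι κ : Type*} [Fintype ι] [DecidableEq ι] [Fintype κ] [DecidableEq κ]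

/-! For a set `S` of indices let `q_S = ∏_{i ∈ S} (⟨a_i, ·⟩² - ‖·‖²)`, a form of degree `2|S|`. The
certificate uses the matrices `M_k = k! ∑_{|S| = k} jet(q_S) jet(q_S)ᵀ`, `1 ≤ k ≤ t`, where a jet is
the tensor of all partial derivatives of order `2k` at the origin. With `p = ⌈log₂ n⌉` it accepts
when `tr M_k^p` is below a threshold for every `k`.

Soundness. In the inner product of jets, multiplication by a linear form is adjoint to a directional
derivative, up to a degree factor. Hence pairing `jet(q_S)` with the jet of `⟨x, ·⟩^(2k)` evaluates
`q_S` at `x`, up to `(2k)!²`. The quadratic form of `M_k` at that jet is therefore `(2k)!⁴ k!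
e_k(w)`, where `w_i = (⟨a_i, x⟩² - 1)²` and `e_k` is the elementary symmetric function, and it is
controlled by `(tr M_k^p)^(1/p)`. Finally `y⁴ ≤ 2((y² - 1)² + 1)`, and expanding the product bounds
`P_t` by the `e_k(w)` with `k ≤ t` (`CertHolds.distinctProducts_le`).

Completeness. By Markov's inequality it is enough to bound `E tr M_k^p`. Consider more generally the
Gram matrix of the `q_U q_S` with `S ⊆ s`, `|S| = k`. For `i ∈ s` it is `W = Z + Y`, where `Z`
collects the `S` that avoid `i` and does not involve `a_i`. Now `k tr W^(r+1) = ∑_i tr(Y_i W^r)` and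
`tr(Y (Z + Y)^r) ≤ 2 tr(Y Z^r) + (4r)^r tr Y^(r+1)` (`trace_mul_add_pow_le`). The first term is
linear in `Y`, so averaging over `a_i` replaces the random quadratic factor by all pairs of
coordinates (`lintegral_trace_quadForm_mul_le`). A Young inequality (`mul_trace_mul_pow_le`) and the
operator estimate `trace_jetGram_X_mul_pow_le` then give half of the same moment for `s \ {i}`, plus
the moment with `k - 1`. In the second term `i` has moved from `s` to `U`. At `k = 0` the matrix has
rank one, and the moments of the norm of `jet(q_U)` follow from Gaussian decoupling
(`lintegral_jet_quadForm_mul_pow_le`). The recursion has the explicit supersolution `momentBound`.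
Prefactors polynomial in `n` and `d` cost only a constant per degree because `n ≤ 2^p`. The
resulting rate is `n + p d²/k + p³ k`, and the hypothesis on `t` absorbs its last term at `k = t`.

Program. A jet of a product of quadratic forms is an explicit sum over permutations
(`jet_prod_quadForm_apply`), so every entry of `M_k` is a sum of `n^O(t)` terms. A small calculus of
functions computable in polynomial time (`IComputes`, `RComputes`) yields a program that tabulates
the powers of all `M_k` in memory and compares the traces with the thresholds. -/

theorem Matrix.PosSemidef.exists_diagonalization {A : Matrix ι ι ℝ} (hA : A.PosSemidef) :
    ∃ (U : Matrix ι ι ℝ) (l : ι → ℝ), (∀ i, 0 ≤ l i) ∧ Uᵀ * U = 1 ∧ U * Uᵀ = 1 ∧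
      ∀ r : ℕ, A ^ r = U * diagonal (fun i => l i ^ r) * Uᵀ := by
  set U : Matrix ι ι ℝ := (hA.1.eigenvectorUnitary : Matrix ι ι ℝ) with hU
  have h1 : Uᵀ * U = 1 := by
    have := Unitary.coe_star_mul_self hA.1.eigenvectorUnitary
    rwa [Matrix.star_eq_conjTranspose, conjTranspose_eq_transpose_of_trivial] at this
  have h2 : U * Uᵀ = 1 := mul_eq_one_comm.mp h1
  have h3 : A = U * diagonal hA.1.eigenvalues * Uᵀ := by
    have := hA.1.spectral_theorem
    rw [Unitary.conjStarAlgAut_apply] at this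
    rwa [Matrix.star_eq_conjTranspose, conjTranspose_eq_transpose_of_trivial] at this
  refine ⟨U, hA.1.eigenvalues, hA.eigenvalues_nonneg, h1, h2, fun r => ?_⟩
  generalize hA.1.eigenvalues = l at h3
  induction r with
  | zero => simp [h2]
  | succ r ih =>
    calc A ^ (r + 1) = U * diagonal (fun i => l i ^ r) * Uᵀ * (U * diagonal l * Uᵀ) := by
          rw [pow_succ, ih, ← h3]
      _ = U * diagonal (fun i => l i ^ r) * (Uᵀ * U) * diagonal l * Uᵀ := by
          simp only [Matrix.mul_assoc]
      _ = _ := by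
          rw [h1, Matrix.mul_one, Matrix.mul_assoc U, diagonal_mul_diagonal]
          simp only [pow_succ]

/-- The weights are squares, hence nonnegative, although the two diagonalized matrices need not
commute. This is why scalar inequalities between monomials in two nonnegative variables pass to
traces. -/
theorem trace_diagonal_conj (H V S : Matrix ι ι ℝ) (hH : Hᵀ = H) (p q : ι → ℝ) :
    (H * (V * diagonal p * Vᵀ) * H * (S * diagonal q * Sᵀ)).trace =
      ∑ b, ∑ c, (Vᵀ * H * S) b c ^ 2 * p b * q c := by
  have : (H * (V * diagonal p * Vᵀ) * H * (S * diagonal q * Sᵀ)).trace =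
      ((Sᵀ * H * V) * (diagonal p * ((Vᵀ * H * S) * diagonal q))).trace := by
    rw [← Matrix.mul_assoc _ (S * diagonal q) Sᵀ, trace_mul_comm]
    simp only [Matrix.mul_assoc]
  rw [this]
  have h2 : Sᵀ * H * V = (Vᵀ * H * S)ᵀ := by
    simp [transpose_mul, hH, Matrix.mul_assoc]
  rw [h2, trace, Finset.sum_comm]
  refine Finset.sum_congr rfl fun b _ => ?_
  simp only [diag_apply, mul_apply (M := (Vᵀ * H * S)ᵀ), transpose_apply, diagonal_mul,
    mul_diagonal]
  refine Finset.sum_congr rfl fun c _ => ?_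
  ring

/-- An inequality between sums of monomials `x ^ k * y ^ l` for `x, y ≥ 0` passes to traces. -/
theorem Matrix.PosSemidef.exists_joint_weights {A B H : Matrix ι ι ℝ} (hA : A.PosSemidef)
    (hB : B.PosSemidef) (hH : Hᵀ = H) :
    ∃ (c : ι → ι → ℝ) (x y : ι → ℝ), (∀ i j, 0 ≤ c i j) ∧ (∀ i, 0 ≤ x i) ∧ (∀ i, 0 ≤ y i) ∧
      ∀ k l : ℕ, (H * A ^ k * H * B ^ l).trace = ∑ i, ∑ j, c i j * x i ^ k * y j ^ l := by
  obtain ⟨U, x, hx, -, -, hU⟩ := hA.exists_diagonalization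
  obtain ⟨V, y, hy, -, -, hV⟩ := hB.exists_diagonalization
  refine ⟨fun i j => (Uᵀ * H * V) i j ^ 2, x, y, fun i j => sq_nonneg _, hx, hy, fun k l => ?_⟩
  rw [hU, hV, trace_diagonal_conj H U V hH]

/-- For eigenvalues `x, y ≥ 0` the monomial `x^k y^l` is at most the larger of `x^(k+l)` and
`y^(k+l)`. -/
theorem trace_mul_pow_mul_le {A B H : Matrix ι ι ℝ} (hA : A.PosSemidef)
    (hB : B.PosSemidef) (hH : Hᵀ = H) (k l : ℕ) :
    (H * A ^ k * H * B ^ l).trace ≤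
      (H * A ^ (k + l) * H).trace + (H * H * B ^ (k + l)).trace := by
  obtain ⟨c, x, y, hc, hx, hy, h⟩ := hA.exists_joint_weights hB hH
  have h1 := h (k + l) 0
  have h2 := h 0 (k + l)
  simp only [pow_zero, mul_one] at h1 h2
  rw [h, h1, h2, ← Finset.sum_add_distrib]
  refine Finset.sum_le_sum fun i _ => ?_
  rw [← Finset.sum_add_distrib]
  refine Finset.sum_le_sum fun j _ => ?_
  rw [mul_assoc, ← mul_add]
  refine mul_le_mul_of_nonneg_left ?_ (hc i j)
  rcases le_total (x i) (y j) with hxy | hxy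
  · calc x i ^ k * y j ^ l ≤ y j ^ k * y j ^ l := by
          gcongr; exact pow_nonneg (hy j) l; exact hx i
      _ = y j ^ (k + l) := (pow_add _ _ _).symm
      _ ≤ _ := le_add_of_nonneg_left (pow_nonneg (hx i) _)
  · calc x i ^ k * y j ^ l ≤ x i ^ k * x i ^ l := by
          gcongr; exact pow_nonneg (hx i) k; exact hy j
      _ = x i ^ (k + l) := (pow_add _ _ _).symm
      _ ≤ _ := le_add_of_nonneg_right (pow_nonneg (hy j) _)

/-- Split at `w = 4ry`. Above it, one factor `y` is at most `w / (4r)`; below it, every `w` is at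
most `4ry`. -/
theorem sq_mul_pow_le {r : ℕ} (hr : 1 ≤ r) {y w : ℝ} (hy : 0 ≤ y) (hw : 0 ≤ w) :
    r * (y ^ 2 * w ^ (r - 1)) ≤ 1 / 4 * (y * w ^ r) + (4 * r) ^ r / 4 * y ^ (r + 1) := by
  obtain ⟨m, rfl⟩ : ∃ m, r = m + 1 := ⟨r - 1, by omega⟩
  simp only [Nat.add_sub_cancel]
  set R : ℝ := ((m + 1 : ℕ) : ℝ) with hR
  have hR0 : 0 ≤ R := by positivity
  rcases le_total (4 * R * y) w with h | h
  · have : R * (y ^ 2 * w ^ m) ≤ 1 / 4 * (y * w ^ (m + 1)) := by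
      have : 4 * R * y * (y * w ^ m) ≤ w * (y * w ^ m) := by gcongr
      rw [pow_succ w m]; nlinarith
    have h2 : 0 ≤ (4 * R) ^ (m + 1) / 4 * y ^ (m + 1 + 1) := by positivity
    linarith
  · have h1 : w ^ m ≤ (4 * R * y) ^ m := by gcongr
    have : R * (y ^ 2 * w ^ m) ≤ (4 * R) ^ (m + 1) / 4 * y ^ (m + 1 + 1) := by
      calc R * (y ^ 2 * w ^ m) ≤ R * (y ^ 2 * (4 * R * y) ^ m) := by gcongr
        _ = _ := by rw [mul_pow]; ring
    have h2 : 0 ≤ 1 / 4 * (y * w ^ (m + 1)) := by positivity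
    linarith

theorem mul_trace_sq_mul_pow_le {Y W : Matrix ι ι ℝ} (hY : Y.PosSemidef) (hW : W.PosSemidef)
    {r : ℕ} (hr : 1 ≤ r) :
    r * (Y * Y * W ^ (r - 1)).trace ≤
      1 / 4 * (Y * W ^ r).trace + (4 * r) ^ r / 4 * (Y ^ (r + 1)).trace := by
  obtain ⟨c, y, w, hc, hy, hw, h⟩ :=
    hY.exists_joint_weights hW (H := 1) (by simp)
  simp only [Matrix.one_mul, Matrix.mul_one] at h
  have h1 := h 2 (r - 1)
  have h2 := h 1 r
  have h3 := h (r + 1) 0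
  simp only [pow_two Y, pow_one, pow_zero, mul_one] at h1 h2 h3
  rw [h1, h2, h3]
  simp only [Finset.mul_sum]
  rw [← Finset.sum_add_distrib]
  refine Finset.sum_le_sum fun i _ => ?_
  rw [← Finset.sum_add_distrib]
  refine Finset.sum_le_sum fun j _ => ?_
  have := mul_le_mul_of_nonneg_left (sq_mul_pow_le hr (hy i) (hw j)) (hc i j)
  nlinarith

/-- Telescoping, replacing the factors `Z + Y` by `Z` one at a time without commuting them. -/
theorem add_pow_sub_pow_eq_sum (Z Y : Matrix ι ι ℝ) (r : ℕ) :
    (Z + Y) ^ r - Z ^ r = ∑ k ∈ Finset.range r, (Z + Y) ^ k * Y * Z ^ (r - 1 - k) := by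
  induction r with
  | zero => simp
  | succ r ih =>
    have : (Z + Y) ^ (r + 1) - Z ^ (r + 1) = (Z + Y) ^ r * Y + ((Z + Y) ^ r - Z ^ r) * Z := by
      rw [pow_succ, pow_succ]; noncomm_ring
    rw [this, ih, Finset.sum_range_succ, Finset.sum_mul, add_comm]
    simp only [Nat.add_sub_cancel, Nat.sub_self, pow_zero, Matrix.mul_one]
    congr 1
    refine Finset.sum_congr rfl fun k hk => ?_
    rw [Matrix.mul_assoc, ← pow_succ]
    congr 2
    have := Finset.mem_range.1 hk
    omega

theorem trace_mul_pow_nonneg {Y W : Matrix ι ι ℝ} (hY : Y.PosSemidef) (hW : W.PosSemidef)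
    (k l : ℕ) : 0 ≤ (Y ^ k * W ^ l).trace := by
  obtain ⟨c, y, w, hc, hy, hw, h⟩ :=
    hY.exists_joint_weights hW (H := 1) (by simp)
  simp only [Matrix.one_mul, Matrix.mul_one] at h
  rw [h]
  exact Finset.sum_nonneg fun i _ => Finset.sum_nonneg fun j _ =>
    mul_nonneg (mul_nonneg (hc i j) (pow_nonneg (hy i) _)) (pow_nonneg (hw j) _)

/-- A matrix version of `y (z + y) ^ r ≤ 2 y z ^ r + (4 r) ^ r y ^ (r + 1)`. -/
theorem trace_mul_add_pow_le {Y Z : Matrix ι ι ℝ} (hY : Y.PosSemidef) (hZ : Z.PosSemidef)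
    (r : ℕ) :
    (Y * (Z + Y) ^ r).trace ≤ 2 * (Y * Z ^ r).trace + (4 * r) ^ r * (Y ^ (r + 1)).trace := by
  rcases Nat.eq_zero_or_pos r with rfl | hr
  · have := hY.trace_nonneg
    simp; linarith
  have hW := hZ.add hY
  set W := Z + Y with hWdef
  have hYt : Yᵀ = Y := by
    have := hY.1
    rwa [IsHermitian, conjTranspose_eq_transpose_of_trivial] at this
  have e1 : (Y * W ^ r).trace = (Y * Z ^ r).trace +
      ∑ k ∈ Finset.range r, (Y * W ^ k * Y * Z ^ (r - 1 - k)).trace := by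
    have := add_pow_sub_pow_eq_sum Z Y r
    have h2 : W ^ r = Z ^ r + ∑ k ∈ Finset.range r, W ^ k * Y * Z ^ (r - 1 - k) := by
      rw [← this]; abel
    rw [h2, Matrix.mul_add, trace_add, Finset.mul_sum, trace_sum]
    simp only [Matrix.mul_assoc]
  -- The powers of `W` and `Z` that sit between the two factors `Y` are gathered into a single power
  -- of either matrix.
  have e2 : ∑ k ∈ Finset.range r, (Y * W ^ k * Y * Z ^ (r - 1 - k)).trace ≤
      r * ((Y * Y * W ^ (r - 1)).trace + (Y * Y * Z ^ (r - 1)).trace) := by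
    calc _ ≤ ∑ k ∈ Finset.range r,
          ((Y * Y * W ^ (r - 1)).trace + (Y * Y * Z ^ (r - 1)).trace) := by
          refine Finset.sum_le_sum fun k hk => ?_
          have hk := Finset.mem_range.1 hk
          have := trace_mul_pow_mul_le hW hZ hYt k (r - 1 - k)
          rw [show k + (r - 1 - k) = r - 1 by omega] at this
          have h3 : (Y * W ^ (r - 1) * Y).trace = (Y * Y * W ^ (r - 1)).trace := by
            rw [trace_mul_comm, Matrix.mul_assoc]
          rwa [h3] at this
      _ = _ := by simp only [Finset.sum_const, Finset.card_range, nsmul_eq_mul]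
  have e3 := mul_trace_sq_mul_pow_le hY hW hr
  have e4 := mul_trace_sq_mul_pow_le hY hZ hr
  have e5 : 0 ≤ (Y * Z ^ r).trace := by simpa using trace_mul_pow_nonneg hY hZ 1 r
  have e6 : 0 ≤ (4 * (r : ℝ)) ^ r * (Y ^ (r + 1)).trace :=
    mul_nonneg (by positivity) (hY.pow _).trace_nonneg
  -- With `x = tr(Y W^r)`, `y = tr(Y Z^r)` and `z = (4r)^r tr Y^(r+1)`, the estimates add up to `x ≤
  -- y + (x + y)/4 + z/2`, and the quarter of `x` moves to the left.
  nlinarith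

/-- Young's inequality, by comparing `z` with `2cx`. The coefficient `1/2` lets the recursion absorb
a term of the same order as its left side. -/
theorem mul_trace_mul_pow_le {X Z : Matrix ι ι ℝ} (hX : X.PosSemidef) (hZ : Z.PosSemidef)
    {c : ℝ} (hc : 0 ≤ c) (r : ℕ) :
    c * (X * Z ^ r).trace ≤
      1 / 2 * (Z ^ (r + 1)).trace + (2 * c) ^ (r + 1) * (X ^ (r + 1)).trace := by
  obtain ⟨w, x, z, hw, hx, hz, h⟩ :=
    hX.exists_joint_weights hZ (H := 1) (by simp)
  simp only [Matrix.one_mul, Matrix.mul_one] at h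
  have h1 := h 1 r
  have h2 := h 0 (r + 1)
  have h3 := h (r + 1) 0
  simp only [pow_one, pow_zero, mul_one, Matrix.one_mul] at h1 h2 h3
  rw [h1, h2, h3]
  simp only [Finset.mul_sum]
  rw [← Finset.sum_add_distrib]
  refine Finset.sum_le_sum fun i _ => ?_
  rw [← Finset.sum_add_distrib]
  refine Finset.sum_le_sum fun j _ => ?_
  have hx := hx i
  have hz := hz j
  have key : c * (x i * z j ^ r) ≤ 1 / 2 * z j ^ (r + 1) + (2 * c) ^ (r + 1) * x i ^ (r + 1) := by
    rw [← mul_pow]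
    rcases le_total (2 * c * x i) (z j) with h | h
    · have : 2 * c * x i * z j ^ r ≤ z j * z j ^ r := by gcongr
      have h2 : 0 ≤ (2 * c * x i) ^ (r + 1) := by positivity
      rw [pow_succ (z j)]; nlinarith
    · have : z j ^ r ≤ (2 * c * x i) ^ r := by gcongr
      have h3 : 2 * c * x i * z j ^ r ≤ 2 * c * x i * (2 * c * x i) ^ r := by gcongr
      have h2 : 0 ≤ z j ^ (r + 1) := by positivity
      have h4 : 0 ≤ (2 * c * x i) ^ (r + 1) := by positivity
      rw [pow_succ (2 * c * x i)] at *; nlinarith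
  have := mul_le_mul_of_nonneg_left key (hw i j)
  nlinarith

/-- Jensen's inequality for the spectral measures of finitely many vectors. -/
theorem sum_dotProduct_pow_le {A : Matrix ι ι ℝ} (hA : A.PosSemidef) {σ : Type*} (s : Finset σ)
    (w : σ → ℝ) (hw : ∀ j ∈ s, 0 ≤ w j) (v : σ → ι → ℝ)
    (hv : ∑ j ∈ s, w j * (v j ⬝ᵥ v j) = 1) (p : ℕ) :
    (∑ j ∈ s, w j * (v j ⬝ᵥ A *ᵥ v j)) ^ p ≤ ∑ j ∈ s, w j * (v j ⬝ᵥ (A ^ p) *ᵥ v j) := by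
  obtain ⟨U, l, hl, h1, h2, hU⟩ := hA.exists_diagonalization
  have key : ∀ (r : ℕ) (u : ι → ℝ), u ⬝ᵥ (A ^ r) *ᵥ u = ∑ i, (u ᵥ* U) i ^ 2 * l i ^ r := by
    intro r u
    rw [hU, ← mulVec_mulVec, ← mulVec_mulVec, dotProduct_mulVec, mulVec_transpose]
    simp only [dotProduct, mulVec_diagonal]
    refine Finset.sum_congr rfl fun i _ => ?_
    ring
  have key' : ∀ (r : ℕ), ∑ j ∈ s, w j * (v j ⬝ᵥ (A ^ r) *ᵥ v j) =
      ∑ i, (∑ j ∈ s, w j * (v j ᵥ* U) i ^ 2) * l i ^ r := by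
    intro r
    simp only [key, Finset.mul_sum, Finset.sum_mul]
    rw [Finset.sum_comm]
    simp only [mul_assoc]
  have h3 := key' 1
  rw [pow_one] at h3
  rw [h3, key' p]
  simp only [pow_one]
  refine Real.pow_arith_mean_le_arith_mean_pow _ _ _ (fun i _ => ?_) ?_ (fun i _ => hl i) p
  · exact Finset.sum_nonneg fun j hj => mul_nonneg (hw j hj) (sq_nonneg _)
  -- The case of exponent zero says that the spectral weights add up to one.
  · have := key' 0
    simp only [pow_zero, one_mulVec, mul_one] at this
    rw [← this, hv]

/-- Every eigenvalue is at most the `p`-th root of the sum of the `p`-th powers. This turns a trace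
into a bound that holds for all vectors at once. -/
theorem dotProduct_mulVec_pow_le_trace {A : Matrix ι ι ℝ} (hA : A.PosSemidef) (v : ι → ℝ)
    {p : ℕ} (hp : p ≠ 0) : (v ⬝ᵥ A *ᵥ v) ^ p ≤ (A ^ p).trace * (v ⬝ᵥ v) ^ p := by
  obtain ⟨U, l, hl, h1, h2, hU⟩ := hA.exists_diagonalization
  have key : ∀ (r : ℕ) (u : ι → ℝ), u ⬝ᵥ (A ^ r) *ᵥ u = ∑ i, (u ᵥ* U) i ^ 2 * l i ^ r := by
    intro r u
    rw [hU, ← mulVec_mulVec, ← mulVec_mulVec, dotProduct_mulVec, mulVec_transpose]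
    simp only [dotProduct, mulVec_diagonal]
    refine Finset.sum_congr rfl fun i _ => ?_
    ring
  have htr : (A ^ p).trace = ∑ i, l i ^ p := by
    rw [hU, Matrix.mul_assoc, trace_mul_comm, Matrix.mul_assoc, h1, Matrix.mul_one, trace_diagonal]
  have hle : ∀ i, l i ≤ (∑ i, l i ^ p) ^ ((p : ℝ)⁻¹) := by
    intro i
    have : l i ^ p ≤ ∑ i, l i ^ p :=
      Finset.single_le_sum (f := fun i => l i ^ p) (fun i _ => pow_nonneg (hl i) _) (Finset.mem_univ i)
    calc l i = (l i ^ p) ^ ((p : ℝ)⁻¹) := (Real.pow_rpow_inv_natCast (hl i) hp).symm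
      _ ≤ _ := by
        have := pow_nonneg (hl i) p
        gcongr
  have h0 : 0 ≤ ∑ i, l i ^ p := Finset.sum_nonneg fun i _ => pow_nonneg (hl i) _
  have k1 := key 1 v
  have k0 := key 0 v
  simp only [pow_one, pow_zero, one_mulVec, mul_one] at k1 k0
  have : v ⬝ᵥ A *ᵥ v ≤ (∑ i, l i ^ p) ^ ((p : ℝ)⁻¹) * (v ⬝ᵥ v) := by
    rw [k1, k0, Finset.mul_sum]
    refine Finset.sum_le_sum fun i _ => ?_
    rw [mul_comm]
    exact mul_le_mul_of_nonneg_right (hle i) (sq_nonneg _)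
  have hnn : 0 ≤ v ⬝ᵥ A *ᵥ v := by
    rw [k1]; exact Finset.sum_nonneg fun i _ => mul_nonneg (sq_nonneg _) (hl i)
  calc (v ⬝ᵥ A *ᵥ v) ^ p ≤ ((∑ i, l i ^ p) ^ ((p : ℝ)⁻¹) * (v ⬝ᵥ v)) ^ p := by gcongr
    _ = _ := by rw [mul_pow, Real.rpow_inv_natCast_pow h0 hp, htr]

end TraceInequalities

/-! ### Jets of polynomials at the origin -/

section Jets

open MvPolynomial Matrix

variable {d : ℕ}

/-- The partial derivatives of order `m` of a polynomial at the origin. -/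
noncomputable def jet : (m : ℕ) → MvPolynomial (Fin d) ℝ →ₗ[ℝ] ((Fin m → Fin d) → ℝ)
  | 0 => LinearMap.pi fun _ => lcoeff ℝ 0
  | m + 1 => LinearMap.pi fun α =>
      (LinearMap.proj (Fin.tail α)) ∘ₗ (jet m) ∘ₗ ((pderiv (α 0) : Derivation ℝ _ _) : _ →ₗ[ℝ] _)

theorem jet_zero_apply (f : MvPolynomial (Fin d) ℝ) (α : Fin 0 → Fin d) :
    jet 0 f α = coeff 0 f := rfl

theorem jet_succ_apply (m : ℕ) (f : MvPolynomial (Fin d) ℝ) (α : Fin (m + 1) → Fin d) :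
    jet (m + 1) f α = jet m (pderiv (α 0) f) (Fin.tail α) := rfl

/-- The linear form `x ↦ ⟨v, x⟩`. -/
noncomputable def linForm (v : Fin d → ℝ) : MvPolynomial (Fin d) ℝ := ∑ k, v k • X k

/-- The derivative in the direction `v`. -/
noncomputable def dirDeriv (v : Fin d → ℝ) (f : MvPolynomial (Fin d) ℝ) :
    MvPolynomial (Fin d) ℝ := ∑ k, v k • pderiv k f

theorem coeff_zero_X_mul (k : Fin d) (f : MvPolynomial (Fin d) ℝ) : coeff 0 (X k * f) = 0 := by
  rw [mul_comm, MvPolynomial.coeff_mul_X']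
  simp

theorem pderiv_X_mul (l k : Fin d) (f : MvPolynomial (Fin d) ℝ) :
    pderiv l (X k * f) = (if l = k then f else 0) + X k * pderiv l f := by
  rw [Derivation.leibniz, pderiv_X, smul_eq_mul, smul_eq_mul]
  by_cases h : l = k
  · subst h; simp [add_comm]
  · simp [h, Ne.symm h]

/-- The commutator of two derivations is a derivation, and this one kills the variables. -/
theorem pderiv_pderiv_comm (l k : Fin d) (f : MvPolynomial (Fin d) ℝ) :
    pderiv l (pderiv k f) = pderiv k (pderiv l f) := by
  have h : ⁅(pderiv l : Derivation ℝ (MvPolynomial (Fin d) ℝ) (MvPolynomial (Fin d) ℝ)),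
      (pderiv k : Derivation ℝ (MvPolynomial (Fin d) ℝ) (MvPolynomial (Fin d) ℝ))⁆ = 0 := by
    apply MvPolynomial.derivation_ext
    intro i
    rw [Derivation.commutator_apply, pderiv_X, pderiv_X]
    simp [Pi.single_apply, apply_ite]
  have := congrArg (fun D => D f) h
  rw [Derivation.commutator_apply] at this
  simpa [sub_eq_zero] using this

theorem jet_succ_dotProduct (m : ℕ) (f g : MvPolynomial (Fin d) ℝ) :
    jet (m + 1) f ⬝ᵥ jet (m + 1) g = ∑ k, jet m (pderiv k f) ⬝ᵥ jet m (pderiv k g) := by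
  simp only [dotProduct]
  rw [← (Fin.consEquiv (fun _ : Fin (m + 1) => Fin d)).sum_comp, Fintype.sum_prod_type]
  rfl

/-- Multiplication by a variable is adjoint to differentiation. In the induction the product rule
yields the pairing itself once, from the differentiated variable, and `m + 1` times through the
induction hypothesis. Homogeneity is not needed, since a jet only sees one degree. -/
theorem jet_X_mul_dotProduct (m : ℕ) (k : Fin d) (f g : MvPolynomial (Fin d) ℝ) :
    jet (m + 1) (X k * f) ⬝ᵥ jet (m + 1) g = (m + 1) * (jet m f ⬝ᵥ jet m (pderiv k g)) := by
  induction m generalizing f g with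
  | zero =>
    rw [jet_succ_dotProduct]
    simp only [pderiv_X_mul, dotProduct, jet_zero_apply, coeff_add, coeff_zero_X_mul]
    simp [apply_ite (coeff 0)]
  | succ m ih =>
    rw [jet_succ_dotProduct]
    have : ∀ l, jet (m + 1) (pderiv l (X k * f)) ⬝ᵥ jet (m + 1) (pderiv l g) =
        (if l = k then jet (m + 1) f ⬝ᵥ jet (m + 1) (pderiv l g) else 0) +
          (m + 1) * (jet m (pderiv l f) ⬝ᵥ jet m (pderiv l (pderiv k g))) := by
      intro l
      rw [pderiv_X_mul, map_add, add_dotProduct, ih, pderiv_pderiv_comm]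
      congr 1
      split_ifs <;> simp
    simp only [this, Finset.sum_add_distrib, ← Finset.mul_sum]
    rw [← jet_succ_dotProduct]
    simp
    ring

theorem jet_linForm_mul_dotProduct (m : ℕ) (v : Fin d → ℝ) (f g : MvPolynomial (Fin d) ℝ) :
    jet (m + 1) (linForm v * f) ⬝ᵥ jet (m + 1) g =
      (m + 1) * (jet m f ⬝ᵥ jet m (dirDeriv v g)) := by
  simp only [linForm, dirDeriv, Finset.sum_mul, map_sum, sum_dotProduct, dotProduct_sum,
    smul_mul_assoc, map_smul, smul_dotProduct, dotProduct_smul, jet_X_mul_dotProduct,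
    Finset.mul_sum]
  refine Finset.sum_congr rfl fun k _ => ?_
  simp only [smul_eq_mul]; ring

theorem dirDeriv_linForm_mul (v u : Fin d → ℝ) (f : MvPolynomial (Fin d) ℝ) :
    dirDeriv v (linForm u * f) = (v ⬝ᵥ u) • f + linForm u * dirDeriv v f := by
  have h : ∀ k, pderiv k (linForm u * f) = u k • f + linForm u * pderiv k f := by
    intro k
    simp only [linForm, Finset.sum_mul, map_sum, smul_mul_assoc, Derivation.map_smul,
      pderiv_X_mul, smul_add, Finset.sum_add_distrib]
    simp
  simp only [dirDeriv, h, smul_add, Finset.sum_add_distrib, Finset.mul_sum, dotProduct,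
    Finset.sum_smul, smul_smul, mul_smul_comm]

theorem dirDeriv_linForm_pow (v u : Fin d → ℝ) (m : ℕ) :
    dirDeriv v (linForm u ^ (m + 1)) = ((m + 1 : ℝ) * (v ⬝ᵥ u)) • linForm u ^ m := by
  induction m with
  | zero =>
    have := dirDeriv_linForm_mul v u 1
    rw [mul_one] at this
    rw [zero_add, pow_one, this]
    simp [dirDeriv]
  | succ m ih =>
    rw [pow_succ' (linForm u) (m + 1), dirDeriv_linForm_mul, ih, mul_smul_comm, ← pow_succ',
      ← add_smul]
    congr 1
    push_cast; ring

theorem jet_linForm_mul_sq_one (v : Fin d → ℝ) (f : MvPolynomial (Fin d) ℝ) :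
    jet 1 (linForm v * f) ⬝ᵥ jet 1 (linForm v * f) = (v ⬝ᵥ v) * (jet 0 f ⬝ᵥ jet 0 f) := by
  have := jet_linForm_mul_dotProduct 0 v f (linForm v * f)
  rw [this, dirDeriv_linForm_mul, map_add, dotProduct_add, map_smul, dotProduct_smul]
  have h : jet 0 (linForm v * dirDeriv v f) = 0 := by
    ext α
    simp [linForm, Finset.sum_mul, jet_zero_apply, coeff_sum, coeff_zero_X_mul]
  rw [h]; simp

/-- Move one factor `linForm v` across as a derivative, apply the product rule, and move the other
factor across in the term where it survives. -/
theorem jet_linForm_mul_sq (m : ℕ) (v : Fin d → ℝ) (f : MvPolynomial (Fin d) ℝ) :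
    jet (m + 2) (linForm v * f) ⬝ᵥ jet (m + 2) (linForm v * f) =
      (m + 2) * ((v ⬝ᵥ v) * (jet (m + 1) f ⬝ᵥ jet (m + 1) f) +
        (m + 1) * (jet m (dirDeriv v f) ⬝ᵥ jet m (dirDeriv v f))) := by
  have := jet_linForm_mul_dotProduct (m + 1) v f (linForm v * f)
  rw [this, dirDeriv_linForm_mul, map_add, dotProduct_add, map_smul, dotProduct_smul,
    dotProduct_comm _ (jet (m + 1) (linForm v * dirDeriv v f)),
    jet_linForm_mul_dotProduct m v]
  push_cast
  simp only [smul_eq_mul]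
  ring

/-- At the origin exactly one of the derivatives must hit the factor `X k`; the sum is over its
position. -/
theorem jet_X_mul_apply (m : ℕ) (k : Fin d) (f : MvPolynomial (Fin d) ℝ)
    (α : Fin (m + 1) → Fin d) :
    jet (m + 1) (X k * f) α =
      ∑ p : Fin (m + 1), if α p = k then jet m f (p.removeNth α) else 0 := by
  induction m generalizing f with
  | zero =>
    rw [jet_succ_apply, pderiv_X_mul]
    simp only [jet_zero_apply, coeff_add, coeff_zero_X_mul]
    by_cases h : α 0 = k <;> simp [h]
  | succ m ih =>
    rw [jet_succ_apply, pderiv_X_mul, map_add, Pi.add_apply, ih,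
      Fin.sum_univ_succ (n := m + 1)]
    congr 1
    · split_ifs <;> simp [Fin.removeNth_zero]
    · refine Finset.sum_congr rfl fun p _ => ?_
      have : Fin.tail (p.succ.removeNth α) = p.removeNth (Fin.tail α) := by
        ext i; simp [Fin.tail, Fin.removeNth]
      simp only [jet_succ_apply m f, this]
      simp only [Fin.tail, Fin.removeNth]
      rfl

theorem jet_linForm_mul_apply (m : ℕ) (v : Fin d → ℝ) (f : MvPolynomial (Fin d) ℝ)
    (α : Fin (m + 1) → Fin d) :
    jet (m + 1) (linForm v * f) α = ∑ p : Fin (m + 1), v (α p) * jet m f (p.removeNth α) := by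
  simp only [linForm, Finset.sum_mul, map_sum, smul_mul_assoc, map_smul, Finset.sum_apply,
    Pi.smul_apply, jet_X_mul_apply, smul_eq_mul, Finset.mul_sum]
  rw [Finset.sum_comm]
  simp

/-- A permutation amounts to the image `p` of `0` and a permutation of the remaining points, as in
the expansion of a permanent along a row. -/
theorem sum_perm_fin_succ {M : Type*} [AddCommMonoid M] (m : ℕ)
    (F : Equiv.Perm (Fin (m + 1)) → M) :
    ∑ π, F π = ∑ p : Fin (m + 1), ∑ σ : Equiv.Perm (Fin m),
      F (((finSuccEquiv' 0).trans (Equiv.optionCongr σ)).trans (finSuccEquiv' p).symm) := by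
  rw [← Fintype.sum_prod_type']
  symm
  refine Function.Bijective.sum_comp (e := fun x : Fin (m + 1) × Equiv.Perm (Fin m) =>
    (((finSuccEquiv' 0).trans (Equiv.optionCongr x.2)).trans (finSuccEquiv' x.1).symm)) ?_ F
  rw [Fintype.bijective_iff_injective_and_card]
  constructor
  · rintro ⟨p, σ⟩ ⟨q, τ⟩ h
    have h0 := congrArg (fun e => e 0) h
    have hp : p = q := by simpa using h0
    subst hp
    simp only [Prod.mk.injEq, true_and]
    ext i
    have h1 := congrArg (fun e => e i.succ) h
    simp only [Equiv.trans_apply, ← Fin.succAbove_zero_apply, finSuccEquiv'_succAbove,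
      EmbeddingLike.apply_eq_iff_eq, Equiv.optionCongr_apply, Option.map_some,
      Option.some.injEq] at h1
    rw [h1]
  · simp [Fintype.card_perm, Nat.factorial_succ]

/-- The derivative is a permanent, expanded here along its first row. -/
theorem jet_prod_linForm_apply (m : ℕ) (u : Fin m → Fin d → ℝ) (α : Fin m → Fin d) :
    jet m (∏ k, linForm (u k)) α = ∑ π : Equiv.Perm (Fin m), ∏ k, u k (α (π k)) := by
  induction m with
  | zero => simp [jet_zero_apply]
  | succ m ih =>
    rw [Fin.prod_univ_succ, jet_linForm_mul_apply, sum_perm_fin_succ]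
    refine Finset.sum_congr rfl fun p _ => ?_
    rw [ih, Finset.mul_sum]
    refine Finset.sum_congr rfl fun σ _ => ?_
    rw [Fin.prod_univ_succ]
    refine congrArg₂ (· * ·) ?_ (Finset.prod_congr rfl fun k _ => ?_)
    · simp
    · change u k.succ (α (p.succAbove (σ k))) = _
      rw [← Fin.succAbove_zero_apply (i := k)]
      simp only [Equiv.trans_apply, finSuccEquiv'_succAbove, Equiv.optionCongr_apply,
        Option.map_some, finSuccEquiv'_symm_some]

/-- The quadratic form `x ↦ ⟨v, x⟩² - ‖x‖²`. -/
noncomputable def quadForm (v : Fin d → ℝ) : MvPolynomial (Fin d) ℝ :=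
  linForm v * linForm v - ∑ k, X k * X k

theorem linForm_single (k : Fin d) : linForm (Pi.single k 1) = (X k : MvPolynomial (Fin d) ℝ) := by
  simp [linForm, Pi.single_apply]

theorem quadForm_eq_sum (v : Fin d → ℝ) :
    quadForm v = ∑ z : Fin d × Fin d, (v z.1 * v z.2 - if z.1 = z.2 then 1 else 0) •
      (linForm (Pi.single z.1 1) * linForm (Pi.single z.2 1)) := by
  simp only [linForm_single]
  simp only [quadForm, linForm, Fintype.sum_prod_type, sub_smul,
    Finset.sum_sub_distrib, Finset.sum_mul_sum, smul_mul_smul_comm]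
  congr 1
  simp [ite_smul]

theorem prod_fin_mul_two {M : Type*} [CommMonoid M] (k : ℕ) (F : Fin (k * 2) → M) :
    ∏ j, F j = ∏ r : Fin k, F (finProdFinEquiv (r, 0)) * F (finProdFinEquiv (r, 1)) := by
  rw [← finProdFinEquiv.prod_comp, Fintype.prod_prod_type]
  simp

/-- Expand every factor into products of coordinate forms and use the permanent formula; for a fixed
permutation the indicator functions collapse the sum over coordinates. This is the formula that the
program evaluates. -/
theorem jet_prod_quadForm_apply (k : ℕ) (v : Fin k → Fin d → ℝ) (α : Fin (k * 2) → Fin d) :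
    jet (k * 2) (∏ r, quadForm (v r)) α = ∑ π : Equiv.Perm (Fin (k * 2)), ∏ r,
      (v r (α (π (finProdFinEquiv (r, 0)))) * v r (α (π (finProdFinEquiv (r, 1)))) -
        if α (π (finProdFinEquiv (r, 0))) = α (π (finProdFinEquiv (r, 1))) then 1 else 0) := by
  simp only [quadForm_eq_sum, Finset.prod_univ_sum, Fintype.piFinset_univ, map_sum,
    Finset.sum_apply]
  have h : ∀ z : Fin k → Fin d × Fin d,
      jet (k * 2) (∏ r, (v r (z r).1 * v r (z r).2 - if (z r).1 = (z r).2 then (1 : ℝ) else 0) •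
        (linForm (Pi.single (z r).1 1) * linForm (Pi.single (z r).2 1))) α =
      ∑ π : Equiv.Perm (Fin (k * 2)), ∏ r,
        ((v r (z r).1 * v r (z r).2 - if (z r).1 = (z r).2 then (1 : ℝ) else 0) *
        if (α (π (finProdFinEquiv (r, 0))), α (π (finProdFinEquiv (r, 1)))) = z r
          then 1 else 0) := by
    intro z
    -- The linear forms are listed so that the two belonging to factor `r` occupy slots `(r, 0)` and
    -- `(r, 1)`.
    set u : Fin (k * 2) → Fin d → ℝ := fun j => Pi.single
      (if (finProdFinEquiv.symm j).2 = 0 then (z (finProdFinEquiv.symm j).1).1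
        else (z (finProdFinEquiv.symm j).1).2) 1 with hu
    have h1 : ∏ r, (linForm (Pi.single (z r).1 1) * linForm (Pi.single (z r).2 1)) =
        ∏ j, linForm (u j) := by
      rw [prod_fin_mul_two]
      simp only [hu, Equiv.symm_apply_apply, if_true, one_ne_zero, if_false]
    rw [Finset.prod_smul, h1, map_smul, Pi.smul_apply, jet_prod_linForm_apply, Finset.smul_sum]
    refine Finset.sum_congr rfl fun π _ => ?_
    rw [prod_fin_mul_two, smul_eq_mul, ← Finset.prod_mul_distrib]
    refine Finset.prod_congr rfl fun r _ => ?_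
    congr 1
    simp only [hu, Equiv.symm_apply_apply, if_true, Pi.single_apply, one_ne_zero, if_false,
      Prod.ext_iff, ite_and, mul_ite, mul_one, mul_zero]
    split_ifs <;> rfl
  simp only [h]
  rw [Finset.sum_comm]
  refine Finset.sum_congr rfl fun π _ => ?_
  rw [← Fintype.piFinset_univ, ← Finset.prod_univ_sum (fun _ : Fin k => Finset.univ)
    (fun r (z : Fin d × Fin d) => (v r z.1 * v r z.2 - if z.1 = z.2 then (1 : ℝ) else 0) *
      if (α (π (finProdFinEquiv (r, 0))), α (π (finProdFinEquiv (r, 1)))) = z then 1 else 0)]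
  refine Finset.prod_congr rfl fun r _ => ?_
  simp

/-- Directional derivatives of a power of `linForm x` are multiples of lower powers of it, so each
squared linear form contributes its value at `x`. The subtracted sum over coordinate directions
contributes `‖x‖²`. -/
theorem jet_quadForm_mul_dotProduct_pow (m : ℕ) (v x : Fin d → ℝ) (f : MvPolynomial (Fin d) ℝ) :
    jet (m + 2) (quadForm v * f) ⬝ᵥ jet (m + 2) (linForm x ^ (m + 2)) =
      ((m + 2) * (m + 1)) ^ 2 * ((v ⬝ᵥ x) ^ 2 - x ⬝ᵥ x) *
        (jet m f ⬝ᵥ jet m (linForm x ^ m)) := by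
  have key : ∀ u : Fin d → ℝ, jet (m + 2) (linForm u * (linForm u * f)) ⬝ᵥ
      jet (m + 2) (linForm x ^ (m + 2)) = ((m + 2) * (m + 1)) ^ 2 * (u ⬝ᵥ x) ^ 2 *
        (jet m f ⬝ᵥ jet m (linForm x ^ m)) := by
    intro u
    rw [jet_linForm_mul_dotProduct, dirDeriv_linForm_pow, map_smul, dotProduct_smul,
      jet_linForm_mul_dotProduct, dirDeriv_linForm_pow, map_smul, dotProduct_smul]
    push_cast
    simp only [smul_eq_mul]
    ring
  have hq : quadForm v * f = linForm v * (linForm v * f) -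
      ∑ k, linForm (Pi.single k 1) * (linForm (Pi.single k 1) * f) := by
    simp only [quadForm, linForm_single, sub_mul, Finset.sum_mul, mul_assoc]
  rw [hq, map_sub, sub_dotProduct, map_sum, sum_dotProduct, key]
  simp only [key, single_dotProduct, one_mul, ← Finset.sum_mul, ← Finset.mul_sum]
  rw [show x ⬝ᵥ x = ∑ k, x k ^ 2 from Finset.sum_congr rfl fun k _ => (sq _).symm]
  ring

theorem jet_prod_quadForm_dotProduct_pow {ι : Type*} (s : Finset ι)
    (a : ι → Fin d → ℝ) (x : Fin d → ℝ) {m : ℕ} (hm : m = s.card * 2) :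
    jet m (∏ i ∈ s, quadForm (a i)) ⬝ᵥ jet m (linForm x ^ m) =
      (m.factorial : ℝ) ^ 2 * ∏ i ∈ s, ((a i ⬝ᵥ x) ^ 2 - x ⬝ᵥ x) := by
  classical
  induction s using Finset.induction_on generalizing m with
  | empty =>
    obtain rfl : m = 0 := by simpa using hm
    simp [dotProduct, jet_zero_apply]
  | insert i s hi ih =>
    rw [Finset.card_insert_of_notMem hi] at hm
    obtain ⟨m, rfl⟩ : ∃ m', m = m' + 2 := ⟨m - 2, by omega⟩
    rw [Finset.prod_insert hi, Finset.prod_insert hi, jet_quadForm_mul_dotProduct_pow,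
      ih (by omega), Nat.factorial_succ, Nat.factorial_succ]
    push_cast
    ring

theorem jet_linForm_pow_dotProduct_self (x : Fin d → ℝ) (m : ℕ) :
    jet m (linForm x ^ m) ⬝ᵥ jet m (linForm x ^ m) = (m.factorial : ℝ) ^ 2 * (x ⬝ᵥ x) ^ m := by
  induction m with
  | zero => simp [dotProduct, jet_zero_apply]
  | succ m ih =>
    nth_rewrite 1 [pow_succ']
    rw [jet_linForm_mul_dotProduct, dirDeriv_linForm_pow, map_smul, dotProduct_smul, ih,
      Nat.factorial_succ, smul_eq_mul]
    push_cast
    ring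

/-- The sum of the rank one matrices of the jets of a family of polynomials. -/
noncomputable def jetGram {σ : Type*} (m : ℕ) (s : Finset σ) (g : σ → MvPolynomial (Fin d) ℝ) :
    Matrix (Fin m → Fin d) (Fin m → Fin d) ℝ :=
  ∑ j ∈ s, vecMulVec (jet m (g j)) (jet m (g j))

theorem jetGram_posSemidef {σ : Type*} (m : ℕ) (s : Finset σ) (g : σ → MvPolynomial (Fin d) ℝ) :
    (jetGram m s g).PosSemidef := by
  refine Matrix.posSemidef_sum s fun j _ => ?_
  simpa using posSemidef_vecMulVec_self_star (jet m (g j))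

theorem dotProduct_jetGram_mulVec {σ : Type*} (m : ℕ) (s : Finset σ)
    (g : σ → MvPolynomial (Fin d) ℝ) (e : (Fin m → Fin d) → ℝ) :
    e ⬝ᵥ jetGram m s g *ᵥ e = ∑ j ∈ s, (e ⬝ᵥ jet m (g j)) ^ 2 := by
  rw [jetGram, sum_mulVec, dotProduct_sum]
  refine Finset.sum_congr rfl fun j _ => ?_
  rw [vecMulVec_mulVec, dotProduct_comm (jet m (g j)) e]
  simp [dotProduct_smul, sq]

/-- The transpose of `jet_X_mul_apply`: multiplication by `X k` becomes slicing `e` at the index `k`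
in every position. -/
theorem dotProduct_jet_X_mul (m : ℕ) (k : Fin d) (f : MvPolynomial (Fin d) ℝ)
    (e : (Fin (m + 1) → Fin d) → ℝ) :
    e ⬝ᵥ jet (m + 1) (X k * f) =
      ∑ p : Fin (m + 1), (fun β => e (p.insertNth k β)) ⬝ᵥ jet m f := by
  simp only [dotProduct, jet_X_mul_apply, Finset.mul_sum]
  rw [Finset.sum_comm]
  refine Finset.sum_congr rfl fun p _ => ?_
  rw [← (Fin.insertNthEquiv (fun _ : Fin (m + 1) => Fin d) p).sum_comp, Fintype.sum_prod_type,
    Finset.sum_eq_single k]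
  · simp [Fin.insertNthEquiv]
  · intro x _ hx
    simp [hx]
  · simp

/-- Cut a unit eigenvector into slices, one for each position and index. Cauchy–Schwarz over the `m
+ 1` positions bounds the eigenvalue by `(m + 1)²` times a weighted sum of the old quadratic form
over the slices. The slices have total weight one, so Jensen's inequality applies to the `p`-th
power. Summing over the eigenbasis gives the full old trace for every slice, so `d` enters once and
not to the power `p`. -/
theorem trace_jetGram_X_mul_pow_le {σ : Type*} (m : ℕ) (s : Finset σ)
    (g : σ → MvPolynomial (Fin d) ℝ) (p : ℕ) :
    (jetGram (m + 1) (Finset.univ ×ˢ s) (fun z : Fin d × σ => X z.1 * g z.2) ^ p).trace ≤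
      ((m + 1 : ℝ) ^ 2) ^ p * (d * (jetGram m s g ^ p).trace) := by
  set A := jetGram (m + 1) (Finset.univ ×ˢ s) (fun z : Fin d × σ => X z.1 * g z.2) with hA
  set T := jetGram m s g with hT
  obtain ⟨U, l, hl, h1, h2, hU⟩ := (jetGram_posSemidef (m + 1) (Finset.univ ×ˢ s)
    (fun z : Fin d × σ => X z.1 * g z.2)).exists_diagonalization
  rw [← hA] at hU
  have htr : (A ^ p).trace = ∑ i, l i ^ p := by
    rw [hU, Matrix.mul_assoc, trace_mul_comm, Matrix.mul_assoc, h1, Matrix.mul_one, trace_diagonal]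
  set v : (Fin (m + 1) → Fin d) → Fin (m + 1) × Fin d → (Fin m → Fin d) → ℝ :=
    fun i z β => U (z.1.insertNth z.2 β) i with hv
  have hcol : ∀ i, Uᵀ i ⬝ᵥ A *ᵥ Uᵀ i = l i := by
    intro i
    have hd : Uᵀ * A * U = diagonal l := by
      have := hU 1
      simp only [pow_one] at this
      rw [this, ← Matrix.mul_assoc, ← Matrix.mul_assoc, h1, Matrix.one_mul, Matrix.mul_assoc, h1,
        Matrix.mul_one]
    have h := congrFun (congrFun hd i) i
    rw [diagonal_apply_eq, Matrix.mul_assoc, mul_apply_eq_vecMul] at h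
    rw [← h]
    simp [dotProduct, mulVec, vecMul, mul_apply]
  have hle : ∀ i, l i ≤ (m + 1 : ℝ) ^ 2 *
      ∑ z : Fin (m + 1) × Fin d, (1 / (m + 1 : ℝ)) * (v i z ⬝ᵥ T *ᵥ v i z) := by
    intro i
    rw [← hcol i, hA, dotProduct_jetGram_mulVec, Finset.sum_product, Fintype.sum_prod_type_right,
      Finset.mul_sum]
    refine Finset.sum_le_sum fun k _ => ?_
    simp only [hT, dotProduct_jetGram_mulVec, dotProduct_jet_X_mul, Finset.mul_sum]
    rw [Finset.sum_comm (s := (Finset.univ : Finset (Fin (m + 1))))]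
    refine Finset.sum_le_sum fun j _ => ?_
    refine (sq_sum_le_card_mul_sum_sq (s := Finset.univ) (α := ℝ) (f := fun q : Fin (m + 1) =>
      (fun β => Uᵀ i (q.insertNth k β)) ⬝ᵥ jet m (g j))).trans ?_
    rw [Finset.card_univ, Fintype.card_fin, Finset.mul_sum]
    refine Finset.sum_le_sum fun q _ => le_of_eq ?_
    have : (m + 1 : ℝ) ≠ 0 := by positivity
    push_cast
    field_simp
    rfl
  have hone : ∀ i, ∑ z : Fin (m + 1) × Fin d, (1 / (m + 1 : ℝ)) * (v i z ⬝ᵥ v i z) = 1 := by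
    intro i
    have h := congrFun (congrFun h1 i) i
    rw [one_apply_eq, mul_apply] at h
    rw [← Finset.mul_sum, Fintype.sum_prod_type]
    have h3 : ∀ q : Fin (m + 1), ∑ k, v i (q, k) ⬝ᵥ v i (q, k) = 1 := by
      intro q
      rw [← h, ← (Fin.insertNthEquiv (fun _ : Fin (m + 1) => Fin d) q).sum_comp,
        Fintype.sum_prod_type]
      rfl
    simp only [h3]
    have : (m + 1 : ℝ) ≠ 0 := by positivity
    simp [this]
  have hTp := (jetGram_posSemidef m s g)
  -- The slices at a fixed position and index are restricted rows of the orthogonal matrix `U`,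
  -- hence they resolve the identity.
  have hsum : ∀ z, ∑ i, v i z ⬝ᵥ (T ^ p) *ᵥ v i z = (T ^ p).trace := by
    intro z
    have e1 : ∀ i, v i z ⬝ᵥ (T ^ p) *ᵥ v i z =
        ∑ β, ∑ γ, (T ^ p) β γ * (v i z β * v i z γ) := by
      intro i
      simp only [dotProduct, mulVec, Finset.mul_sum]
      refine Finset.sum_congr rfl fun β _ => Finset.sum_congr rfl fun γ _ => ?_
      ring
    have e2 : ∀ β γ, ∑ i, v i z β * v i z γ = if β = γ then 1 else 0 := by
      intro β γ
      have h := congrFun (congrFun h2 (z.1.insertNth z.2 β)) (z.1.insertNth z.2 γ)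
      rw [mul_apply, one_apply] at h
      simp only [hv]
      simp only [transpose_apply] at h
      rw [h]
      by_cases hβ : β = γ
      · simp [hβ]
      · have : z.1.insertNth z.2 β ≠ (z.1.insertNth z.2 γ : Fin (m + 1) → Fin d) :=
          fun h => hβ (Fin.insertNth_right_injective _ h)
        simp [hβ, this]
    simp only [e1]
    rw [Finset.sum_comm]
    simp only [Finset.sum_comm (s := (Finset.univ : Finset (Fin (m + 1) → Fin d))),
      ← Finset.mul_sum, e2]
    simp [trace]
  calc (A ^ p).trace = ∑ i, l i ^ p := htr
    _ ≤ ∑ i, ((m + 1 : ℝ) ^ 2) ^ p *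
        ∑ z : Fin (m + 1) × Fin d, (1 / (m + 1 : ℝ)) * (v i z ⬝ᵥ (T ^ p) *ᵥ v i z) := by
      refine Finset.sum_le_sum fun i _ => ?_
      calc l i ^ p ≤ _ := pow_le_pow_left₀ (hl i) (hle i) p
        _ ≤ _ := by
          rw [mul_pow]
          refine mul_le_mul_of_nonneg_left ?_ (by positivity)
          exact sum_dotProduct_pow_le hTp _ _ (fun _ _ => by positivity) _ (hone i) p
    _ = _ := by
      rw [← Finset.mul_sum, Finset.sum_comm]
      simp only [← Finset.mul_sum, hsum]
      congr 1
      have : (m + 1 : ℝ) ≠ 0 := by positivity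
      simp
      field_simp

end Jets

/-! ### Moments of standard Gaussian vectors -/

section GaussianMoments

open MeasureTheory ProbabilityTheory

/-- The law of a vector of independent standard Gaussians. -/
noncomputable abbrev stdGauss (d : ℕ) : Measure (Fin d → ℝ) :=
  Measure.pi fun _ : Fin d => gaussianReal 0 1

variable {d : ℕ}

theorem memLp_eval_stdGauss (x : Fin d) : MemLp (fun b : Fin d → ℝ => b x) 2 (stdGauss d) :=
  (memLp_id_gaussianReal' 2 (by simp)).comp_measurePreserving (measurePreserving_eval _ x)

theorem integrable_eval_mul_eval (x y : Fin d) :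
    Integrable (fun b : Fin d → ℝ => b x * b y) (stdGauss d) :=
  (memLp_eval_stdGauss x).integrable_mul (memLp_eval_stdGauss y)

theorem integral_eval_stdGauss (x : Fin d) : ∫ b, b x ∂(stdGauss d) = 0 := by
  have h := integral_map (μ := stdGauss d) (φ := fun b => b x)
    (measurable_pi_apply x).aemeasurable
    (f := fun z : ℝ => z) (by fun_prop)
  rw [(measurePreserving_eval (fun _ : Fin d => gaussianReal 0 1) x).map_eq] at h
  rw [← h, integral_id_gaussianReal]

theorem integral_eval_mul_eval (x y : Fin d) :
    ∫ b, b x * b y ∂(stdGauss d) = if x = y then 1 else 0 := by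
  have h : ∀ b : Fin d → ℝ, b x * b y =
      ∏ i, ((if i = x then b i else 1) * (if i = y then b i else 1)) := by
    intro b
    rw [Finset.prod_mul_distrib]
    simp
  simp only [h]
  rw [integral_fintype_prod_eq_prod (𝕜 := ℝ) (μ := fun _ : Fin d => gaussianReal 0 1)
    (fun i z => (if i = x then z else 1) * (if i = y then z else 1))]
  split_ifs with hxy
  · subst hxy
    refine Finset.prod_eq_one fun i _ => ?_
    split_ifs with hi
    · have := variance_of_integral_eq_zero (X := id) (μ := gaussianReal 0 1) (by fun_prop)
        (by simp)
      rw [variance_id_gaussianReal] at this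
      simp only [id, pow_two] at this
      simpa using this.symm
    · simp
  · refine Finset.prod_eq_zero (Finset.mem_univ x) ?_
    simp [hxy]

theorem integrable_linear_sq (c : Fin d → ℝ) :
    Integrable (fun b : Fin d → ℝ => (∑ x, c x * b x) ^ 2) (stdGauss d) := by
  have : (fun b : Fin d → ℝ => (∑ x, c x * b x) ^ 2) =
      fun b => ∑ x, ∑ y, c x * c y * (b x * b y) := by
    ext b
    rw [sq, Finset.sum_mul_sum]
    refine Finset.sum_congr rfl fun x _ => Finset.sum_congr rfl fun y _ => ?_
    ring
  rw [this]
  exact integrable_finsetSum _ fun x _ => integrable_finsetSum _ fun y _ =>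
    (integrable_eval_mul_eval x y).const_mul _

theorem integral_linear_sq (c : Fin d → ℝ) :
    ∫ b, (∑ x, c x * b x) ^ 2 ∂(stdGauss d) = ∑ x, c x ^ 2 := by
  have : (fun b : Fin d → ℝ => (∑ x, c x * b x) ^ 2) =
      fun b => ∑ x, ∑ y, c x * c y * (b x * b y) := by
    ext b
    rw [sq, Finset.sum_mul_sum]
    refine Finset.sum_congr rfl fun x _ => Finset.sum_congr rfl fun y _ => ?_
    ring
  rw [this, integral_finsetSum _ fun x _ => integrable_finsetSum _ fun y _ =>
    (integrable_eval_mul_eval x y).const_mul _]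
  refine Finset.sum_congr rfl fun x _ => ?_
  rw [integral_finsetSum _ fun y _ => (integrable_eval_mul_eval x y).const_mul _]
  simp only [integral_const_mul, integral_eval_mul_eval]
  simp [sq]

theorem lintegral_linear_sq (c : Fin d → ℝ) :
    ∫⁻ b, ENNReal.ofReal ((∑ x, c x * b x) ^ 2) ∂(stdGauss d) = ENNReal.ofReal (∑ x, c x ^ 2) := by
  rw [← integral_linear_sq, ofReal_integral_eq_lintegral_ofReal (integrable_linear_sq c)]
  exact Filter.Eventually.of_forall fun b => sq_nonneg _

theorem lintegral_exp_linear (c : Fin d → ℝ) :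
    ∫⁻ b, ENNReal.ofReal (Real.exp (∑ x, c x * b x)) ∂(stdGauss d) =
      ENNReal.ofReal (Real.exp ((∑ x, c x ^ 2) / 2)) := by
  simp only [Real.exp_sum]
  rw [← ofReal_integral_eq_lintegral_ofReal]
  · rw [integral_fintype_prod_eq_prod (𝕜 := ℝ) (μ := fun _ : Fin d => gaussianReal 0 1)
      (fun x z => Real.exp (c x * z)), Finset.sum_div, Real.exp_sum]
    congr 1
    refine Finset.prod_congr rfl fun x _ => ?_
    have := congrFun (mgf_id_gaussianReal (μ := 0) (v := 1)) (c x)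
    simpa [mgf] using this
  · exact Integrable.fintype_prod (f := fun x z => Real.exp (c x * z))
      fun x => integrable_exp_mul_gaussianReal (c x)
  · exact Filter.Eventually.of_forall fun b => Finset.prod_nonneg fun x _ => (Real.exp_pos _).le

theorem pow_le_factorial_mul_exp {x : ℝ} (hx : 0 ≤ x) (k : ℕ) :
    x ^ k ≤ k.factorial * Real.exp x := by
  have h := Real.pow_div_factorial_le_exp x hx k
  rwa [div_le_iff₀ (by positivity), mul_comm] at h

theorem pow_two_mul_le_factorial_mul_exp_add (x : ℝ) (p : ℕ) :
    x ^ (2 * p) ≤ (2 * p).factorial * (Real.exp x + Real.exp (-x)) := by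
  rcases le_total 0 x with h | h
  · refine (pow_le_factorial_mul_exp h _).trans ?_
    have := Real.exp_pos (-x)
    gcongr
    linarith
  · have := pow_le_factorial_mul_exp (neg_nonneg.2 h) (2 * p)
    rw [Even.neg_pow (even_two_mul p)] at this
    refine this.trans ?_
    have := Real.exp_pos x
    gcongr
    linarith

/-- Bound the power by exponentials of `±l` times the form and use the Laplace transform. The
constant collects `(2p)! ≤ (2p)^(2p)` and `2e^p ≤ 6^p`. -/
theorem lintegral_linear_pow_le (c : Fin d → ℝ) {p : ℕ} (hp : 1 ≤ p) :
    ∫⁻ b, ENNReal.ofReal ((∑ x, c x * b x) ^ (2 * p)) ∂(stdGauss d) ≤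
      ENNReal.ofReal ((12 * p * ∑ x, c x ^ 2) ^ p) := by
  set S := ∑ x, c x ^ 2 with hS
  have hS0 : 0 ≤ S := Finset.sum_nonneg fun x _ => sq_nonneg _
  have hp0 : (0 : ℝ) < p := by exact_mod_cast hp
  rcases hS0.eq_or_lt with h0 | hpos
  · have hc : ∀ x, c x = 0 := by
      intro x
      have := (Finset.sum_eq_zero_iff_of_nonneg (fun x _ => sq_nonneg (c x))).1
        (hS.symm.trans h0.symm) x (Finset.mem_univ x)
      exact pow_eq_zero_iff (two_ne_zero) |>.1 this
    have : 2 * p ≠ 0 := by omega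
    simp [hc, this]
  -- With this `l` each of the two exponential moments is exactly `e^p`.
  set l := Real.sqrt (2 * p / S) with hl
  have hl2 : l ^ 2 = 2 * p / S := Real.sq_sqrt (by positivity)
  have hlpos : 0 < l := Real.sqrt_pos.2 (by positivity)
  have hpt : ∀ b : Fin d → ℝ, ENNReal.ofReal ((∑ x, c x * b x) ^ (2 * p)) ≤
      ENNReal.ofReal ((S / (2 * p)) ^ p * (2 * p).factorial) *
        (ENNReal.ofReal (Real.exp (∑ x, (l * c x) * b x)) +
          ENNReal.ofReal (Real.exp (∑ x, (-l * c x) * b x))) := by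
    intro b
    rw [← ENNReal.ofReal_add (Real.exp_pos _).le (Real.exp_pos _).le,
      ← ENNReal.ofReal_mul (by positivity)]
    refine ENNReal.ofReal_le_ofReal ?_
    have h := pow_two_mul_le_factorial_mul_exp_add (l * ∑ x, c x * b x) p
    rw [mul_pow, pow_mul l, hl2] at h
    have e : (S / (2 * p)) ^ p * (2 * p / S) ^ p = 1 := by
      rw [← mul_pow, div_mul_div_comm, mul_comm S, div_self (by positivity), one_pow]
    calc (∑ x, c x * b x) ^ (2 * p)
        = (S / (2 * p)) ^ p * ((2 * p / S) ^ p * (∑ x, c x * b x) ^ (2 * p)) := by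
          rw [← mul_assoc, e, one_mul]
      _ ≤ (S / (2 * p)) ^ p * ((2 * p).factorial * (Real.exp (l * ∑ x, c x * b x) +
            Real.exp (-(l * ∑ x, c x * b x)))) := by gcongr
      _ = _ := by
          simp only [neg_mul, mul_assoc, Finset.sum_neg_distrib, ← Finset.mul_sum]
  refine (lintegral_mono hpt).trans ?_
  have hm : ∀ e : Fin d → ℝ, Measurable fun b : Fin d → ℝ =>
      ENNReal.ofReal (Real.exp (∑ x, e x * b x)) := fun e => by fun_prop
  rw [lintegral_const_mul' _ _ ENNReal.ofReal_ne_top, lintegral_add_left (hm _),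
    lintegral_exp_linear,
    lintegral_exp_linear]
  have e1 : (∑ x, (l * c x) ^ 2) / 2 = p := by
    simp only [mul_pow, ← Finset.mul_sum, hl2, ← hS]; field_simp
  have e2 : (∑ x, (-l * c x) ^ 2) / 2 = p := by
    simp only [mul_pow, ← Finset.mul_sum, neg_sq, hl2, ← hS]; field_simp
  rw [e1, e2, ← ENNReal.ofReal_add (Real.exp_pos _).le (Real.exp_pos _).le,
      ← ENNReal.ofReal_mul (by positivity)]
  refine ENNReal.ofReal_le_ofReal ?_
  have hf : ((2 * p).factorial : ℝ) ≤ (2 * p : ℝ) ^ (2 * p) := by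
    exact_mod_cast Nat.factorial_le_pow (2 * p)
  have he : Real.exp p ≤ 3 ^ p := by
    rw [← Real.exp_one_pow]
    gcongr
    exact Real.exp_one_lt_three.le
  have h2 : (2 : ℝ) ≤ 2 ^ p := le_self_pow₀ (by norm_num) (by omega)
  calc (S / (2 * p)) ^ p * ((2 * p).factorial : ℝ) * (Real.exp p + Real.exp p)
      ≤ (S / (2 * p)) ^ p * (2 * p : ℝ) ^ (2 * p) * (2 ^ p * 3 ^ p) := by
        have : Real.exp p + Real.exp p ≤ 2 ^ p * 3 ^ p := by
          have := Real.exp_pos (p : ℝ)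
          nlinarith
        gcongr
    _ = (S / (2 * p) * (2 * p) ^ 2 * (2 * 3)) ^ p := by
        rw [pow_mul, ← mul_pow, ← mul_pow, ← mul_pow]
    _ = (12 * p * S) ^ p := by
        congr 1; field_simp; ring

/-- Convexity with weights proportional to the variances reduces to one linear form, so the number
of forms does not enter. -/
theorem lintegral_sum_linear_sq_pow_le {κ : Type*} [Fintype κ] (c : κ → Fin d → ℝ) {p : ℕ}
    (hp : 1 ≤ p) :
    ∫⁻ b, ENNReal.ofReal ((∑ j, (∑ x, c j x * b x) ^ 2) ^ p) ∂(stdGauss d) ≤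
      ENNReal.ofReal ((12 * p * ∑ j, ∑ x, c j x ^ 2) ^ p) := by
  set σ : κ → ℝ := fun j => ∑ x, c j x ^ 2 with hσ
  have hσ0 : ∀ j, 0 ≤ σ j := fun j => Finset.sum_nonneg fun x _ => sq_nonneg _
  set S := ∑ j, σ j with hS
  have hS0 : 0 ≤ S := Finset.sum_nonneg fun j _ => hσ0 j
  have hp0 : (0 : ℝ) < p := by exact_mod_cast hp
  have hpne : p ≠ 0 := by omega
  have hz : ∀ j, σ j = 0 → ∀ x, c j x = 0 := by
    intro j hj x
    have := (Finset.sum_eq_zero_iff_of_nonneg (fun x _ => sq_nonneg (c j x))).1 hj x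
      (Finset.mem_univ x)
    exact pow_eq_zero_iff (two_ne_zero) |>.1 this
  rcases hS0.eq_or_lt with h0 | hpos
  · have hc : ∀ j x, c j x = 0 := fun j => hz j <|
      (Finset.sum_eq_zero_iff_of_nonneg (fun j _ => hσ0 j)).1 (hS.symm.trans h0.symm) j
        (Finset.mem_univ j)
    simp [hc, hpne]
  have hpt : ∀ b : Fin d → ℝ, ENNReal.ofReal ((∑ j, (∑ x, c j x * b x) ^ 2) ^ p) ≤
      ∑ j, ENNReal.ofReal (σ j / S * (S / σ j) ^ p) *
        ENNReal.ofReal ((∑ x, c j x * b x) ^ (2 * p)) := by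
    intro b
    have h1 : ∀ j, 0 ≤ σ j / S * (S / σ j) ^ p := fun j =>
      mul_nonneg (div_nonneg (hσ0 j) hS0) (pow_nonneg (div_nonneg hS0 (hσ0 j)) _)
    simp only [← ENNReal.ofReal_mul (h1 _)]
    rw [← ENNReal.ofReal_sum_of_nonneg fun j _ => mul_nonneg (h1 j) (by
      rw [pow_mul]; positivity)]
    refine ENNReal.ofReal_le_ofReal ?_
    have hJ := Real.pow_arith_mean_le_arith_mean_pow Finset.univ (fun j => σ j / S)
      (fun j => S / σ j * (∑ x, c j x * b x) ^ 2) (fun j _ => div_nonneg (hσ0 j) hS0)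
      (by rw [← Finset.sum_div, ← hS, div_self hpos.ne'])
      (fun j _ => mul_nonneg (div_nonneg hS0 (hσ0 j)) (sq_nonneg _)) p
    have e1 : ∀ j, σ j / S * (S / σ j * (∑ x, c j x * b x) ^ 2) = (∑ x, c j x * b x) ^ 2 := by
      intro j
      by_cases hj : σ j = 0
      · simp [hz j hj]
      · field_simp
    simp only [e1] at hJ
    refine hJ.trans (le_of_eq (Finset.sum_congr rfl fun j _ => ?_))
    rw [mul_pow, pow_mul, mul_assoc]
  refine (lintegral_mono hpt).trans ?_
  rw [lintegral_finsetSum _ fun j _ => by fun_prop]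
  simp only [lintegral_const_mul' _ _ ENNReal.ofReal_ne_top]
  calc _ ≤ ∑ j, ENNReal.ofReal (σ j / S * (S / σ j) ^ p) *
        ENNReal.ofReal ((12 * p * σ j) ^ p) := by
        gcongr with j
        exact lintegral_linear_pow_le (c j) hp
    _ ≤ ∑ j, ENNReal.ofReal (σ j / S * (12 * p * S) ^ p) := by
        refine Finset.sum_le_sum fun j _ => ?_
        have h1 : 0 ≤ σ j / S * (S / σ j) ^ p :=
          mul_nonneg (div_nonneg (hσ0 j) hS0) (pow_nonneg (div_nonneg hS0 (hσ0 j)) _)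
        rw [← ENNReal.ofReal_mul h1]
        refine ENNReal.ofReal_le_ofReal (le_of_eq ?_)
        by_cases hj : σ j = 0
        · simp [hj]
        · rw [mul_assoc, ← mul_pow]
          congr 2
          field_simp
    _ = _ := by
        rw [← ENNReal.ofReal_sum_of_nonneg fun j _ => mul_nonneg (div_nonneg (hσ0 j) hS0)
          (by positivity), ← Finset.sum_mul, ← Finset.sum_div, ← hS, div_self hpos.ne', one_mul]

theorem integrable_exp_mul_sq_gaussianReal {θ : ℝ} (hθ : θ ≤ 1 / 4) :
    Integrable (fun z => Real.exp (θ * z ^ 2)) (gaussianReal 0 1) := by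
  have h : gaussianReal 0 1 = (volume : Measure ℝ).withDensity (gaussianPDF 0 1) :=
    gaussianReal_of_var_ne_zero _ one_ne_zero
  rw [h, integrable_withDensity_iff (measurable_gaussianPDF _ _)
    (Filter.Eventually.of_forall fun _ => gaussianPDF_lt_top)]
  have h2 := (integrable_exp_neg_mul_sq (b := 1 / 2 - θ) (by linarith)).const_mul
    ((Real.sqrt (2 * Real.pi))⁻¹)
  refine h2.congr (Filter.Eventually.of_forall fun z => ?_)
  simp only [toReal_gaussianPDF, gaussianPDFReal, NNReal.coe_one, mul_one, sub_zero]
  rw [mul_comm (Real.exp (θ * z ^ 2)), mul_assoc, ← Real.exp_add]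
  congr 2
  ring

/-- The integral is `(1 - 2θ)^(-1/2)`, so the bound reduces to `1 ≤ (1 - 2θ)(1 + 4θ)`, valid for `θ
≤ 1/4`. -/
theorem integral_exp_mul_sq_gaussianReal_le {θ : ℝ} (h0 : 0 ≤ θ) (hθ : θ ≤ 1 / 4) :
    ∫ z, Real.exp (θ * z ^ 2) ∂(gaussianReal 0 1) ≤ Real.exp (2 * θ) := by
  rw [integral_gaussianReal_eq_integral_smul one_ne_zero]
  have : ∀ z : ℝ, gaussianPDFReal 0 1 z • Real.exp (θ * z ^ 2) =
      (Real.sqrt (2 * Real.pi))⁻¹ * Real.exp (-(1 / 2 - θ) * z ^ 2) := by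
    intro z
    simp only [gaussianPDFReal, NNReal.coe_one, mul_one, sub_zero, smul_eq_mul]
    rw [mul_assoc, ← Real.exp_add]
    congr 2
    ring
  simp only [this]
  rw [integral_const_mul, integral_gaussian, ← Real.sqrt_inv, ← Real.sqrt_mul (by positivity)]
  rw [show (2 * Real.pi)⁻¹ * (Real.pi / (1 / 2 - θ)) = 1 / (1 - 2 * θ) by
    have := Real.pi_pos
    have h2 : 1 - 2 * θ ≠ 0 := by linarith
    have h3 : 1 / 2 - θ ≠ 0 := by linarith
    field_simp]
  rw [Real.sqrt_le_left (Real.exp_pos _).le, ← Real.exp_nat_mul, div_le_iff₀ (by linarith)]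
  have := Real.add_one_le_exp (((2 : ℕ) : ℝ) * (2 * θ))
  push_cast at this ⊢
  nlinarith

theorem lintegral_sum_sq_pow_le (d : ℕ) {p : ℕ} (hp : 1 ≤ p) :
    ∫⁻ b, ENNReal.ofReal ((∑ x, b x ^ 2) ^ p) ∂(stdGauss d) ≤
      ENNReal.ofReal ((8 * (d + p : ℝ)) ^ p) := by
  have hp0 : (0 : ℝ) < p := by exact_mod_cast hp
  have hd0 : (0 : ℝ) ≤ d := by positivity
  set L : ℝ := 4 * (d + p) with hL
  have hLpos : 0 < L := by positivity
  -- This keeps `θ ≤ 1/4`, as well as `2dθ ≤ p/2`, so that the exponential moment stays below `2^p`.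
  set θ : ℝ := p / L with hθ
  have hθ0 : 0 < θ := by positivity
  have hθ4 : θ ≤ 1 / 4 := by
    rw [hθ, div_le_iff₀ hLpos, hL]; linarith
  have hpt : ∀ b : Fin d → ℝ, ENNReal.ofReal ((∑ x, b x ^ 2) ^ p) ≤
      ENNReal.ofReal (L ^ p) * ENNReal.ofReal (∏ x, Real.exp (θ * b x ^ 2)) := by
    intro b
    have hb : 0 ≤ ∑ x, b x ^ 2 := Finset.sum_nonneg fun x _ => sq_nonneg _
    rw [← ENNReal.ofReal_mul (by positivity), ← Real.exp_sum, ← Finset.mul_sum]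
    refine ENNReal.ofReal_le_ofReal ?_
    have h := pow_le_factorial_mul_exp (mul_nonneg hθ0.le hb) p
    have hf : (p.factorial : ℝ) ≤ (p : ℝ) ^ p := by exact_mod_cast Nat.factorial_le_pow p
    have e : (∑ x, b x ^ 2) ^ p = (θ⁻¹) ^ p * (θ * ∑ x, b x ^ 2) ^ p := by
      rw [← mul_pow, inv_mul_cancel_left₀ hθ0.ne']
    rw [e]
    calc (θ⁻¹) ^ p * (θ * ∑ x, b x ^ 2) ^ p
        ≤ (θ⁻¹) ^ p * ((p : ℝ) ^ p * Real.exp (θ * ∑ x, b x ^ 2)) := by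
          gcongr
          exact h.trans (by gcongr)
      _ = _ := by
          rw [← mul_assoc, ← mul_pow]
          congr 2
          rw [hθ]; field_simp
  refine (lintegral_mono hpt).trans ?_
  rw [lintegral_const_mul' _ _ ENNReal.ofReal_ne_top, ← ofReal_integral_eq_lintegral_ofReal
    (Integrable.fintype_prod (f := fun _ z => Real.exp (θ * z ^ 2))
      fun x => integrable_exp_mul_sq_gaussianReal hθ4)
    (Filter.Eventually.of_forall fun b => Finset.prod_nonneg fun x _ => (Real.exp_pos _).le),
    integral_fintype_prod_eq_prod (𝕜 := ℝ) (μ := fun _ : Fin d => gaussianReal 0 1)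
      (fun _ z => Real.exp (θ * z ^ 2)), ← ENNReal.ofReal_mul (by positivity)]
  refine ENNReal.ofReal_le_ofReal ?_
  have h1 : ∏ _x : Fin d, ∫ z, Real.exp (θ * z ^ 2) ∂(gaussianReal 0 1) ≤ 2 ^ p := by
    calc _ ≤ ∏ _x : Fin d, Real.exp (2 * θ) := by
          refine Finset.prod_le_prod (fun _ _ => integral_nonneg fun z => (Real.exp_pos _).le)
            fun _ _ => integral_exp_mul_sq_gaussianReal_le hθ0.le hθ4
      _ = Real.exp (d * (2 * θ)) := by
          rw [Finset.prod_const, Finset.card_univ, Fintype.card_fin, ← Real.exp_nat_mul]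
      _ ≤ Real.exp (p * (1 / 2)) := by
          refine Real.exp_le_exp.2 ?_
          rw [hθ, hL]
          have : (d : ℝ) * (2 * (p / (4 * (d + p)))) = p * (1 / 2) * (d / (d + p)) := by
            field_simp; ring
          rw [this]
          have : (d : ℝ) / (d + p) ≤ 1 := by
            rw [div_le_one (by positivity)]; linarith
          nlinarith
      _ = Real.exp (1 / 2) ^ p := by rw [← Real.exp_nat_mul]
      _ ≤ 2 ^ p := by
          gcongr
          have h := Real.exp_one_lt_three
          have : Real.exp (1 / 2) ^ 2 = Real.exp 1 := by
            rw [← Real.exp_nat_mul]; norm_num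
          nlinarith [Real.exp_pos (1 / 2)]
  calc L ^ p * _ ≤ L ^ p * 2 ^ p := by gcongr
    _ = _ := by rw [← mul_pow, hL]; congr 1; ring

end GaussianMoments

/-! ### Random quadratic factors -/

section Decoupling

open MeasureTheory ProbabilityTheory MvPolynomial Matrix

variable {d : ℕ}

instance isGaussian_stdGauss (d : ℕ) : IsGaussian (stdGauss d) := by
  have h := iIndepFun.hasGaussianLaw (P := stdGauss d) (X := fun (x : Fin d) b => b x)
    (fun x => ⟨by
      have := (measurePreserving_eval (fun _ : Fin d => gaussianReal 0 1) x).map_eq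
      change IsGaussian ((stdGauss d).map (Function.eval x))
      rw [this]; infer_instance⟩)
    (iIndepFun_pi (μ := fun _ : Fin d => gaussianReal 0 1) (X := fun _ z => z)
      fun _ => aemeasurable_id)
  have h2 := h.isGaussian_map
  have : (fun (b : Fin d → ℝ) (x : Fin d) => b x) = id := rfl
  rwa [this, Measure.map_id] at h2

theorem convexOn_sum_sq_pow {κ : Type*} [Fintype κ] (p : ℕ) :
    ConvexOn ℝ Set.univ fun z : κ → ℝ => (∑ c, z c ^ 2) ^ p := by
  have h := (((convexOn_norm (convex_univ (𝕜 := ℝ) (E := EuclideanSpace ℝ κ))).comp_linearMap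
    (WithLp.linearEquiv 2 ℝ (κ → ℝ)).symm.toLinearMap).pow (fun _ _ => norm_nonneg _) (2 * p))
  refine h.congr fun z _ => ?_
  simp only [Pi.pow_apply, Function.comp_apply]
  rw [pow_mul, EuclideanSpace.norm_sq_eq]
  simp

/-- Rotation by 45 degrees preserves a product of two centred copies of the same Gaussian law. -/
theorem lintegral_prod_rotation (f : (Fin d → ℝ) × (Fin d → ℝ) → ENNReal) (hf : Measurable f) :
    ∫⁻ v, ∫⁻ w, f (v, w) ∂(stdGauss d) ∂(stdGauss d) =
      ∫⁻ b, ∫⁻ b', f ((Real.sqrt 2 / 2) • (b + b'), (Real.sqrt 2 / 2) • (b' - b)) ∂(stdGauss d)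
        ∂(stdGauss d) := by
  have hmean : (stdGauss d)[id] = 0 := by
    ext x
    change (∫ b : Fin d → ℝ, b ∂(stdGauss d)) x = 0
    rw [eval_integral (fun x => (memLp_eval_stdGauss x).integrable one_le_two)]
    exact integral_eval_stdGauss x
  have hR := IsGaussian.map_rotation_eq_self hmean (Real.pi / 4)
  rw [← lintegral_prod _ hf.aemeasurable]
  nth_rewrite 1 [← hR]
  rw [lintegral_map hf (by fun_prop), lintegral_prod _ (by fun_prop)]
  simp only [ContinuousLinearMap.rotation_apply, Real.cos_pi_div_four, Real.sin_pi_div_four]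
  simp only [smul_add, smul_sub, neg_smul, neg_add_eq_sub]

/-- Decoupling. The identity matrix is the mean of `w wᵀ` for an independent copy `w`, so Jensen's
inequality passes to `v vᵀ - w wᵀ`. A rotation by 45 degrees turns this into `b b'ᵀ + b' bᵀ`, which
a symmetric `B` sees as twice `b b'ᵀ`. -/
theorem lintegral_quadratic_pow_le {κ : Type*} [Fintype κ] (B : κ → Fin d → Fin d → ℝ)
    (hB : ∀ c x y, B c x y = B c y x) (p : ℕ) :
    ∫⁻ v, ENNReal.ofReal ((∑ c, (∑ x, ∑ y, B c x y *
        (v x * v y - if x = y then 1 else 0)) ^ 2) ^ p) ∂(stdGauss d) ≤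
      ∫⁻ b, ∫⁻ b', ENNReal.ofReal ((∑ c, (2 * ∑ x, ∑ y, B c x y * (b x * b' y)) ^ 2) ^ p)
        ∂(stdGauss d) ∂(stdGauss d) := by
  set Φ : (κ → ℝ) → ℝ := fun z => (∑ c, z c ^ 2) ^ p with hΦ
  have hΦ0 : ∀ z, 0 ≤ Φ z := fun z => by positivity
  have hΦc : Continuous Φ := by fun_prop
  set H : (Fin d → ℝ) × (Fin d → ℝ) → κ → ℝ := fun z c =>
    ∑ x, ∑ y, B c x y * (z.1 x * z.1 y - z.2 x * z.2 y) with hH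
  have hHc : Continuous H := by fun_prop
  have step : ∀ v : Fin d → ℝ, ENNReal.ofReal (Φ fun c => ∑ x, ∑ y, B c x y *
        (v x * v y - if x = y then 1 else 0)) ≤
      ∫⁻ w, ENNReal.ofReal (Φ (H (v, w))) ∂(stdGauss d) := by
    intro v
    by_cases htop : ∫⁻ w, ENNReal.ofReal (Φ (H (v, w))) ∂(stdGauss d) = ⊤
    -- When the right side is infinite nothing is to be shown; otherwise it supplies the
    -- integrability that Jensen's inequality needs.
    · rw [htop]; exact le_top
    have hint : Integrable (fun w => Φ (H (v, w))) (stdGauss d) := by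
      refine ⟨(by fun_prop : Continuous fun w => Φ (H (v, w))).aestronglyMeasurable, ?_⟩
      rw [hasFiniteIntegral_iff_ofReal (Filter.Eventually.of_forall fun w => hΦ0 _)]
      exact lt_top_iff_ne_top.2 htop
    have hsub : ∀ c x y, Integrable (fun w : Fin d → ℝ => B c x y * (v x * v y - w x * w y))
        (stdGauss d) := fun c x y =>
      Integrable.const_mul (f := fun w : Fin d → ℝ => v x * v y - w x * w y)
        ((integrable_const _).sub (integrable_eval_mul_eval x y)) _
    have hHi : ∀ c, Integrable (fun w => H (v, w) c) (stdGauss d) := fun c =>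
      integrable_finsetSum _ fun x _ => integrable_finsetSum _ fun y _ => hsub c x y
    have hJ := (convexOn_sum_sq_pow (κ := κ) p).map_integral_le hΦc.continuousOn isClosed_univ
      (Filter.Eventually.of_forall fun w => Set.mem_univ (H (v, w))) (Integrable.of_eval hHi) hint
    rw [← ofReal_integral_eq_lintegral_ofReal hint (Filter.Eventually.of_forall fun w => hΦ0 _)]
    refine ENNReal.ofReal_le_ofReal (le_of_eq_of_le ?_ hJ)
    simp only [hΦ]
    congr 1
    refine Finset.sum_congr rfl fun c _ => ?_
    congr 1
    rw [eval_integral hHi]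
    simp only [hH]
    rw [integral_finsetSum _ fun x _ => integrable_finsetSum _ fun y _ => hsub c x y]
    refine Finset.sum_congr rfl fun x _ => ?_
    rw [integral_finsetSum _ fun y _ => hsub c x y]
    refine Finset.sum_congr rfl fun y _ => ?_
    rw [integral_const_mul, integral_sub (integrable_const _) (integrable_eval_mul_eval x y),
      integral_eval_mul_eval]
    simp
  refine (lintegral_mono step).trans (le_of_eq ?_)
  rw [lintegral_prod_rotation (fun z => ENNReal.ofReal (Φ (H z))) (by fun_prop)]
  refine lintegral_congr fun b => lintegral_congr fun b' => ?_
  congr 2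
  ext c
  simp only [hH, Pi.smul_apply, Pi.add_apply, Pi.sub_apply, smul_eq_mul]
  have h2 : Real.sqrt 2 * Real.sqrt 2 = 2 := Real.mul_self_sqrt (by norm_num)
  have e : ∀ x y, B c x y * (Real.sqrt 2 / 2 * (b x + b' x) * (Real.sqrt 2 / 2 * (b y + b' y)) -
      Real.sqrt 2 / 2 * (b' x - b x) * (Real.sqrt 2 / 2 * (b' y - b y))) =
      B c x y * (b x * b' y) + B c y x * (b y * b' x) := by
    intro x y
    rw [hB c y x]
    linear_combination (B c x y * ((b x + b' x) * (b y + b' y) - (b' x - b x) * (b' y - b y)) / 4)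
      * h2
  simp only [e, Finset.sum_add_distrib]
  rw [Finset.sum_comm (f := fun x y => B c y x * (b y * b' x)), two_mul]

theorem map_quadForm_mul (L : MvPolynomial (Fin d) ℝ →ₗ[ℝ] ℝ) (v : Fin d → ℝ)
    (f : MvPolynomial (Fin d) ℝ) :
    L (quadForm v * f) = ∑ x, ∑ y, L (X x * (X y * f)) * (v x * v y - if x = y then 1 else 0) := by
  simp only [quadForm_eq_sum, linForm_single, Finset.sum_mul, map_sum, smul_mul_assoc, map_smul,
    Fintype.sum_prod_type, smul_eq_mul, mul_assoc]
  refine Finset.sum_congr rfl fun x _ => Finset.sum_congr rfl fun y _ => ?_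
  ring

theorem map_linForm_mul_linForm_mul (L : MvPolynomial (Fin d) ℝ →ₗ[ℝ] ℝ) (b c : Fin d → ℝ)
    (f : MvPolynomial (Fin d) ℝ) :
    L (linForm b * (linForm c * f)) = ∑ x, ∑ y, L (X x * (X y * f)) * (b x * c y) := by
  simp only [linForm, Finset.sum_mul, Finset.mul_sum, map_sum, smul_mul_assoc, mul_smul_comm,
    map_smul, smul_eq_mul]
  rw [Finset.sum_comm]
  refine Finset.sum_congr rfl fun x _ => Finset.sum_congr rfl fun y _ => ?_
  ring

/-- Decouple with exponent one, then integrate out the two vectors in turn; the `4` is the square of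
the decoupling factor. -/
theorem lintegral_map_quadForm_mul_sq_le (L : MvPolynomial (Fin d) ℝ →ₗ[ℝ] ℝ)
    (f : MvPolynomial (Fin d) ℝ) :
    ∫⁻ v, ENNReal.ofReal (L (quadForm v * f) ^ 2) ∂(stdGauss d) ≤
      ENNReal.ofReal (4 * ∑ x, ∑ y, L (X x * (X y * f)) ^ 2) := by
  have h := lintegral_quadratic_pow_le (κ := Unit) (fun _ x y => L (X x * (X y * f)))
    (fun _ x y => by rw [mul_left_comm]) 1
  simp only [Finset.univ_unique, Finset.sum_singleton, pow_one, ← map_quadForm_mul] at h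
  refine h.trans (le_of_eq ?_)
  have e : ∀ b c : Fin d → ℝ, 2 * ∑ x, ∑ y, L (X x * (X y * f)) * (b x * c y) =
      ∑ y, (2 * ∑ x, L (X x * (X y * f)) * b x) * c y := by
    intro b c
    rw [Finset.sum_comm, Finset.mul_sum]
    refine Finset.sum_congr rfl fun y _ => ?_
    rw [mul_assoc, Finset.sum_mul]
    simp only [mul_assoc]
  simp only [e, lintegral_linear_sq]
  have e2 : ∀ b : Fin d → ℝ, ENNReal.ofReal (∑ y, (2 * ∑ x, L (X x * (X y * f)) * b x) ^ 2) =
      ENNReal.ofReal 4 * ∑ y, ENNReal.ofReal ((∑ x, L (X x * (X y * f)) * b x) ^ 2) := by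
    intro b
    rw [← ENNReal.ofReal_sum_of_nonneg fun _ _ => sq_nonneg _, ← ENNReal.ofReal_mul (by norm_num),
      Finset.mul_sum]
    congr 1
    exact Finset.sum_congr rfl fun y _ => by ring
  simp only [e2]
  rw [lintegral_const_mul' _ _ ENNReal.ofReal_ne_top, ENNReal.ofReal_mul (by norm_num),
    lintegral_finsetSum _ fun y _ => by fun_prop, Finset.sum_comm,
    ENNReal.ofReal_sum_of_nonneg fun _ _ => Finset.sum_nonneg fun _ _ => sq_nonneg _]
  simp only [lintegral_linear_sq]

theorem trace_jetGram_mul {σ : Type*} (m : ℕ) (s : Finset σ) (g : σ → MvPolynomial (Fin d) ℝ)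
    (N : Matrix (Fin m → Fin d) (Fin m → Fin d) ℝ) :
    (jetGram m s g * (Nᵀ * N)).trace = ∑ j ∈ s, ∑ c, (N c ⬝ᵥ jet m (g j)) ^ 2 := by
  rw [jetGram, Finset.sum_mul, trace_sum]
  refine Finset.sum_congr rfl fun j _ => ?_
  rw [vecMulVec_mul, trace_vecMulVec, ← vecMul_vecMul, vecMul_transpose, dotProduct_comm,
    ← dotProduct_mulVec, dotProduct]
  refine Finset.sum_congr rfl fun c _ => ?_
  rw [sq]
  rfl

theorem _root_.Matrix.PosSemidef.exists_transpose_mul_self {ι : Type*} [Fintype ι] [DecidableEq ι]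
    {M : Matrix ι ι ℝ} (hM : M.PosSemidef) : ∃ N : Matrix ι ι ℝ, M = Nᵀ * N := by
  obtain ⟨U, l, hl, -, -, hU⟩ := hM.exists_diagonalization
  refine ⟨diagonal (fun i => √(l i)) * Uᵀ, ?_⟩
  have h1 := hU 1
  rw [pow_one] at h1
  rw [h1, transpose_mul, transpose_transpose, diagonal_transpose, Matrix.mul_assoc,
    Matrix.mul_assoc, ← Matrix.mul_assoc (diagonal _) (diagonal _), diagonal_mul_diagonal]
  simp only [Real.mul_self_sqrt (hl _)]
  congr 3
  ext i
  simp

/-- Writing `M = NᵀN` makes the trace a sum of squares of linear functionals of the polynomials, and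
each of them is averaged separately. -/
theorem lintegral_trace_quadForm_mul_le {σ : Type*} (m : ℕ) (s : Finset σ)
    (g : σ → MvPolynomial (Fin d) ℝ) {M : Matrix (Fin m → Fin d) (Fin m → Fin d) ℝ}
    (hM : M.PosSemidef) :
    ∫⁻ v, ENNReal.ofReal ((jetGram m s (fun j => quadForm v * g j) * M).trace) ∂(stdGauss d) ≤
      ENNReal.ofReal (4 * (jetGram m (Finset.univ ×ˢ (Finset.univ ×ˢ s))
        (fun z : Fin d × Fin d × σ => X z.1 * (X z.2.1 * g z.2.2)) * M).trace) := by
  obtain ⟨N, rfl⟩ := hM.exists_transpose_mul_self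
  simp only [trace_jetGram_mul]
  set L : (Fin m → Fin d) → MvPolynomial (Fin d) ℝ →ₗ[ℝ] ℝ := fun c =>
    (dotProductBilin ℝ ℝ (N c)) ∘ₗ jet m with hL
  have hLe : ∀ c f, N c ⬝ᵥ jet m f = L c f := fun c f => rfl
  simp only [hLe]
  have h0 : ∀ v : Fin d → ℝ, ENNReal.ofReal (∑ j ∈ s, ∑ c, L c (quadForm v * g j) ^ 2) =
      ∑ j ∈ s, ∑ c, ENNReal.ofReal (L c (quadForm v * g j) ^ 2) := by
    intro v
    rw [ENNReal.ofReal_sum_of_nonneg fun _ _ => Finset.sum_nonneg fun _ _ => sq_nonneg _]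
    simp only [ENNReal.ofReal_sum_of_nonneg fun _ _ => sq_nonneg _]
  simp only [h0]
  have hmeas : ∀ c j, Measurable fun v : Fin d → ℝ =>
      ENNReal.ofReal (L c (quadForm v * g j) ^ 2) := by
    intro c j
    simp only [map_quadForm_mul]
    fun_prop
  rw [lintegral_finsetSum _ fun j _ => Finset.measurable_fun_sum _ fun c _ => hmeas c j]
  simp only [lintegral_finsetSum _ fun c _ => hmeas c _]
  calc _ ≤ ∑ j ∈ s, ∑ c, ENNReal.ofReal (4 * ∑ x, ∑ y, L c (X x * (X y * g j)) ^ 2) := by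
        gcongr with j _ c
        exact lintegral_map_quadForm_mul_sq_le (L c) (g j)
    _ = _ := by
        have hnn : ∀ c j, 0 ≤ 4 * ∑ x, ∑ y, L c (X x * (X y * g j)) ^ 2 := fun c j => by positivity
        simp only [← ENNReal.ofReal_sum_of_nonneg fun _ _ => hnn _ _]
        rw [← ENNReal.ofReal_sum_of_nonneg fun _ _ => Finset.sum_nonneg fun _ _ => hnn _ _]
        congr 1
        simp only [← Finset.mul_sum]
        congr 1
        simp only [Finset.sum_product]
        rw [Finset.sum_comm]
        have : ∀ c, ∑ j ∈ s, ∑ x, ∑ y, L c (X x * (X y * g j)) ^ 2 =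
            ∑ x, ∑ y, ∑ j ∈ s, L c (X x * (X y * g j)) ^ 2 := by
          intro c
          rw [Finset.sum_comm]
          exact Finset.sum_congr rfl fun x _ => Finset.sum_comm
        simp only [this]
        rw [Finset.sum_comm]
        refine Finset.sum_congr rfl fun x _ => ?_
        rw [Finset.sum_comm]
        exact Finset.sum_congr rfl fun y _ => Finset.sum_comm

theorem jet_dirDeriv_apply (m : ℕ) (b : Fin d → ℝ) (f : MvPolynomial (Fin d) ℝ)
    (β : Fin m → Fin d) : jet m (dirDeriv b f) β = ∑ x, jet m (pderiv x f) β * b x := by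
  simp only [dirDeriv, map_sum, Finset.sum_apply, map_smul, Pi.smul_apply, smul_eq_mul]
  exact Finset.sum_congr rfl fun x _ => mul_comm _ _

theorem lintegral_jet_dirDeriv_pow_le (m : ℕ) (f : MvPolynomial (Fin d) ℝ) {p : ℕ} (hp : 1 ≤ p) :
    ∫⁻ b, ENNReal.ofReal ((jet m (dirDeriv b f) ⬝ᵥ jet m (dirDeriv b f)) ^ p) ∂(stdGauss d) ≤
      ENNReal.ofReal ((12 * p * (jet (m + 1) f ⬝ᵥ jet (m + 1) f)) ^ p) := by
  have h := lintegral_sum_linear_sq_pow_le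
    (fun (β : Fin m → Fin d) x => jet m (pderiv x f) β) hp
  simp only [← jet_dirDeriv_apply] at h
  have e : ∀ g : MvPolynomial (Fin d) ℝ, jet m g ⬝ᵥ jet m g = ∑ β, jet m g β ^ 2 := fun g =>
    Finset.sum_congr rfl fun β _ => (sq _).symm
  rw [jet_succ_dotProduct]
  simp only [e]
  rwa [Finset.sum_comm] at h

/-- The norm formula splits into `‖b‖²` times the old norm, with moments of order `d + p`, and the
jet of a directional derivative, which is linear in `b` and has moments of order `p`. For jets of
order one the second part is absent. -/
theorem lintegral_jet_linForm_mul_pow_le (m : ℕ) (f : MvPolynomial (Fin d) ℝ) {p : ℕ}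
    (hp : 1 ≤ p) :
    ∫⁻ b, ENNReal.ofReal ((jet (m + 1) (linForm b * f) ⬝ᵥ jet (m + 1) (linForm b * f)) ^ p)
        ∂(stdGauss d) ≤
      ENNReal.ofReal (((m + 1) * (24 * (d + p * (m + 1)))) ^ p * (jet m f ⬝ᵥ jet m f) ^ p) := by
  have hp0 : (0 : ℝ) < p := by exact_mod_cast hp
  have hd0 : (0 : ℝ) ≤ d := by positivity
  have hnn : ∀ k (g : MvPolynomial (Fin d) ℝ), 0 ≤ jet k g ⬝ᵥ jet k g := fun k g =>
    Finset.sum_nonneg fun _ _ => mul_self_nonneg _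
  have hvv : ∀ b : Fin d → ℝ, b ⬝ᵥ b = ∑ x, b x ^ 2 := fun b =>
    Finset.sum_congr rfl fun x _ => (sq _).symm
  rcases m with _ | m
  · have h0 := hnn 0 f
    have e : ∀ b : Fin d → ℝ, jet (0 + 1) (linForm b * f) ⬝ᵥ jet (0 + 1) (linForm b * f) =
        (∑ x, b x ^ 2) * (jet 0 f ⬝ᵥ jet 0 f) := fun b => by
      rw [← hvv]; exact jet_linForm_mul_sq_one b f
    simp only [e, mul_pow]
    simp only [ENNReal.ofReal_mul' (pow_nonneg h0 p)]
    rw [lintegral_mul_const' _ _ ENNReal.ofReal_ne_top]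
    gcongr
    refine (lintegral_sum_sq_pow_le d hp).trans (ENNReal.ofReal_le_ofReal ?_)
    rw [← mul_pow, ← mul_pow]
    refine pow_le_pow_left₀ (by positivity) ?_ p
    push_cast
    linarith
  · set F := jet (m + 1) f ⬝ᵥ jet (m + 1) f with hF
    have hF0 : 0 ≤ F := hnn _ f
    have hpt : ∀ b : Fin d → ℝ, ENNReal.ofReal ((jet (m + 2) (linForm b * f) ⬝ᵥ
        jet (m + 2) (linForm b * f)) ^ p) ≤
        ENNReal.ofReal ((2 * (m + 2) * F) ^ p) * ENNReal.ofReal ((∑ x, b x ^ 2) ^ p) +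
        ENNReal.ofReal ((2 * (m + 2) * (m + 1)) ^ p) *
          ENNReal.ofReal ((jet m (dirDeriv b f) ⬝ᵥ jet m (dirDeriv b f)) ^ p) := by
      intro b
      have hb : 0 ≤ ∑ x, b x ^ 2 := Finset.sum_nonneg fun _ _ => sq_nonneg _
      have hD := hnn m (dirDeriv b f)
      rw [← ENNReal.ofReal_mul (by positivity), ← ENNReal.ofReal_mul (by positivity),
        ← ENNReal.ofReal_add (by positivity) (by positivity)]
      refine ENNReal.ofReal_le_ofReal ?_
      rw [jet_linForm_mul_sq, ← hF, hvv, mul_pow]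
      have h1 := add_pow_le (mul_nonneg hb hF0)
        (mul_nonneg (by positivity : (0 : ℝ) ≤ m + 1) hD) p
      have h2 : (2 : ℝ) ^ (p - 1) ≤ 2 ^ p := pow_le_pow_right₀ (by norm_num) (by omega)
      calc _ ≤ ((m : ℝ) + 2) ^ p * (2 ^ p * (((∑ x, b x ^ 2) * F) ^ p +
              ((m + 1) * (jet m (dirDeriv b f) ⬝ᵥ jet m (dirDeriv b f))) ^ p)) := by
            gcongr
            exact h1.trans (by gcongr)
        _ = _ := by simp only [mul_pow]; ring
    have hmeas : Measurable fun b : Fin d → ℝ =>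
        ENNReal.ofReal ((2 * (m + 2) * F) ^ p) * ENNReal.ofReal ((∑ x, b x ^ 2) ^ p) := by
      fun_prop
    refine (lintegral_mono hpt).trans ?_
    rw [lintegral_add_left hmeas, lintegral_const_mul' _ _ ENNReal.ofReal_ne_top,
      lintegral_const_mul' _ _ ENNReal.ofReal_ne_top]
    calc _ ≤ ENNReal.ofReal ((2 * (m + 2) * F) ^ p) * ENNReal.ofReal ((8 * (d + p : ℝ)) ^ p) +
          ENNReal.ofReal ((2 * (m + 2) * (m + 1)) ^ p) * ENNReal.ofReal ((12 * p * F) ^ p) := by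
          gcongr
          · exact lintegral_sum_sq_pow_le d hp
          · exact lintegral_jet_dirDeriv_pow_le m f hp
      _ = ENNReal.ofReal (((m + 2) * (16 * (d + p))) ^ p * F ^ p +
            ((m + 2) * (24 * (p * (m + 1)))) ^ p * F ^ p) := by
          rw [← ENNReal.ofReal_mul (by positivity), ← ENNReal.ofReal_mul (by positivity),
            ← ENNReal.ofReal_add (by positivity) (by positivity)]
          congr 1
          simp only [← mul_pow]
          congr 2 <;> ring
      _ ≤ _ := by
          refine ENNReal.ofReal_le_ofReal ?_
          rw [← add_mul]
          push_cast
          refine mul_le_mul_of_nonneg_right ?_ (pow_nonneg hF0 p)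
          have hadd := pow_add_pow_le (n := p) (by positivity : (0 : ℝ) ≤ (m + 2) * (16 * (d + p)))
            (by positivity : (0 : ℝ) ≤ (m + 2) * (24 * (p * (m + 1)))) (by omega)
          refine hadd.trans ?_
          gcongr
          nlinarith [mul_nonneg (by positivity : (0 : ℝ) ≤ (m : ℝ) + 2) hd0,
            mul_nonneg (by positivity : (0 : ℝ) ≤ (m : ℝ) + 2) hp0.le]

-- Decoupling replaces the quadratic factor by two independent linear factors, integrated one after
-- the other. Each costs `Δ/2` times its degree, and the decoupling factor `2² = 4` cancels the two
-- halves.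
set_option maxHeartbeats 1000000 in
theorem lintegral_jet_quadForm_mul_pow_le (m : ℕ) (f : MvPolynomial (Fin d) ℝ) {p : ℕ}
    (hp : 1 ≤ p) {Δ : ℝ} (hΔ : 48 * (d + p * (m + 2)) ≤ Δ) :
    ∫⁻ v, ENNReal.ofReal ((jet (m + 2) (quadForm v * f) ⬝ᵥ jet (m + 2) (quadForm v * f)) ^ p)
        ∂(stdGauss d) ≤
      ENNReal.ofReal (((m + 2) * (m + 1) * Δ ^ 2) ^ p * (jet m f ⬝ᵥ jet m f) ^ p) := by
  have hnn : ∀ k (g : MvPolynomial (Fin d) ℝ), 0 ≤ jet k g ⬝ᵥ jet k g := fun k g =>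
    Finset.sum_nonneg fun _ _ => mul_self_nonneg _
  have hsq : ∀ g : MvPolynomial (Fin d) ℝ, jet (m + 2) g ⬝ᵥ jet (m + 2) g =
      ∑ c, jet (m + 2) g c ^ 2 := fun g => Finset.sum_congr rfl fun β _ => (sq _).symm
  have h := lintegral_quadratic_pow_le
    (fun (c : Fin (m + 2) → Fin d) x y => jet (m + 2) (X x * (X y * f)) c)
    (fun c x y => by rw [mul_left_comm]) p
  have e1 : ∀ (v : Fin d → ℝ) c, ∑ x, ∑ y, jet (m + 2) (X x * (X y * f)) c *
      (v x * v y - if x = y then 1 else 0) = jet (m + 2) (quadForm v * f) c := fun v c =>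
    (map_quadForm_mul ((LinearMap.proj c) ∘ₗ jet (m + 2)) v f).symm
  have e2 : ∀ (b b' : Fin d → ℝ) c, ∑ x, ∑ y, jet (m + 2) (X x * (X y * f)) c *
      (b x * b' y) = jet (m + 2) (linForm b' * (linForm b * f)) c := fun b b' c => by
    rw [mul_left_comm]
    exact (map_linForm_mul_linForm_mul ((LinearMap.proj c) ∘ₗ jet (m + 2)) b b' f).symm
  simp only [e1, e2, mul_pow, ← Finset.mul_sum, ← hsq] at h
  refine h.trans ?_
  have hΔ0 : 0 ≤ Δ := le_trans (by positivity) hΔ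
  have h4 : (0 : ℝ) ≤ (2 ^ 2) ^ p := by positivity
  simp only [ENNReal.ofReal_mul h4]
  simp only [lintegral_const_mul' _ _ ENNReal.ofReal_ne_top]
  calc _ ≤ ENNReal.ofReal ((2 ^ 2) ^ p) * ∫⁻ b, ENNReal.ofReal (((m + 2) * (Δ / 2)) ^ p) *
        ENNReal.ofReal ((jet (m + 1) (linForm b * f) ⬝ᵥ jet (m + 1) (linForm b * f)) ^ p)
        ∂(stdGauss d) := by
        gcongr with b
        rw [← ENNReal.ofReal_mul (by positivity)]
        refine (lintegral_jet_linForm_mul_pow_le (m + 1) (linForm b * f) hp).trans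
          (ENNReal.ofReal_le_ofReal ?_)
        have := hnn (m + 1) (linForm b * f)
        have hle : (((m + 1 : ℕ) : ℝ) + 1) * (24 * (d + p * (((m + 1 : ℕ) : ℝ) + 1))) ≤
            (m + 2) * (Δ / 2) := by
          push_cast
          rw [add_assoc, one_add_one_eq_two]
          exact mul_le_mul_of_nonneg_left (by linarith) (by positivity)
        exact mul_le_mul_of_nonneg_right (pow_le_pow_left₀ (by positivity) hle p)
          (pow_nonneg this p)
    _ ≤ ENNReal.ofReal ((2 ^ 2) ^ p) * (ENNReal.ofReal (((m + 2) * (Δ / 2)) ^ p) *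
        ENNReal.ofReal (((m + 1) * (Δ / 2)) ^ p * (jet m f ⬝ᵥ jet m f) ^ p)) := by
        rw [lintegral_const_mul' _ _ ENNReal.ofReal_ne_top]
        gcongr
        refine (lintegral_jet_linForm_mul_pow_le m f hp).trans (ENNReal.ofReal_le_ofReal ?_)
        have := hnn m f
        gcongr
        have : (0 : ℝ) ≤ p := by positivity
        nlinarith
    _ = _ := by
        rw [← ENNReal.ofReal_mul (by positivity), ← ENNReal.ofReal_mul (by positivity)]
        congr 1
        have h2 : ((2 : ℝ) ^ 2) ^ p = 2 ^ p * 2 ^ p := by rw [← mul_pow]; norm_num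
        rw [h2]
        simp only [mul_pow, div_pow]
        field_simp
        ring

end Decoupling

/-! ### Moments of Gram matrices of products of random quadratic forms -/

section MomentRecursion

open MeasureTheory ProbabilityTheory MvPolynomial Matrix

variable {d : ℕ} {ι : Type*} [DecidableEq ι]

/-- Integrate the coordinate `i` first, with all the others frozen. -/
theorem lintegral_pi_le_of_update [Fintype ι] {X : ι → Type*} [∀ i, MeasurableSpace (X i)]
    (μ : ∀ i, Measure (X i)) [∀ i, IsProbabilityMeasure (μ i)] (i : ι)
    {f g : (∀ i, X i) → ENNReal} (hf : Measurable f) (hg : Measurable g)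
    (hgi : ∀ ω v, g (Function.update ω i v) = g ω)
    (h : ∀ ω, ∫⁻ v, f (Function.update ω i v) ∂(μ i) ≤ g ω) :
    ∫⁻ ω, f ω ∂(Measure.pi μ) ≤ ∫⁻ ω, g ω ∂(Measure.pi μ) := by
  refine lintegral_le_of_lmarginal_le {i} hf hg fun ω => ?_
  simp only [lmarginal_singleton, hgi]
  simpa using h ω

noncomputable def quadProd (a : ι → Fin d → ℝ) (S : Finset ι) : MvPolynomial (Fin d) ℝ :=
  ∏ i ∈ S, quadForm (a i)

theorem quadProd_insert (a : ι → Fin d → ℝ) {S : Finset ι} {i : ι} (hi : i ∉ S) :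
    quadProd a (insert i S) = quadForm (a i) * quadProd a S := Finset.prod_insert hi

theorem quadProd_update (a : ι → Fin d → ℝ) {S : Finset ι} {i : ι} (hi : i ∉ S) (v : Fin d → ℝ) :
    quadProd (Function.update a i v) S = quadProd a S :=
  Finset.prod_congr rfl fun j hj => by
    rw [Function.update_of_ne (ne_of_mem_of_not_mem hj hi)]

/-- `U` holds the vectors forced into every product, `s` the vectors still free. The recursion
deletes vectors from `s`, or moves them to `U`. -/
noncomputable def prodGram (a : ι → Fin d → ℝ) (m : ℕ) (U s : Finset ι) (k : ℕ) :
    Matrix (Fin m → Fin d) (Fin m → Fin d) ℝ :=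
  jetGram m (s.powersetCard k) fun S => quadProd a U * quadProd a S

theorem prodGram_posSemidef {ι : Type*} (a : ι → Fin d → ℝ) (m : ℕ) (U s : Finset ι) (k : ℕ) :
    (prodGram a m U s k).PosSemidef := jetGram_posSemidef _ _ _

theorem prodGram_update (a : ι → Fin d → ℝ) (m : ℕ) {U s : Finset ι} (k : ℕ) {i : ι}
    (hU : i ∉ U) (hs : i ∉ s) (v : Fin d → ℝ) :
    prodGram (Function.update a i v) m U s k = prodGram a m U s k := by
  refine Finset.sum_congr rfl fun S hS => ?_
  have : i ∉ S := fun h => hs ((Finset.mem_powersetCard.1 hS).1 h)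
  simp only [quadProd_update a hU, quadProd_update a this]

theorem prodGram_insert_eq (a : ι → Fin d → ℝ) (m : ℕ) {U s : Finset ι} (k : ℕ) {i : ι}
    (hU : i ∉ U) :
    prodGram a m (insert i U) s k =
      jetGram m (s.powersetCard k) fun S => quadForm (a i) * (quadProd a U * quadProd a S) := by
  refine Finset.sum_congr rfl fun S hS => ?_
  simp only [quadProd_insert a hU, mul_assoc]

theorem sum_powersetCard_filter_mem {M : Type*} [AddCommMonoid M] {s : Finset ι} {i : ι}
    (hi : i ∈ s) (k : ℕ) (F : Finset ι → M) :
    ∑ S ∈ s.powersetCard (k + 1) with i ∈ S, F S =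
      ∑ S ∈ (s.erase i).powersetCard k, F (insert i S) := by
  refine Finset.sum_bij' (fun S _ => S.erase i) (fun S _ => insert i S) ?_ ?_ ?_ ?_ ?_
  · intro S hS
    simp only [Finset.mem_filter, Finset.mem_powersetCard] at hS ⊢
    exact ⟨Finset.erase_subset_erase _ hS.1.1, by rw [Finset.card_erase_of_mem hS.2]; omega⟩
  · intro S hS
    simp only [Finset.mem_filter, Finset.mem_powersetCard] at hS ⊢
    have : i ∉ S := fun h => by simpa using hS.1 h
    exact ⟨⟨Finset.insert_subset hi (hS.1.trans (Finset.erase_subset _ _)),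
      by rw [Finset.card_insert_of_notMem this]; omega⟩, Finset.mem_insert_self _ _⟩
  · intro S hS
    exact Finset.insert_erase (Finset.mem_filter.1 hS).2
  · intro S hS
    have : i ∉ S := fun h => by simpa using (Finset.mem_powersetCard.1 hS).1 h
    exact Finset.erase_insert this
  · intro S hS
    rw [Finset.insert_erase (Finset.mem_filter.1 hS).2]

/-- A set of `k + 1` indices is counted once for each of its elements. -/
theorem sum_sum_powersetCard_erase {M : Type*} [AddCommMonoid M] (s : Finset ι) (k : ℕ)
    (F : Finset ι → M) :
    ∑ i ∈ s, ∑ S ∈ (s.erase i).powersetCard k, F (insert i S) =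
      (k + 1) • ∑ S ∈ s.powersetCard (k + 1), F S := by
  rw [Finset.smul_sum]
  calc _ = ∑ i ∈ s, ∑ S ∈ s.powersetCard (k + 1), if i ∈ S then F S else 0 :=
        Finset.sum_congr rfl fun i hi => by
          rw [← sum_powersetCard_filter_mem hi, Finset.sum_filter]
    _ = _ := by
        rw [Finset.sum_comm]
        refine Finset.sum_congr rfl fun S hS => ?_
        obtain ⟨h1, h2⟩ := Finset.mem_powersetCard.1 hS
        rw [← Finset.sum_filter, Finset.sum_const, Finset.filter_mem_eq_inter,
          Finset.inter_eq_right.2 h1, h2]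

theorem prodGram_insert_eq_sum (a : ι → Fin d → ℝ) (m : ℕ) {U s : Finset ι} (k : ℕ) {i : ι}
    (hU : i ∉ U) :
    prodGram a m (insert i U) (s.erase i) k = ∑ S ∈ (s.erase i).powersetCard k,
      vecMulVec (jet m (quadProd a U * quadProd a (insert i S)))
        (jet m (quadProd a U * quadProd a (insert i S))) := by
  refine Finset.sum_congr rfl fun S hS => ?_
  have : i ∉ S := fun h => by simpa using (Finset.mem_powersetCard.1 hS).1 h
  simp only [quadProd_insert a hU, quadProd_insert a this, mul_left_comm, mul_assoc]

/-- Sort the sets by whether they contain `i`. This is the splitting `W = Z + Y`, in which `Z` does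
not involve the vector `a i`. -/
theorem prodGram_succ (a : ι → Fin d → ℝ) (m : ℕ) {U s : Finset ι} (k : ℕ) {i : ι} (hi : i ∈ s)
    (hU : i ∉ U) :
    prodGram a m U s (k + 1) =
      prodGram a m U (s.erase i) (k + 1) + prodGram a m (insert i U) (s.erase i) k := by
  rw [prodGram_insert_eq_sum a m k hU, ← sum_powersetCard_filter_mem hi k (fun S =>
    vecMulVec (jet m (quadProd a U * quadProd a S)) (jet m (quadProd a U * quadProd a S))),
    prodGram, jetGram, ← Finset.sum_filter_not_add_sum_filter _ (fun S => i ∈ S)]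
  congr 1
  refine Finset.sum_congr ?_ fun _ _ => rfl
  ext S
  simp only [Finset.mem_filter, Finset.mem_powersetCard, Finset.subset_erase]
  tauto

theorem smul_prodGram (a : ι → Fin d → ℝ) (m : ℕ) {U s : Finset ι} (k : ℕ) (h : Disjoint U s) :
    ((k : ℝ) + 1) • prodGram a m U s (k + 1) =
      ∑ i ∈ s, prodGram a m (insert i U) (s.erase i) k := by
  rw [Finset.sum_congr rfl fun i hi => prodGram_insert_eq_sum a m k
      (fun hU => (Finset.disjoint_left.1 h) hU hi),
    sum_sum_powersetCard_erase s k fun S =>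
      vecMulVec (jet m (quadProd a U * quadProd a S)) (jet m (quadProd a U * quadProd a S)),
    ← Nat.cast_smul_eq_nsmul ℝ]
  push_cast
  rfl

/-! ### Measurability of jets, Gram matrices and traces. -/

section Measurability

variable {Ω : Type*} [MeasurableSpace Ω]

theorem measurable_jet_X_mul {P : Ω → MvPolynomial (Fin d) ℝ}
    (hP : ∀ m α, Measurable fun ω => jet m (P ω) α) (x : Fin d) :
    ∀ m α, Measurable fun ω => jet m (X x * P ω) α := by
  rintro (_ | m) α
  · simp only [jet_zero_apply, coeff_zero_X_mul]
    exact measurable_const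
  · simp only [jet_X_mul_apply]
    refine Finset.measurable_fun_sum _ fun p _ => ?_
    split_ifs
    · exact hP _ _
    · exact measurable_const

theorem measurable_jet_quadForm_mul {P : Ω → MvPolynomial (Fin d) ℝ}
    (hP : ∀ m α, Measurable fun ω => jet m (P ω) α) {v : Ω → Fin d → ℝ} (hv : Measurable v) :
    ∀ m α, Measurable fun ω => jet m (quadForm (v ω) * P ω) α := by
  intro m α
  have e : ∀ ω, jet m (quadForm (v ω) * P ω) α = _ := fun ω =>
    map_quadForm_mul ((LinearMap.proj α) ∘ₗ jet m) (v ω) (P ω)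
  simp only [e]
  refine Finset.measurable_fun_sum _ fun x _ => Finset.measurable_fun_sum _ fun y _ => ?_
  exact (measurable_jet_X_mul (measurable_jet_X_mul hP y) x m α).mul (by fun_prop)

theorem measurable_jet_quadProd {a : Ω → ι → Fin d → ℝ} (ha : Measurable a) (S : Finset ι)
    {P : Ω → MvPolynomial (Fin d) ℝ} (hP : ∀ m α, Measurable fun ω => jet m (P ω) α) :
    ∀ m α, Measurable fun ω => jet m (quadProd (a ω) S * P ω) α := by
  induction S using Finset.induction_on with
  | empty => simpa [quadProd] using hP
  | insert i S hi ih =>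
    simp only [quadProd_insert _ hi, mul_assoc]
    exact measurable_jet_quadForm_mul ih (by fun_prop)

theorem measurable_jet_quadProd_mul {a : Ω → ι → Fin d → ℝ} (ha : Measurable a) (S U : Finset ι) :
    ∀ m α, Measurable fun ω => jet m (quadProd (a ω) S * quadProd (a ω) U) α := by
  refine measurable_jet_quadProd ha S ?_
  have := measurable_jet_quadProd ha U (P := fun _ => 1) fun m α => measurable_const
  simpa using this

theorem measurable_jetGram {σ : Type*} (s : Finset σ) {P : Ω → σ → MvPolynomial (Fin d) ℝ}
    (hP : ∀ j m α, Measurable fun ω => jet m (P ω j) α) (m : ℕ) (α β : Fin m → Fin d) :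
    Measurable fun ω => jetGram m s (P ω) α β := by
  simp only [jetGram, Matrix.sum_apply, vecMulVec_apply]
  exact Finset.measurable_fun_sum _ fun j _ => (hP j m α).mul (hP j m β)

theorem measurable_matrix_mul {κ : Type*} [Fintype κ] {A B : Ω → Matrix κ κ ℝ}
    (hA : ∀ i j, Measurable fun ω => A ω i j) (hB : ∀ i j, Measurable fun ω => B ω i j) (i j : κ) :
    Measurable fun ω => (A ω * B ω) i j := by
  simp only [Matrix.mul_apply]
  exact Finset.measurable_fun_sum _ fun k _ => (hA i k).mul (hB k j)

theorem measurable_matrix_pow {κ : Type*} [Fintype κ] [DecidableEq κ] {A : Ω → Matrix κ κ ℝ}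
    (hA : ∀ i j, Measurable fun ω => A ω i j) (p : ℕ) (i j : κ) :
    Measurable fun ω => (A ω ^ p) i j := by
  induction p generalizing i j with
  | zero => simp only [pow_zero]; exact measurable_const
  | succ p ih =>
    simp only [pow_succ]
    exact measurable_matrix_mul ih hA i j

theorem measurable_matrix_trace {κ : Type*} [Fintype κ] {A : Ω → Matrix κ κ ℝ}
    (hA : ∀ i j, Measurable fun ω => A ω i j) : Measurable fun ω => (A ω).trace :=
  Finset.measurable_fun_sum _ fun i _ => hA i i

theorem measurable_prodGram (m : ℕ) (U s : Finset ι) (k : ℕ) (α β : Fin m → Fin d) :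
    Measurable fun a : ι → Fin d → ℝ => prodGram a m U s k α β :=
  measurable_jetGram _ (fun S => measurable_jet_quadProd_mul measurable_id U S) m α β

theorem measurable_trace_prodGram_pow (m : ℕ) (U s : Finset ι) (k p : ℕ) :
    Measurable fun a : ι → Fin d → ℝ => (prodGram a m U s k ^ p).trace :=
  measurable_matrix_trace fun i j => measurable_matrix_pow (measurable_prodGram m U s k) p i j

end Measurability

end MomentRecursion

/-! ### One step of the moment recursion. -/

section MomentRecursion

open MeasureTheory ProbabilityTheory MvPolynomial Matrix

variable {d : ℕ} {ι : Type*} [DecidableEq ι]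

/-- The Gram matrix that replaces a random quadratic factor by all pairs of coordinates. -/
noncomputable def pairGram (a : ι → Fin d → ℝ) (m : ℕ) (U s : Finset ι) (k : ℕ) :
    Matrix (Fin m → Fin d) (Fin m → Fin d) ℝ :=
  jetGram m (Finset.univ ×ˢ (Finset.univ ×ˢ s.powersetCard k))
    (fun z : Fin d × Fin d × Finset ι => X z.1 * (X z.2.1 * (quadProd a U * quadProd a z.2.2)))

theorem pairGram_posSemidef {ι : Type*} (a : ι → Fin d → ℝ) (m : ℕ) (U s : Finset ι) (k : ℕ) :
    (pairGram a m U s k).PosSemidef := jetGram_posSemidef _ _ _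

theorem trace_pairGram_pow_le {ι : Type*} (a : ι → Fin d → ℝ) (m : ℕ) (U s : Finset ι) (k p : ℕ) :
    (pairGram a (m + 2) U s k ^ p).trace ≤
      (((m + 2 : ℝ) * (m + 1)) ^ 2) ^ p * d ^ 2 * (prodGram a m U s k ^ p).trace := by
  have h1 := trace_jetGram_X_mul_pow_le (m + 1) (Finset.univ ×ˢ s.powersetCard k)
    (fun z : Fin d × Finset ι => X z.1 * (quadProd a U * quadProd a z.2)) p
  have h2 := trace_jetGram_X_mul_pow_le m (s.powersetCard k)
    (fun S => quadProd a U * quadProd a S) p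
  refine h1.trans ?_
  calc _ ≤ (((m + 1 : ℕ) + 1 : ℝ) ^ 2) ^ p * (d * (((m + 1 : ℝ) ^ 2) ^ p *
        (d * (prodGram a m U s k ^ p).trace))) := by
        gcongr
        exact h2
    _ = _ := by push_cast; rw [add_assoc, one_add_one_eq_two]; simp only [mul_pow]; ring

theorem pairGram_update (a : ι → Fin d → ℝ) (m : ℕ) {U s : Finset ι} (k : ℕ) {i : ι}
    (hU : i ∉ U) (hs : i ∉ s) (v : Fin d → ℝ) :
    pairGram (Function.update a i v) m U s k = pairGram a m U s k := by
  refine Finset.sum_congr rfl fun z hz => ?_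
  have : i ∉ z.2.2 := fun h => by
    simp only [Finset.mem_product, Finset.mem_powersetCard] at hz
    exact hs (hz.2.2.1 h)
  simp only [quadProd_update a hU, quadProd_update a this]

theorem measurable_pairGram (m : ℕ) (U s : Finset ι) (k : ℕ) (α β : Fin m → Fin d) :
    Measurable fun a : ι → Fin d → ℝ => pairGram a m U s k α β := by
  have h0 : ∀ S m α, Measurable fun a : ι → Fin d → ℝ =>
      jet m (quadProd a U * quadProd a S) α := fun S =>
    measurable_jet_quadProd_mul measurable_id U S
  have h1 : ∀ S y m α, Measurable fun a : ι → Fin d → ℝ =>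
      jet m (X y * (quadProd a U * quadProd a S)) α := fun S y => measurable_jet_X_mul (h0 S) y
  have h2 : ∀ S y x m α, Measurable fun a : ι → Fin d → ℝ =>
      jet m (X x * (X y * (quadProd a U * quadProd a S))) α := fun S y x =>
    measurable_jet_X_mul (h1 S y) x
  exact measurable_jetGram (P := fun (a : ι → Fin d → ℝ) (z : Fin d × Fin d × Finset ι) =>
    X z.1 * (X z.2.1 * (quadProd a U * quadProd a z.2.2))) _ (fun z => h2 z.2.2 z.2.1 z.1) m α β

theorem measurable_trace_prodGram_mul_pow (m : ℕ) (U V s : Finset ι) (k l r : ℕ) :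
    Measurable fun a : ι → Fin d → ℝ =>
      (prodGram a m U s k * prodGram a m V s l ^ r).trace :=
  measurable_matrix_trace (measurable_matrix_mul (measurable_prodGram m U s k)
    (measurable_matrix_pow (measurable_prodGram m V s l) r))

theorem measurable_trace_pairGram_mul_pow (m : ℕ) (U V s : Finset ι) (k l r : ℕ) :
    Measurable fun a : ι → Fin d → ℝ =>
      (pairGram a m U s k * prodGram a m V s l ^ r).trace :=
  measurable_matrix_trace (measurable_matrix_mul (measurable_pairGram m U s k)
    (measurable_matrix_pow (measurable_prodGram m V s l) r))

/-- Condition on all vectors except `a i`. The power does not involve `a i`, and the other factor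
enters linearly, so only a second moment in `a i` is needed. -/
theorem lintegral_trace_prodGram_mul_le [Fintype ι] (m : ℕ) {U s : Finset ι} (k r : ℕ) {i : ι}
    (hU : i ∉ U) :
    ∫⁻ a, ENNReal.ofReal ((prodGram a m (insert i U) (s.erase i) k *
        prodGram a m U (s.erase i) (k + 1) ^ r).trace) ∂(Measure.pi fun _ : ι => stdGauss d) ≤
      ∫⁻ a, ENNReal.ofReal (4 * (pairGram a m U (s.erase i) k *
        prodGram a m U (s.erase i) (k + 1) ^ r).trace) ∂(Measure.pi fun _ : ι => stdGauss d) := by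
  have hi : i ∉ s.erase i := Finset.notMem_erase i s
  refine lintegral_pi_le_of_update _ i ?_ ?_ (fun a v => ?_) fun a => ?_
  · exact (measurable_trace_prodGram_mul_pow _ _ _ _ _ _ _).ennreal_ofReal
  · exact ((measurable_trace_pairGram_mul_pow _ _ _ _ _ _ _).const_mul _).ennreal_ofReal
  · simp only [pairGram_update a m k hU hi, prodGram_update a m (k + 1) hU hi]
  · have h := lintegral_trace_quadForm_mul_le m ((s.erase i).powersetCard k)
      (fun S => quadProd a U * quadProd a S) ((prodGram_posSemidef a m U (s.erase i) (k + 1)).pow r)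
    have e : ∀ v : Fin d → ℝ, prodGram (Function.update a i v) m (insert i U) (s.erase i) k =
        jetGram m ((s.erase i).powersetCard k)
          (fun S => quadForm v * (quadProd a U * quadProd a S)) := fun v => by
      rw [prodGram_insert_eq _ m k hU]
      refine Finset.sum_congr rfl fun S hS => ?_
      have : i ∉ S := fun h => hi ((Finset.mem_powersetCard.1 hS).1 h)
      simp only [Function.update_self, quadProd_update a hU, quadProd_update a this]
    simp only [prodGram_update a m (k + 1) hU hi, e]
    exact h

/-- One factor of the power is written as an average of the `Y_i`, and in the remaining power `W =
Z_i + Y_i` is separated for each `i`. -/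
theorem trace_prodGram_pow_le (a : ι → Fin d → ℝ) (m : ℕ) {U s : Finset ι} (k r : ℕ)
    (h : Disjoint U s) :
    (prodGram a m U s (k + 1) ^ (r + 1)).trace ≤
      ∑ i ∈ s, (2 / (k + 1) * (prodGram a m (insert i U) (s.erase i) k *
          prodGram a m U (s.erase i) (k + 1) ^ r).trace +
        (4 * r) ^ r / (k + 1) * (prodGram a m (insert i U) (s.erase i) k ^ (r + 1)).trace) := by
  have hk : (0 : ℝ) < k + 1 := by positivity
  have e : (prodGram a m U s (k + 1) ^ (r + 1)).trace = 1 / (k + 1) *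
      ∑ i ∈ s, (prodGram a m (insert i U) (s.erase i) k * prodGram a m U s (k + 1) ^ r).trace := by
    rw [← trace_sum, ← Finset.sum_mul, ← smul_prodGram a m k h, smul_mul_assoc, trace_smul,
      ← pow_succ', smul_eq_mul]
    field_simp
  rw [e, Finset.mul_sum]
  refine Finset.sum_le_sum fun i hi => ?_
  have hU : i ∉ U := fun hU => (Finset.disjoint_left.1 h) hU hi
  rw [prodGram_succ a m k hi hU]
  have := trace_mul_add_pow_le (prodGram_posSemidef a m (insert i U) (s.erase i) k)
    (prodGram_posSemidef a m U (s.erase i) (k + 1)) r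
  calc _ ≤ 1 / ((k : ℝ) + 1) * _ := mul_le_mul_of_nonneg_left this (by positivity)
    _ = _ := by ring

theorem trace_pairGram_mul_le {ι : Type*} (a : ι → Fin d → ℝ) (m : ℕ) {U s : Finset ι} (k r : ℕ)
    {N : ℝ} (hN : 0 < N) :
    2 / ((k : ℝ) + 1) * (4 * (pairGram a (m + 2) U s k * prodGram a (m + 2) U s (k + 1) ^ r).trace) ≤
      1 / N * (1 / 2 * (prodGram a (m + 2) U s (k + 1) ^ (r + 1)).trace +
        (16 * N / (k + 1)) ^ (r + 1) * ((((m + 2 : ℝ) * (m + 1)) ^ 2) ^ (r + 1) * d ^ 2) *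
          (prodGram a m U s k ^ (r + 1)).trace) := by
  have h := mul_trace_mul_pow_le (pairGram_posSemidef a (m + 2) U s k)
    -- The constant already includes `N`, later the number of vectors in the sum over `i`, so that
    -- all of them together carry the weight `1/2` on the term of the same order.
    (prodGram_posSemidef a (m + 2) U s (k + 1)) (c := 8 * N / (k + 1)) (by positivity) r
  have h2 := trace_pairGram_pow_le a m U s k (r + 1)
  calc _ = 1 / N * (8 * N / (k + 1) *
        (pairGram a (m + 2) U s k * prodGram a (m + 2) U s (k + 1) ^ r).trace) := by
        field_simp; ring
    _ ≤ 1 / N * (1 / 2 * (prodGram a (m + 2) U s (k + 1) ^ (r + 1)).trace +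
        (2 * (8 * N / (k + 1))) ^ (r + 1) * ((((m + 2 : ℝ) * (m + 1)) ^ 2) ^ (r + 1) * d ^ 2 *
          (prodGram a m U s k ^ (r + 1)).trace)) := by
        refine mul_le_mul_of_nonneg_left (h.trans ?_) (by positivity)
        gcongr
    _ = _ := by
        rw [show 2 * (8 * N / ((k : ℝ) + 1)) = 16 * N / (k + 1) by ring]
        ring

theorem lintegral_trace_prodGram_pow_succ_le [Fintype ι] (m : ℕ) {U s : Finset ι} (k r : ℕ)
    (h : Disjoint U s) {b₁ b₂ b₃ : ℝ} (hb₁ : 0 ≤ b₁) (hb₂ : 0 ≤ b₂) (hb₃ : 0 ≤ b₃)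
    (h₁ : ∀ i ∈ s, ∫⁻ a, ENNReal.ofReal
      ((prodGram a (m + 2) U (s.erase i) (k + 1) ^ (r + 1)).trace)
      ∂(Measure.pi fun _ : ι => stdGauss d) ≤ ENNReal.ofReal b₁)
    (h₂ : ∀ i ∈ s, ∫⁻ a, ENNReal.ofReal ((prodGram a m U (s.erase i) k ^ (r + 1)).trace)
      ∂(Measure.pi fun _ : ι => stdGauss d) ≤ ENNReal.ofReal b₂)
    (h₃ : ∀ i ∈ s, ∫⁻ a, ENNReal.ofReal
      ((prodGram a (m + 2) (insert i U) (s.erase i) k ^ (r + 1)).trace)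
      ∂(Measure.pi fun _ : ι => stdGauss d) ≤ ENNReal.ofReal b₃) :
    ∫⁻ a, ENNReal.ofReal ((prodGram a (m + 2) U s (k + 1) ^ (r + 1)).trace)
      ∂(Measure.pi fun _ : ι => stdGauss d) ≤
      ENNReal.ofReal (1 / 2 * b₁ + (16 * s.card / (k + 1)) ^ (r + 1) *
        ((((m + 2 : ℝ) * (m + 1)) ^ 2) ^ (r + 1) * d ^ 2) * b₂ +
          s.card * ((4 * r) ^ r / (k + 1) * b₃)) := by
  set μ := Measure.pi fun _ : ι => stdGauss d with hμ
  have hnn : ∀ {κ : Type} [Fintype κ] [DecidableEq κ] (A : Matrix κ κ ℝ) (hA : A.PosSemidef)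
    (p : ℕ), 0 ≤ (A ^ p).trace := fun A hA p => (hA.pow p).trace_nonneg
  set w := (16 * s.card / (k + 1)) ^ (r + 1) *
        ((((m + 2 : ℝ) * (m + 1)) ^ 2) ^ (r + 1) * d ^ 2) with hw
  have hw0 : 0 ≤ w := by positivity
  have hq0 : 0 ≤ (4 * (r : ℝ)) ^ r / (k + 1) := by positivity
  have hY := fun i => measurable_trace_prodGram_pow (d := d) (m + 2) (insert i U) (s.erase i) k
    (r + 1)
  have hZ := fun i => measurable_trace_prodGram_pow (d := d) (m + 2) U (s.erase i) (k + 1) (r + 1)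
  have hM := fun i => measurable_trace_prodGram_pow (d := d) m U (s.erase i) k (r + 1)
  have hYZ : ∀ i, Measurable fun a : ι → Fin d → ℝ => (prodGram a (m + 2) (insert i U)
      (s.erase i) k * prodGram a (m + 2) U (s.erase i) (k + 1) ^ r).trace := fun i =>
    measurable_trace_prodGram_mul_pow _ _ _ _ _ _ _
  have hYZ0 : ∀ i (a : ι → Fin d → ℝ), 0 ≤ (prodGram a (m + 2) (insert i U)
      (s.erase i) k * prodGram a (m + 2) U (s.erase i) (k + 1) ^ r).trace := fun i a => by
    simpa using trace_mul_pow_nonneg (prodGram_posSemidef a (m + 2) (insert i U) (s.erase i) k)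
      (prodGram_posSemidef a (m + 2) U (s.erase i) (k + 1)) 1 r
  calc _ ≤ ∫⁻ a, ∑ i ∈ s, (ENNReal.ofReal (2 / (k + 1)) *
          ENNReal.ofReal ((prodGram a (m + 2) (insert i U) (s.erase i) k *
            prodGram a (m + 2) U (s.erase i) (k + 1) ^ r).trace) +
        ENNReal.ofReal ((4 * r) ^ r / (k + 1)) *
          ENNReal.ofReal ((prodGram a (m + 2) (insert i U) (s.erase i) k ^ (r + 1)).trace)) ∂μ := by
        refine lintegral_mono fun a => ?_
        refine (ENNReal.ofReal_le_ofReal (trace_prodGram_pow_le a (m + 2) k r h)).trans ?_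
        have hY0 : ∀ i, 0 ≤ (prodGram a (m + 2) (insert i U) (s.erase i) k ^ (r + 1)).trace :=
          fun i => hnn _ (prodGram_posSemidef _ _ _ _ _) _
        rw [ENNReal.ofReal_sum_of_nonneg fun i _ => add_nonneg
          (mul_nonneg (by positivity) (hYZ0 i a)) (mul_nonneg hq0 (hY0 i))]
        refine Finset.sum_le_sum fun i _ => ?_
        refine ENNReal.ofReal_add_le.trans (le_of_eq ?_)
        rw [ENNReal.ofReal_mul (by positivity), ENNReal.ofReal_mul hq0]
    _ = ∑ i ∈ s, (ENNReal.ofReal (2 / (k + 1)) *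
          ∫⁻ a, ENNReal.ofReal ((prodGram a (m + 2) (insert i U) (s.erase i) k *
            prodGram a (m + 2) U (s.erase i) (k + 1) ^ r).trace) ∂μ +
        ENNReal.ofReal ((4 * r) ^ r / (k + 1)) *
          ∫⁻ a, ENNReal.ofReal ((prodGram a (m + 2) (insert i U) (s.erase i) k ^ (r + 1)).trace)
            ∂μ) := by
        rw [lintegral_finsetSum]
        swap
        · exact fun i _ => (((hYZ i).ennreal_ofReal.const_mul _).add
            ((hY i).ennreal_ofReal.const_mul _))
        refine Finset.sum_congr rfl fun i _ => ?_
        rw [lintegral_add_left ((hYZ i).ennreal_ofReal.const_mul _),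
          lintegral_const_mul' _ _ ENNReal.ofReal_ne_top,
          lintegral_const_mul' _ _ ENNReal.ofReal_ne_top]
    _ ≤ ∑ i ∈ s, (ENNReal.ofReal (1 / s.card * (1 / 2 * b₁ + w * b₂)) +
          ENNReal.ofReal ((4 * r) ^ r / (k + 1) * b₃)) := by
        refine Finset.sum_le_sum fun i hi => ?_
        have hN : (0 : ℝ) < s.card := by exact_mod_cast Finset.card_pos.2 ⟨i, hi⟩
        have hU : i ∉ U := fun hU => (Finset.disjoint_left.1 h) hU hi
        refine add_le_add ?_ ?_
        · calc _ ≤ ENNReal.ofReal (2 / (k + 1)) * ∫⁻ a, ENNReal.ofReal (4 *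
                (pairGram a (m + 2) U (s.erase i) k *
                prodGram a (m + 2) U (s.erase i) (k + 1) ^ r).trace) ∂μ := by
                exact mul_le_mul' le_rfl (lintegral_trace_prodGram_mul_le (m + 2) k r hU)
            _ ≤ ∫⁻ a, (ENNReal.ofReal (1 / s.card * (1 / 2)) *
                  ENNReal.ofReal ((prodGram a (m + 2) U (s.erase i) (k + 1) ^ (r + 1)).trace) +
                ENNReal.ofReal (1 / s.card * w) *
                  ENNReal.ofReal ((prodGram a m U (s.erase i) k ^ (r + 1)).trace)) ∂μ := by
                rw [← lintegral_const_mul' _ _ ENNReal.ofReal_ne_top]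
                refine lintegral_mono fun a => ?_
                rw [← ENNReal.ofReal_mul (by positivity), ← ENNReal.ofReal_mul (by positivity),
                  ← ENNReal.ofReal_mul (by positivity), ← ENNReal.ofReal_add
                  (mul_nonneg (by positivity) (hnn _ (prodGram_posSemidef _ _ _ _ _) _))
                  (mul_nonneg (by positivity) (hnn _ (prodGram_posSemidef _ _ _ _ _) _))]
                refine ENNReal.ofReal_le_ofReal ((trace_pairGram_mul_le a m k r hN).trans
                  (le_of_eq ?_))
                ring
            _ ≤ ENNReal.ofReal (1 / s.card * (1 / 2)) * ENNReal.ofReal b₁ +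
                ENNReal.ofReal (1 / s.card * w) * ENNReal.ofReal b₂ := by
                rw [lintegral_add_left ((hZ i).ennreal_ofReal.const_mul _),
                  lintegral_const_mul' _ _ ENNReal.ofReal_ne_top,
                  lintegral_const_mul' _ _ ENNReal.ofReal_ne_top]
                gcongr
                · exact h₁ i hi
                · exact h₂ i hi
            _ = _ := by
                rw [← ENNReal.ofReal_mul (by positivity), ← ENNReal.ofReal_mul (by positivity),
                  ← ENNReal.ofReal_add (by positivity) (by positivity)]
                congr 1
                ring
        · rw [ENNReal.ofReal_mul hq0]
          gcongr
          exact h₃ i hi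
    _ ≤ _ := by
        have hx : 0 ≤ 1 / (s.card : ℝ) * (1 / 2 * b₁ + w * b₂) := by positivity
        have hy : 0 ≤ (4 * (r : ℝ)) ^ r / (k + 1) * b₃ := mul_nonneg hq0 hb₃
        rw [Finset.sum_const, nsmul_eq_mul, ← ENNReal.ofReal_add hx hy,
          ← ENNReal.ofReal_natCast, ← ENNReal.ofReal_mul (by positivity)]
        refine ENNReal.ofReal_le_ofReal ?_
        -- For empty `s` the left side is zero; otherwise the factor `1 / s.card` cancels against
        -- the number of terms.
        rcases Nat.eq_zero_or_pos s.card with h0 | h0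
        · rw [h0]; simp; positivity
        · have : (0 : ℝ) < s.card := by exact_mod_cast h0
          refine le_of_eq ?_
          field_simp

/-- Integrate out the vectors one at a time; the degree factors `(m + 2)(m + 1)` multiply up to
`(2u)!`. -/
theorem lintegral_jet_quadProd_pow_le [Fintype ι] (U : Finset ι) {p : ℕ} (hp : 1 ≤ p) {Δ : ℝ}
    (hΔ : 48 * (d + p * (2 * U.card : ℕ)) ≤ Δ) :
    ∫⁻ a, ENNReal.ofReal ((jet (2 * U.card) (quadProd a U) ⬝ᵥ jet (2 * U.card) (quadProd a U)) ^ p)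
      ∂(Measure.pi fun _ : ι => stdGauss d) ≤
      ENNReal.ofReal (((2 * U.card).factorial * Δ ^ (2 * U.card)) ^ p) := by
  have key : ∀ (U : Finset ι) (m : ℕ), m = 2 * U.card → 48 * (d + p * (m : ℕ)) ≤ Δ →
    ∫⁻ a, ENNReal.ofReal ((jet m (quadProd a U) ⬝ᵥ jet m (quadProd a U)) ^ p)
      ∂(Measure.pi fun _ : ι => stdGauss d) ≤ ENNReal.ofReal ((m.factorial * Δ ^ m) ^ p) := by
    intro U
    induction U using Finset.induction_on with
    | empty =>
      intro m hm _
      simp only [Finset.card_empty, mul_zero] at hm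
      subst hm
      simp [quadProd, dotProduct, jet_zero_apply]
    | insert i U hi ih =>
      intro m hm hΔm
      rw [Finset.card_insert_of_notMem hi] at hm
      obtain ⟨m, rfl⟩ : ∃ m', m = m' + 2 := ⟨2 * U.card, by omega⟩
      push_cast at hΔm
      have ih := ih m (by omega) (by nlinarith [(by positivity : (0 : ℝ) ≤ p)])
      have hΔ0 : 0 ≤ Δ := le_trans (by positivity) hΔm
      have hnn : ∀ k (g : MvPolynomial (Fin d) ℝ), 0 ≤ jet k g ⬝ᵥ jet k g := fun k g =>
        Finset.sum_nonneg fun _ _ => mul_self_nonneg _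
      have hme : ∀ m (V : Finset ι), Measurable fun a : ι → Fin d → ℝ =>
          (jet m (quadProd a V) ⬝ᵥ jet m (quadProd a V)) ^ p := by
        intro m V
        refine Measurable.pow_const ?_ _
        have := measurable_jet_quadProd_mul (d := d) measurable_id V (∅ : Finset ι) m
        simp only [id, quadProd, Finset.prod_empty, mul_one] at this
        exact Finset.measurable_fun_sum _ fun α _ => (this α).mul (this α)
      calc _ ≤ ∫⁻ a, ENNReal.ofReal (((m + 2) * (m + 1) * Δ ^ 2) ^ p *
              (jet m (quadProd a U) ⬝ᵥ jet m (quadProd a U)) ^ p)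
              ∂(Measure.pi fun _ : ι => stdGauss d) := by
            refine lintegral_pi_le_of_update _ i (hme _ _).ennreal_ofReal
              ((hme _ _).const_mul _).ennreal_ofReal (fun a v => ?_) fun a => ?_
            · rw [quadProd_update a hi]
            · simp only [quadProd_insert _ hi, quadProd_update a hi, Function.update_self]
              exact lintegral_jet_quadForm_mul_pow_le m _ hp hΔm
        _ ≤ ENNReal.ofReal (((m + 2) * (m + 1) * Δ ^ 2) ^ p) *
              ENNReal.ofReal ((m.factorial * Δ ^ m) ^ p) := by
            have h0 : 0 ≤ (((m : ℝ) + 2) * (m + 1) * Δ ^ 2) ^ p := by positivity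
            simp only [ENNReal.ofReal_mul h0]
            rw [lintegral_const_mul' _ _ ENNReal.ofReal_ne_top]
            gcongr
        _ = _ := by
            rw [← ENNReal.ofReal_mul (by positivity), ← mul_pow]
            congr 2
            rw [Nat.factorial_succ, Nat.factorial_succ]
            push_cast
            ring
  exact key U _ rfl hΔ

end MomentRecursion

/-! ### Solution of the moment recursion. -/

section MomentBound

open MeasureTheory ProbabilityTheory MvPolynomial Matrix

variable {d : ℕ} {ι : Type*} [DecidableEq ι]

theorem trace_vecMulVec_self_pow {κ : Type*} [Fintype κ] [DecidableEq κ] (v : κ → ℝ) (r : ℕ) :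
    (vecMulVec v v ^ (r + 1)).trace = (v ⬝ᵥ v) ^ (r + 1) := by
  have h : vecMulVec v v ^ (r + 1) = (v ⬝ᵥ v) ^ r • vecMulVec v v := by
    induction r with
    | zero => simp
    | succ r ih =>
      rw [pow_succ, ih, smul_mul_assoc, vecMulVec_mul_vecMulVec, pow_succ, vecMulVec_smul, smul_smul]
  rw [h, trace_smul, trace_vecMulVec, smul_eq_mul, pow_succ]

/-- All three terms of the recursion have a smaller free set, so the induction is on `s`, and `β`
need not depend on `s` beyond `s.card ≤ N`. In the first term `k + 1` and `u` are unchanged; its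
coefficient `1/2` leaves room for the other two. -/
theorem lintegral_trace_prodGram_pow_le [Fintype ι] (r N T : ℕ) {Δ : ℝ} (β : ℕ → ℕ → ℝ)
    (hβ : ∀ k u, 0 ≤ β k u) (hΔ : 48 * (d + (r + 1 : ℕ) * (2 * T : ℕ)) ≤ Δ)
    (hbase : ∀ u, ((2 * u).factorial * Δ ^ (2 * u)) ^ (r + 1) ≤ β 0 u)
    (hrec : ∀ k u, 1 / 2 * β (k + 1) u + (16 * (N : ℝ) / (k + 1)) ^ (r + 1) *
      (((((2 * (k + u) : ℕ) + 2 : ℝ) * ((2 * (k + u) : ℕ) + 1)) ^ 2) ^ (r + 1) * d ^ 2) * β k u +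
        N * ((4 * r) ^ r / (k + 1) * β k (u + 1)) ≤ β (k + 1) u)
    (s U : Finset ι) (k m : ℕ) (hm : m = 2 * (k + U.card)) (hT : k + U.card ≤ T)
    (hUs : Disjoint U s) (hs : s.card ≤ N) :
    ∫⁻ a, ENNReal.ofReal ((prodGram a m U s k ^ (r + 1)).trace)
      ∂(Measure.pi fun _ : ι => stdGauss d) ≤ ENNReal.ofReal (β k U.card) := by
  induction s using Finset.strongInduction generalizing U k m with
  | H s ih =>
    rcases k with _ | k
    · have e : ∀ a : ι → Fin d → ℝ, (prodGram a m U s 0 ^ (r + 1)).trace =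
          (jet m (quadProd a U) ⬝ᵥ jet m (quadProd a U)) ^ (r + 1) := fun a => by
        rw [← trace_vecMulVec_self_pow]
        simp [prodGram, jetGram, quadProd]
      simp only [e]
      rw [zero_add] at hm hT
      subst hm
      refine (lintegral_jet_quadProd_pow_le U (by omega) (le_trans ?_ hΔ)).trans
        (ENNReal.ofReal_le_ofReal (hbase _))
      gcongr
    · obtain ⟨m, rfl⟩ : ∃ m', m = m' + 2 := ⟨2 * (k + U.card), by omega⟩
      obtain rfl : m = 2 * (k + U.card) := by omega
      have hd : ∀ i ∈ s, i ∉ U := fun i hi hU => (Finset.disjoint_left.1 hUs) hU hi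
      have hde : ∀ i, Disjoint U (s.erase i) := fun i =>
        hUs.mono_right (Finset.erase_subset _ _)
      have hc : ∀ i, (s.erase i).card ≤ N := fun i =>
        (Finset.card_le_card (Finset.erase_subset _ _)).trans hs
      refine (lintegral_trace_prodGram_pow_succ_le (2 * (k + U.card)) k r hUs (hβ (k + 1) U.card)
        (hβ k U.card) (hβ k (U.card + 1)) (fun i hi => ?_) (fun i hi => ?_) fun i hi => ?_).trans
        (ENNReal.ofReal_le_ofReal (le_trans ?_ (hrec k U.card)))
      · exact ih _ (Finset.erase_ssubset hi) U (k + 1) _ (by omega) hT (hde i) (hc i)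
      · exact ih _ (Finset.erase_ssubset hi) U k _ (by omega) (by omega) (hde i) (hc i)
      · have hcard := Finset.card_insert_of_notMem (hd i hi)
        rw [← hcard]
        refine ih _ (Finset.erase_ssubset hi) (insert i U) k _ (by omega) (by omega) ?_ (hc i)
        exact Finset.disjoint_insert_left.2 ⟨Finset.notMem_erase i s, hde i⟩
      · have h1 := hβ k U.card
        have h2 := hβ k (U.card + 1)
        gcongr

/-- One term of the explicit solution of the moment recursion. -/
noncomputable def momentTerm (N P Δ : ℝ) (k u j : ℕ) : ℝ :=
  N ^ (k - j) / (k - j).factorial * (4 * P) ^ j * (Δ ^ (2 * (u + j)) / (2 * (u + j)).factorial)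

noncomputable def momentSum (N P Δ : ℝ) (p k u : ℕ) : ℝ :=
  ∑ j ∈ Finset.range (k + 1), momentTerm N P Δ k u j ^ p

/-- In unrolling the recursion, `j` counts the vectors moved to `U`, each costing `4P`, and the
other `k - j` steps produce `N^(k-j)/(k-j)!`. The quotient in `momentTerm` is the rank one bound for
the enlarged `U`, and `A^k` collects the factors that are not `p`-th powers of the rate. -/
noncomputable def momentBound (N P Δ A : ℝ) (p k u : ℕ) : ℝ :=
  (((2 * (k + u)).factorial : ℝ) ^ 2) ^ p * (A ^ k * momentSum N P Δ p k u)

variable {N P Δ A : ℝ}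

theorem momentTerm_nonneg (hN : 0 ≤ N) (hP : 0 ≤ P) (hΔ : 0 ≤ Δ) (k u j : ℕ) :
    0 ≤ momentTerm N P Δ k u j := by
  unfold momentTerm; positivity

theorem momentSum_nonneg (hN : 0 ≤ N) (hP : 0 ≤ P) (hΔ : 0 ≤ Δ) (p k u : ℕ) :
    0 ≤ momentSum N P Δ p k u :=
  Finset.sum_nonneg fun j _ => pow_nonneg (momentTerm_nonneg hN hP hΔ k u j) p

/-- A step that lowers the degree: `k + 1 - j ≤ k + 1` in the factorial. -/
theorem mul_momentTerm_le (hN : 0 ≤ N) (hP : 0 ≤ P) (hΔ : 0 ≤ Δ) {k j : ℕ} (u : ℕ) (hj : j ≤ k) :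
    N / (k + 1) * momentTerm N P Δ k u j ≤ momentTerm N P Δ (k + 1) u j := by
  unfold momentTerm
  rw [← mul_assoc, ← mul_assoc]
  gcongr ?_ * _ * _
  rw [Nat.succ_sub hj, Nat.factorial_succ, pow_succ, div_mul_div_comm, mul_comm N]
  push_cast
  have : ((k - j : ℕ) : ℝ) ≤ k := by exact_mod_cast Nat.sub_le k j
  gcongr

theorem mul_momentTerm_succ (N P Δ : ℝ) (k u j : ℕ) :
    4 * P * momentTerm N P Δ k (u + 1) j = momentTerm N P Δ (k + 1) u (j + 1) := by
  unfold momentTerm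
  rw [Nat.add_sub_add_right, show u + 1 + j = u + (j + 1) by ring]
  ring

theorem pow_mul_momentSum_le (hN : 0 ≤ N) (hP : 0 ≤ P) (hΔ : 0 ≤ Δ) (p k u : ℕ) :
    (N / (k + 1)) ^ p * momentSum N P Δ p k u ≤ momentSum N P Δ p (k + 1) u := by
  unfold momentSum
  rw [Finset.mul_sum, Finset.sum_range_succ _ (k + 1)]
  refine le_add_of_le_of_nonneg (Finset.sum_le_sum fun j hj => ?_)
    (pow_nonneg (momentTerm_nonneg hN hP hΔ _ _ _) _)
  rw [← mul_pow]
  exact pow_le_pow_left₀ (mul_nonneg (by positivity) (momentTerm_nonneg hN hP hΔ _ _ _))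
    (mul_momentTerm_le hN hP hΔ u (Finset.mem_range_succ_iff.1 hj)) p

theorem pow_mul_momentSum_succ_le (hN : 0 ≤ N) (hP : 0 ≤ P) (hΔ : 0 ≤ Δ) (p k u : ℕ) :
    (4 * P) ^ p * momentSum N P Δ p k (u + 1) ≤ momentSum N P Δ p (k + 1) u := by
  unfold momentSum
  rw [Finset.mul_sum, Finset.sum_range_succ' _ (k + 1)]
  refine le_add_of_le_of_nonneg (Finset.sum_le_sum fun j hj => ?_)
    (pow_nonneg (momentTerm_nonneg hN hP hΔ _ _ _) _)
  rw [← mul_pow, mul_momentTerm_succ]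

/-- After the common factorials are taken out, the terms have weights `A/2`, `16^(r+1) d²` and `n`,
and `A` is chosen so that these add up to `A`. -/
theorem momentBound_rec (d r n k u : ℕ) (hΔ : 0 ≤ Δ)
    (hA : A = 2 * 16 ^ (r + 1) * d ^ 2 + 2 * n) :
    1 / 2 * momentBound n (r + 1 : ℕ) Δ A (r + 1) (k + 1) u + (16 * (n : ℝ) / (k + 1)) ^ (r + 1) *
      (((((2 * (k + u) : ℕ) + 2 : ℝ) * ((2 * (k + u) : ℕ) + 1)) ^ 2) ^ (r + 1) * d ^ 2) *
        momentBound n (r + 1 : ℕ) Δ A (r + 1) k u +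
        n * ((4 * r) ^ r / (k + 1) * momentBound n (r + 1 : ℕ) Δ A (r + 1) k (u + 1)) ≤
      momentBound n (r + 1 : ℕ) Δ A (r + 1) (k + 1) u := by
  have hn : (0 : ℝ) ≤ n := by positivity
  have hP : (0 : ℝ) ≤ (r + 1 : ℕ) := by positivity
  have hA0 : 0 ≤ A := by rw [hA]; positivity
  set F : ℝ := (((2 * (k + 1 + u)).factorial : ℝ) ^ 2) ^ (r + 1) with hF
  set S := momentSum n (r + 1 : ℕ) Δ (r + 1) (k + 1) u with hS
  have hF1 : ((((2 * (k + u) : ℕ) + 2 : ℝ) * ((2 * (k + u) : ℕ) + 1)) ^ 2) ^ (r + 1) *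
      (((2 * (k + u)).factorial : ℝ) ^ 2) ^ (r + 1) = F := by
    rw [hF, ← mul_pow, ← mul_pow, show 2 * (k + 1 + u) = 2 * (k + u) + 1 + 1 by ring,
      Nat.factorial_succ, Nat.factorial_succ]
    congr 2
    push_cast
    ring
  have hF2 : (((2 * (k + (u + 1))).factorial : ℝ) ^ 2) ^ (r + 1) = F := by
    rw [hF, show k + (u + 1) = k + 1 + u by ring]
  have hF0 : 0 ≤ F := by positivity
  have h1 := pow_mul_momentSum_le hn hP hΔ (r + 1) k u
  have h2 := pow_mul_momentSum_succ_le hn hP hΔ (r + 1) k u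
  have h3 : (4 * (r : ℝ)) ^ r / (k + 1) ≤ (4 * (r + 1 : ℕ) : ℝ) ^ (r + 1) := by
    calc (4 * (r : ℝ)) ^ r / (k + 1) ≤ (4 * (r : ℝ)) ^ r / 1 := by
          gcongr
          linarith [(by positivity : (0 : ℝ) ≤ k)]
      _ ≤ (4 * (r + 1 : ℕ) : ℝ) ^ r := by
          rw [div_one]
          gcongr
          omega
      _ ≤ _ := pow_le_pow_right₀ (by push_cast; linarith [(by positivity : (0 : ℝ) ≤ r)])
          (by omega)
  have hM0 := momentSum_nonneg hn hP hΔ (r + 1) k (u + 1)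
  unfold momentBound
  rw [hF2]
  calc _ = 1 / 2 * (F * (A ^ (k + 1) * S)) + F * (A ^ k * (16 ^ (r + 1) * d ^ 2 *
        ((n / (k + 1)) ^ (r + 1) * momentSum n (r + 1 : ℕ) Δ (r + 1) k u))) +
        F * (A ^ k * (n * ((4 * r) ^ r / (k + 1) *
          momentSum n (r + 1 : ℕ) Δ (r + 1) k (u + 1)))) := by
        rw [mul_div_assoc, mul_pow 16]
        generalize ((((2 * (k + u) : ℕ) + 2 : ℝ) * ((2 * (k + u) : ℕ) + 1)) ^ 2) ^ (r + 1) = G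
          at hF1
        generalize (((2 * (k + u)).factorial : ℝ) ^ 2) ^ (r + 1) = H at hF1
        linear_combination (16 ^ (r + 1) * (n / (k + 1)) ^ (r + 1) * d ^ 2 * A ^ k *
          momentSum n (r + 1 : ℕ) Δ (r + 1) k u) * hF1
    _ ≤ 1 / 2 * (F * (A ^ (k + 1) * S)) + F * (A ^ k * (16 ^ (r + 1) * d ^ 2 * S)) +
        F * (A ^ k * (n * S)) := by
        gcongr
        exact (mul_le_mul_of_nonneg_right h3 hM0).trans h2
    _ = _ := by rw [pow_succ A k, hA]; ring

/-- The factorials give `k^j`, and `k^(2j)/(2j)! ≤ e^k`, so each of the `j` factors `PΔ²` is divided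
by `k` at a total cost of at most `3^k`. -/
theorem factorial_mul_momentTerm_le (hN : 0 ≤ N) (hP : 0 ≤ P) {k j : ℕ} (hk : 1 ≤ k)
    (hj : j ≤ k) :
    k.factorial * momentTerm N P Δ k 0 j ≤ (3 * (N + 4 * P * Δ ^ 2 / k)) ^ k := by
  have hk0 : (0 : ℝ) < k := by exact_mod_cast hk
  have hV : 0 ≤ 4 * P * Δ ^ 2 / k := by positivity
  have h1 : (k.factorial : ℝ) / (k - j).factorial ≤ k ^ j := by
    rw [div_le_iff₀ (by positivity)]
    have := Nat.factorial_mul_descFactorial hj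
    rw [← this, mul_comm]
    push_cast
    gcongr
    exact_mod_cast Nat.descFactorial_le_pow k j
  have h2 : (k : ℝ) ^ (2 * j) / (2 * j).factorial ≤ 3 ^ k := by
    refine (Real.pow_div_factorial_le_exp k hk0.le (2 * j)).trans ?_
    rw [← mul_one (k : ℝ), Real.exp_nat_mul]
    gcongr
    exact Real.exp_one_lt_three.le
  calc _ = N ^ (k - j) * (((k.factorial : ℝ) / (k - j).factorial) *
        ((4 * P * Δ ^ 2) ^ j / (2 * j).factorial)) := by
        unfold momentTerm
        rw [zero_add, mul_pow (4 * P) (Δ ^ 2), ← pow_mul]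
        ring
    _ ≤ N ^ (k - j) * (k ^ j * ((4 * P * Δ ^ 2) ^ j / (2 * j).factorial)) := by gcongr
    _ = N ^ (k - j) * (4 * P * Δ ^ 2 / k) ^ j * ((k : ℝ) ^ (2 * j) / (2 * j).factorial) := by
        rw [div_pow, two_mul j, pow_add]
        field_simp
    _ ≤ (N + 4 * P * Δ ^ 2 / k) ^ (k - j) * (N + 4 * P * Δ ^ 2 / k) ^ j * 3 ^ k := by
        gcongr
        · linarith
        · linarith
    _ = _ := by rw [← pow_add, Nat.sub_add_cancel hj, mul_pow]; ring

/-- The `k`-th certificate value is expected to be below this number to the power `k`,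
up to a constant factor in the base. -/
noncomputable def certRate (n d p k : ℕ) : ℝ := n + p * d ^ 2 / k + p ^ 3 * k

/-- Since `d ≤ n ≤ 2^p`, the factor `A` is at most `256^p`, a constant after the `p`-th root; the
number `k + 1` of terms costs `2^k`. -/
theorem factorial_pow_mul_momentBound_le {n d p k : ℕ} (hk : 1 ≤ k) (hp : 1 ≤ p) (hdn : d ≤ n)
    (hnp : n ≤ 2 ^ p) :
    (k.factorial : ℝ) ^ p * momentBound n p (48 * (d + p * (2 * k : ℕ)))
        (2 * 16 ^ p * d ^ 2 + 2 * n) p k 0 ≤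
      (((2 * k).factorial : ℝ) ^ 2 * (2 ^ 27 * certRate n d p k) ^ k) ^ p := by
  have hk0 : (0 : ℝ) < k := by exact_mod_cast hk
  set Δ : ℝ := 48 * (d + p * (2 * k : ℕ)) with hΔ
  have hΔ0 : 0 ≤ Δ := by positivity
  set W : ℝ := n + 4 * p * Δ ^ 2 / k with hW
  have hW0 : 0 ≤ W := by positivity
  -- From `(d + 2pk)² ≤ 2d² + 8p²k²`; the constant is `4 · 48² · 8`. Later `256 · 2 · 3 · 73728 ≤
  -- 2^27`.
  have hWc : W ≤ 73728 * certRate n d p k := by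
    have : 4 * (p : ℝ) * Δ ^ 2 / k ≤ 73728 * (p * d ^ 2 / k + p ^ 3 * k) := by
      rw [div_le_iff₀ hk0]
      have e : 73728 * ((p : ℝ) * d ^ 2 / k + p ^ 3 * k) * k =
        73728 * (p * d ^ 2 + p ^ 3 * k ^ 2) := by field_simp
      rw [e, hΔ]
      push_cast
      have := mul_nonneg (by positivity : (0 : ℝ) ≤ p) (sq_nonneg ((d : ℝ) - 2 * p * k))
      have h3 : (0 : ℝ) ≤ p * d ^ 2 := by positivity
      nlinarith
    have hn : (0 : ℝ) ≤ n := by positivity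
    rw [hW, certRate]
    linarith
  have hA : 2 * 16 ^ p * (d : ℝ) ^ 2 + 2 * n ≤ 256 ^ p := by
    have hn : (n : ℝ) ≤ 2 ^ p := by exact_mod_cast hnp
    have hd : (d : ℝ) ≤ 2 ^ p := le_trans (by exact_mod_cast hdn) hn
    have h4 : (4 : ℝ) ≤ 4 ^ p := le_self_pow₀ (by norm_num) (by omega)
    have h16 : (16 : ℝ) ^ p = (2 ^ p) ^ 4 := by rw [← pow_mul, mul_comm, pow_mul]; norm_num
    have h256 : (256 : ℝ) ^ p = 4 ^ p * (2 ^ p) ^ 6 := by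
      rw [← pow_mul, mul_comm p, pow_mul, ← mul_pow]; norm_num
    have h2 : (1 : ℝ) ≤ 2 ^ p := one_le_pow₀ (by norm_num)
    calc 2 * 16 ^ p * (d : ℝ) ^ 2 + 2 * n ≤ 2 * (2 ^ p) ^ 4 * (2 ^ p) ^ 2 + 2 * (2 ^ p) ^ 6 := by
          rw [h16]
          gcongr
          exact hn.trans (le_self_pow₀ h2 (by norm_num))
      _ = 4 * (2 ^ p) ^ 6 := by ring
      _ ≤ _ := by rw [h256]; gcongr
  have hS : (k.factorial : ℝ) ^ p * momentSum n p Δ p k 0 ≤ (2 ^ k) ^ p * ((3 * W) ^ k) ^ p := by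
    unfold momentSum
    rw [Finset.mul_sum]
    calc _ ≤ ∑ j ∈ Finset.range (k + 1), ((3 * W) ^ k) ^ p := by
          refine Finset.sum_le_sum fun j hj => ?_
          rw [← mul_pow]
          exact pow_le_pow_left₀ (mul_nonneg (by positivity)
            (momentTerm_nonneg (by positivity) (by positivity) hΔ0 _ _ _))
            (factorial_mul_momentTerm_le (by positivity) (by positivity) hk
              (Finset.mem_range_succ_iff.1 hj)) p
      _ = ((k + 1 : ℕ) : ℝ) * ((3 * W) ^ k) ^ p := by simp
      _ ≤ _ := by
          gcongr
          calc ((k + 1 : ℕ) : ℝ) ≤ (2 ^ k : ℕ) := by exact_mod_cast Nat.lt_two_pow_self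
            _ ≤ (2 ^ k) ^ p := by
              push_cast
              exact le_self_pow₀ (one_le_pow₀ (by norm_num)) (by omega)
  unfold momentBound
  rw [add_zero]
  calc _ = (((2 * k).factorial : ℝ) ^ 2) ^ p * ((2 * 16 ^ p * (d : ℝ) ^ 2 + 2 * n) ^ k *
        ((k.factorial : ℝ) ^ p * momentSum n p Δ p k 0)) := by ring
    _ ≤ (((2 * k).factorial : ℝ) ^ 2) ^ p * ((256 ^ p) ^ k *
        ((2 ^ k) ^ p * ((3 * W) ^ k) ^ p)) := by
        have := momentSum_nonneg (by positivity : (0 : ℝ) ≤ n) (by positivity : (0 : ℝ) ≤ p) hΔ0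
          p k 0
        gcongr
    _ = (((2 * k).factorial : ℝ) ^ 2 * (1536 * W) ^ k) ^ p := by
        rw [pow_right_comm (256 : ℝ), ← mul_pow, ← mul_pow, ← mul_pow, ← mul_pow, ← mul_pow]
        ring_nf
    _ ≤ _ := by
        have : 0 ≤ certRate n d p k := by unfold certRate; positivity
        have : 1536 * W ≤ 2 ^ 27 * certRate n d p k := by linarith
        gcongr

theorem lintegral_trace_smul_prodGram_pow_le {n d p k : ℕ} (hk : 1 ≤ k) (hp : 1 ≤ p) (hdn : d ≤ n)
    (hnp : n ≤ 2 ^ p) :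
    ∫⁻ a, ENNReal.ofReal
        ((((k.factorial : ℝ) • prodGram a (2 * k) ∅ Finset.univ k) ^ p).trace)
        ∂(gaussianVectors n d) ≤
      ENNReal.ofReal ((((2 * k).factorial : ℝ) ^ 2 * (2 ^ 27 * certRate n d p k) ^ k) ^ p) := by
  obtain ⟨r, rfl⟩ : ∃ r, p = r + 1 := ⟨p - 1, by omega⟩
  refine le_trans ?_ (ENNReal.ofReal_le_ofReal (factorial_pow_mul_momentBound_le hk hp hdn hnp))
  set Δ : ℝ := 48 * (d + (r + 1 : ℕ) * (2 * k : ℕ)) with hΔ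
  have hΔ0 : 0 ≤ Δ := by positivity
  set A : ℝ := 2 * 16 ^ (r + 1) * d ^ 2 + 2 * n with hA
  have hA0 : 0 ≤ A := by positivity
  have h := lintegral_trace_prodGram_pow_le (d := d) (ι := Fin n) r n k
    (momentBound n (r + 1 : ℕ) Δ A (r + 1))
    (fun k u => mul_nonneg (by positivity) (mul_nonneg (by positivity)
      (momentSum_nonneg (by positivity) (by positivity) hΔ0 _ _ _))) hΔ.ge (fun u => le_of_eq ?_)
    (fun k u => momentBound_rec d r n k u hΔ0 hA) Finset.univ ∅ k (2 * k) (by simp) (by simp)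
    (by simp) (by simp)
  · simp only [smul_pow, trace_smul, smul_eq_mul]
    have h0 : (0 : ℝ) ≤ (k.factorial : ℝ) ^ (r + 1) := by positivity
    simp only [ENNReal.ofReal_mul h0]
    rw [lintegral_const_mul' _ _ ENNReal.ofReal_ne_top]
    exact mul_le_mul' le_rfl h
  · simp only [momentBound, momentSum, momentTerm, zero_add, Finset.sum_range_one, pow_zero,
      one_mul, Nat.sub_self, Nat.factorial_zero, Nat.cast_one, div_one, add_zero]
    rw [← mul_pow]
    congr 1
    field_simp

end MomentBound

/-! ### Soundness and completeness of the trace certificate -/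

section Certificate

open MeasureTheory ProbabilityTheory MvPolynomial Matrix

variable {n d : ℕ}

noncomputable def certMatrix (a : Fin n → Fin d → ℝ) (k : ℕ) :
    Matrix (Fin (2 * k) → Fin d) (Fin (2 * k) → Fin d) ℝ :=
  (k.factorial : ℝ) • prodGram a (2 * k) ∅ Finset.univ k

theorem certMatrix_posSemidef (a : Fin n → Fin d → ℝ) (k : ℕ) : (certMatrix a k).PosSemidef :=
  (prodGram_posSemidef a (2 * k) ∅ Finset.univ k).smul (by positivity)

/-- The bound that the certificate puts on the `k`-th elementary symmetric function. -/
noncomputable def certBase (c n d k : ℕ) : ℝ := 2 ^ (28 + c) * certRate n d (Nat.clog 2 n) k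

/-- The base carries `2^(28+c)` where the moment bound has `2^27`. The surplus `2^(c+1)` per degree,
raised to the power `⌈log₂ n⌉`, pays for Markov's inequality. -/
noncomputable def certThreshold (c n d k : ℕ) : ℝ :=
  (((2 * k).factorial : ℝ) ^ 2 * certBase c n d k ^ k) ^ Nat.clog 2 n

/-- All `k ≤ t` are tested because the expansion of the shifted product involves lower orders. The
case `n = 1` is rejected: there the exponent is zero, the trace carries no information, and the
allowed failure probability is one. -/
def CertHolds (c n d t : ℕ) (a : Fin n → Fin d → ℝ) : Prop :=
  2 ≤ n ∧ ∀ k ∈ Finset.Icc 1 t, (certMatrix a k ^ Nat.clog 2 n).trace ≤ certThreshold c n d k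

theorem certRate_nonneg (n d p k : ℕ) : 0 ≤ certRate n d p k := by unfold certRate; positivity

theorem certBase_nonneg (c n d k : ℕ) : 0 ≤ certBase c n d k :=
  mul_nonneg (by positivity) (certRate_nonneg _ _ _ _)

/-- Each pairing with the power evaluates a product at `x` up to `(2k)!²`, and the quadratic form
squares this factor. -/
theorem dotProduct_certMatrix_mulVec (a : Fin n → Fin d → ℝ) (k : ℕ) (x : Fin d → ℝ) :
    jet (2 * k) (linForm x ^ (2 * k)) ⬝ᵥ certMatrix a k *ᵥ jet (2 * k) (linForm x ^ (2 * k)) =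
      ((2 * k).factorial : ℝ) ^ 4 * (k.factorial *
        ∑ S ∈ Finset.univ.powersetCard k, ∏ i ∈ S, ((a i ⬝ᵥ x) ^ 2 - x ⬝ᵥ x) ^ 2) := by
  rw [certMatrix, smul_mulVec, dotProduct_smul, prodGram, dotProduct_jetGram_mulVec, smul_eq_mul,
    mul_left_comm]
  congr 1
  rw [Finset.mul_sum]
  refine Finset.sum_congr rfl fun S hS => ?_
  rw [Finset.mem_powersetCard] at hS
  have : quadProd a ∅ * quadProd a S = ∏ i ∈ S, quadForm (a i) := by simp [quadProd]
  rw [this, dotProduct_comm, jet_prod_quadForm_dotProduct_pow S a x (by omega), mul_pow,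
    ← Finset.prod_pow, ← pow_mul]

/-- The test jet has squared norm `(2k)!²`. With the `(2k)!²` in the threshold this matches the
`(2k)!⁴` of the quadratic form exactly, so only `certBase` remains. -/
theorem CertHolds.factorial_mul_sum_le {c t : ℕ} {a : Fin n → Fin d → ℝ} (h : CertHolds c n d t a)
    {k : ℕ} (hk : k ≤ t) {x : Fin d → ℝ} (hx : x ⬝ᵥ x = 1) :
    k.factorial * ∑ S ∈ Finset.univ.powersetCard k, ∏ i ∈ S, ((a i ⬝ᵥ x) ^ 2 - 1) ^ 2 ≤
      certBase c n d k ^ k := by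
  rcases Nat.eq_zero_or_pos k with rfl | hk0
  · simp
  have hp : Nat.clog 2 n ≠ 0 := (Nat.clog_pos (by norm_num) h.1).ne'
  have h1 := dotProduct_mulVec_pow_le_trace (certMatrix_posSemidef a k)
    (jet (2 * k) (linForm x ^ (2 * k))) hp
  have h2 := h.2 k (Finset.mem_Icc.2 ⟨hk0, hk⟩)
  rw [dotProduct_certMatrix_mulVec, jet_linForm_pow_dotProduct_self, hx, one_pow, mul_one] at h1
  set E : ℝ := k.factorial * ∑ S ∈ Finset.univ.powersetCard k, ∏ i ∈ S, ((a i ⬝ᵥ x) ^ 2 - 1) ^ 2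
  have hf : (0 : ℝ) < ((2 * k).factorial : ℝ) := by positivity
  have h3 : (((2 * k).factorial : ℝ) ^ 4 * E) ^ Nat.clog 2 n ≤
      (((2 * k).factorial : ℝ) ^ 4 * certBase c n d k ^ k) ^ Nat.clog 2 n := by
    refine h1.trans ((mul_le_mul_of_nonneg_right h2 (by positivity)).trans (le_of_eq ?_))
    rw [certThreshold, ← mul_pow]
    congr 1
    ring
  have h4 := le_of_pow_le_pow_left₀ hp
    (mul_nonneg (by positivity) (pow_nonneg (certBase_nonneg c n d k) k)) h3
  exact le_of_mul_le_mul_left h4 (by positivity)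

theorem card_filter_superset_le {n : ℕ} {t : ℕ} {T : Finset (Fin n)} :
    ((Finset.univ.powersetCard t).filter (T ⊆ ·)).card ≤ n.choose (t - T.card) := by
  have : n.choose (t - T.card) =
      ((Finset.univ : Finset (Fin n)).powersetCard (t - T.card)).card := by simp
  rw [this]
  refine Finset.card_le_card_of_injOn (· \ T) (fun S hS => ?_) fun S hS S' hS' e => ?_
  · simp only [Finset.coe_filter, Finset.mem_powersetCard, Set.mem_ofPred_eq] at hS
    simp only [Finset.mem_coe,
      Finset.mem_powersetCard]
    exact ⟨Finset.subset_univ _, by rw [Finset.card_sdiff_of_subset hS.2, hS.1.2]⟩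
  · simp only [Finset.coe_filter, Finset.mem_powersetCard, Set.mem_ofPred_eq] at hS hS'
    simp only at e
    rw [← Finset.sdiff_union_of_subset hS.2, e, Finset.sdiff_union_of_subset hS'.2]

/-- Expand each product over subsets `T`. A set of size `k` lies in at most `n.choose (t - k)` sets
of size `t`, and this binomial is at most `n^(t-k)/(t-k)!`. -/
theorem factorial_mul_sum_prod_add_one_le (t : ℕ) (w : Fin n → ℝ) (hw : ∀ i, 0 ≤ w i) :
    t.factorial * ∑ S ∈ Finset.univ.powersetCard t, ∏ i ∈ S, (w i + 1) ≤
      ∑ k ∈ Finset.range (t + 1), (t.choose k : ℝ) * (n : ℝ) ^ (t - k) *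
        (k.factorial * ∑ S ∈ Finset.univ.powersetCard k, ∏ i ∈ S, w i) := by
  have e : ∑ S ∈ (Finset.univ : Finset (Fin n)).powersetCard t, ∏ i ∈ S, (w i + 1) =
      ∑ k ∈ Finset.range (t + 1), ∑ T ∈ Finset.univ.powersetCard k,
        ((Finset.univ.powersetCard t).filter (T ⊆ ·)).card * ∏ i ∈ T, w i := by
    have h1 : ∀ S ∈ (Finset.univ : Finset (Fin n)).powersetCard t, ∏ i ∈ S, (w i + 1) =
        ∑ k ∈ Finset.range (t + 1), ∑ T ∈ Finset.univ.powersetCard k,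
          if T ⊆ S then ∏ i ∈ T, w i else 0 := by
      intro S hS
      rw [Finset.prod_add_one, Finset.sum_powerset, (Finset.mem_powersetCard.1 hS).2]
      refine Finset.sum_congr rfl fun k _ => ?_
      rw [← Finset.sum_filter]
      refine Finset.sum_congr ?_ fun _ _ => rfl
      ext T
      simp only [Finset.mem_powersetCard, Finset.mem_filter, Finset.subset_univ, true_and]
      tauto
    rw [Finset.sum_congr rfl h1, Finset.sum_comm]
    refine Finset.sum_congr rfl fun k _ => ?_
    rw [Finset.sum_comm]
    refine Finset.sum_congr rfl fun T _ => ?_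
    rw [← Finset.sum_filter, Finset.sum_const, nsmul_eq_mul]
  rw [e, Finset.mul_sum]
  refine Finset.sum_le_sum fun k hk => ?_
  have hkt : k ≤ t := Finset.mem_range_succ_iff.1 hk
  rw [Finset.mul_sum, Finset.mul_sum, Finset.mul_sum]
  refine Finset.sum_le_sum fun T hT => ?_
  have hTk := (Finset.mem_powersetCard.1 hT).2
  have h0 : 0 ≤ ∏ i ∈ T, w i := Finset.prod_nonneg fun i _ => hw i
  rw [← mul_assoc, ← mul_assoc]
  refine mul_le_mul_of_nonneg_right ?_ h0
  have h1 : (((Finset.univ.powersetCard t).filter (T ⊆ ·)).card : ℝ) ≤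
      (n : ℝ) ^ (t - k) / (t - k).factorial :=
    le_trans (by exact_mod_cast hTk ▸ card_filter_superset_le) (Nat.choose_le_pow_div (t - k) n)
  refine (mul_le_mul_of_nonneg_left h1 (by positivity)).trans (le_of_eq ?_)
  rw [← Nat.choose_mul_factorial_mul_factorial hkt]
  push_cast
  field_simp

theorem certRate_le (n d p : ℕ) {k t : ℕ} (hk : 1 ≤ k) (hkt : k ≤ t) :
    certRate n d p k ≤ t / k * certRate n d p t := by
  have hk0 : (0 : ℝ) < k := by exact_mod_cast hk
  have ht0 : (0 : ℝ) < t := by exact_mod_cast hk.trans hkt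
  have h : (k : ℝ) ≤ t := by exact_mod_cast hkt
  have e : (t : ℝ) / k * certRate n d p t = (t / k) * n + p * d ^ 2 / k + p ^ 3 * (t * t / k) := by
    unfold certRate
    field_simp
  have h1 : (1 : ℝ) ≤ t / k := by rwa [one_le_div hk0]
  have h2 : (k : ℝ) ≤ t * t / k := by rw [le_div_iff₀ hk0]; gcongr
  rw [e, certRate]
  have hn : (0 : ℝ) ≤ n := by positivity
  gcongr
  nlinarith

/-- Passing from order `k` to order `t` costs at most `t/k` in the base, and `(t/k)^k ≤ t^k/k! ≤
e^t`. -/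
theorem certBase_pow_le (c n d : ℕ) {k t : ℕ} (hkt : k ≤ t) :
    certBase c n d k ^ k ≤ 3 ^ t * certBase c n d t ^ k := by
  rcases Nat.eq_zero_or_pos k with rfl | hk
  · simpa using one_le_pow₀ (by norm_num : (1 : ℝ) ≤ 3)
  have hk0 : (0 : ℝ) < k := by exact_mod_cast hk
  have h1 : certBase c n d k ≤ t / k * certBase c n d t := by
    unfold certBase
    rw [mul_left_comm]
    exact mul_le_mul_of_nonneg_left (certRate_le n d _ hk hkt) (by positivity)
  have h2 : ((t : ℝ) / k) ^ k ≤ 3 ^ t := by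
    have h3 := Real.pow_div_factorial_le_exp (t : ℝ) (by positivity) k
    calc ((t : ℝ) / k) ^ k = t ^ k / k ^ k := div_pow _ _ _
      _ ≤ t ^ k / k.factorial := by
          gcongr
          exact_mod_cast Nat.factorial_le_pow k
      _ ≤ Real.exp 1 ^ t := by rwa [← Real.exp_nat_mul, mul_one]
      _ ≤ 3 ^ t := by
          gcongr
          exact Real.exp_one_lt_three.le
  calc _ ≤ (t / k * certBase c n d t) ^ k := pow_le_pow_left₀ (certBase_nonneg _ _ _ _) h1 k
    _ = (t / k) ^ k * certBase c n d t ^ k := mul_pow _ _ _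
    _ ≤ _ := mul_le_mul_of_nonneg_right h2 (pow_nonneg (certBase_nonneg _ _ _ _) k)

theorem clog_le_log (hn : 2 ≤ n) : (Nat.clog 2 n : ℝ) ≤ 3 * Real.log n := by
  have h2 := Real.log_two_gt_d9
  have hlog : Real.log 2 ≤ Real.log n := Real.log_le_log (by norm_num) (by exact_mod_cast hn)
  have hc : 1 ≤ Nat.clog 2 n := Nat.clog_pos (by norm_num) hn
  have h : ((Nat.clog 2 n - 1 : ℕ) : ℝ) * Real.log 2 ≤ Real.log n := by
    rw [← Real.log_pow]
    refine Real.log_le_log (by positivity) ?_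
    exact_mod_cast (Nat.pow_pred_clog_lt_self (by norm_num) (by omega)).le
  push_cast [hc] at h
  nlinarith

/-- The hypothesis on `t` is needed for the summand `p³ t` alone, which is `O(t log⁶ n)`; for `p
d²/t` a power of the logarithm is to spare. The lower bound `log n ≥ log 2` permits raising the
powers of the logarithm. -/
theorem certRate_clog_le {t : ℕ} (hn : 2 ≤ n) (ht : 1 ≤ t)
    (h : (t : ℝ) * Real.log n ^ 6 ≤ rateBound n d t) :
    certRate n d (Nat.clog 2 n) t ≤ 132 * rateBound n d t := by
  have ht0 : (0 : ℝ) < t := by exact_mod_cast ht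
  have h2 := Real.log_two_gt_d9
  have hlog : Real.log 2 ≤ Real.log n := Real.log_le_log (by norm_num) (by exact_mod_cast hn)
  set L := Real.log n with hL
  have hL1 : 3 / 5 ≤ L := by linarith
  have hp := clog_le_log hn
  rw [← hL] at hp
  set p : ℝ := (Nat.clog 2 n : ℝ) with hpdef
  have hp0 : 0 ≤ p := by positivity
  have h1 : p * d ^ 2 / t ≤ 5 * (d ^ 2 / t * L ^ 2) := by
    have : p ≤ 5 * L ^ 2 := by nlinarith
    calc p * d ^ 2 / t = p * (d ^ 2 / t) := by ring
      _ ≤ 5 * L ^ 2 * (d ^ 2 / t) := by gcongr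
      _ = _ := by ring
  have h3 : p ^ 3 * t ≤ 125 * (t * L ^ 6) := by
    have h4 : p ^ 3 ≤ (3 * L) ^ 3 := pow_le_pow_left₀ hp0 hp 3
    have h5 : (3 / 5 : ℝ) ^ 3 ≤ L ^ 3 := pow_le_pow_left₀ (by norm_num) hL1 3
    have h6 : p ^ 3 ≤ 125 * L ^ 6 := by
      have : L ^ 6 = L ^ 3 * L ^ 3 := by ring
      nlinarith
    nlinarith
  have hr : rateBound n d t = n + d ^ 2 / t * L ^ 2 := rfl
  have h7 : 0 ≤ (d : ℝ) ^ 2 / t * L ^ 2 := by positivity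
  have h8 : (0 : ℝ) ≤ n := by positivity
  rw [certRate, ← hpdef]
  linarith

theorem CertHolds.distinctProducts_le {c t : ℕ} {a : Fin n → Fin d → ℝ} (h : CertHolds c n d t a)
    (ht : 1 ≤ t) (hr : (t : ℝ) * Real.log n ^ 6 ≤ rateBound n d t)
    (x : EuclideanSpace ℝ (Fin d)) (hx : ‖x‖ = 1) :
    distinctProducts t a x ≤ (((2 ^ (40 + c) : ℕ) : ℝ) * rateBound n d t) ^ t := by
  set y : Fin d → ℝ := x.ofLp with hy
  have hyy : y ⬝ᵥ y = 1 := by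
    have := EuclideanSpace.norm_sq_eq x
    rw [hx] at this
    simp only [Real.norm_eq_abs, sq_abs, one_pow] at this
    rw [this]
    exact Finset.sum_congr rfl fun _ _ => (sq _).symm
  set w : Fin n → ℝ := fun i => ((a i ⬝ᵥ y) ^ 2 - 1) ^ 2 with hw
  have hw0 : ∀ i, 0 ≤ w i := fun i => sq_nonneg _
  set ρ := certBase c n d t with hρ
  have hnρ : (n : ℝ) ≤ ρ := by
    have h1 : (n : ℝ) ≤ certRate n d (Nat.clog 2 n) t := by
      unfold certRate
      have : (0 : ℝ) ≤ Nat.clog 2 n * d ^ 2 / t + Nat.clog 2 n ^ 3 * t := by positivity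
      linarith
    have h2 : (1 : ℝ) ≤ 2 ^ (28 + c) := one_le_pow₀ (by norm_num)
    have h3 := certRate_nonneg n d (Nat.clog 2 n) t
    rw [hρ, certBase]
    nlinarith
  have hρ0 : 0 ≤ ρ := certBase_nonneg _ _ _ _
  have hn0 : (0 : ℝ) ≤ n := by positivity
  calc distinctProducts t a x = t.factorial * ∑ S ∈ Finset.univ.powersetCard t,
        ∏ i ∈ S, (a i ⬝ᵥ y) ^ 4 := rfl
    _ ≤ t.factorial * ∑ S ∈ Finset.univ.powersetCard t, ∏ i ∈ S, (2 * (w i + 1)) := by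
        gcongr with S _ i
        simp only [hw]
        -- The gap between `2((y² - 1)² + 1)` and `y⁴` is `(y² - 2)²`.
        nlinarith [sq_nonneg ((a i ⬝ᵥ y) ^ 2 - 2)]
    _ = 2 ^ t * (t.factorial * ∑ S ∈ Finset.univ.powersetCard t, ∏ i ∈ S, (w i + 1)) := by
        rw [mul_left_comm, Finset.mul_sum _ _ ((2 : ℝ) ^ t)]
        congr 1
        refine Finset.sum_congr rfl fun S hS => ?_
        rw [Finset.prod_mul_distrib, Finset.prod_const, (Finset.mem_powersetCard.1 hS).2]
    _ ≤ 2 ^ t * ∑ k ∈ Finset.range (t + 1), (t.choose k : ℝ) * (n : ℝ) ^ (t - k) *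
          (3 ^ t * ρ ^ k) := by
        refine mul_le_mul_of_nonneg_left
          ((factorial_mul_sum_prod_add_one_le t w hw0).trans ?_) (by positivity)
        refine Finset.sum_le_sum fun k hk => ?_
        have hkt : k ≤ t := Finset.mem_range_succ_iff.1 hk
        exact mul_le_mul_of_nonneg_left
          ((h.factorial_mul_sum_le hkt hyy).trans (certBase_pow_le c n d hkt)) (by positivity)
    _ = (6 * (ρ + n)) ^ t := by
        rw [mul_pow, add_pow, show (6 : ℝ) = 2 * 3 by norm_num, mul_pow, mul_assoc,
          Finset.mul_sum _ _ ((3 : ℝ) ^ t)]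
        congr 1
        exact Finset.sum_congr rfl fun k _ => by ring
    _ ≤ _ := by
        -- Since `n ≤ ρ`, the base is at most `12ρ`, and `12 · 132 ≤ 4096 = 2^12`.
        refine pow_le_pow_left₀ (by positivity) ?_ t
        have h1 := certRate_clog_le h.1 ht hr
        have h2 : ρ ≤ 2 ^ (28 + c) * (132 * rateBound n d t) :=
          mul_le_mul_of_nonneg_left h1 (by positivity)
        have h3 := (certRate_nonneg n d (Nat.clog 2 n) t).trans h1
        have h4 : ((2 ^ (40 + c) : ℕ) : ℝ) = 4096 * 2 ^ (28 + c) := by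
          push_cast
          rw [pow_add, pow_add]
          norm_num
          ring
        rw [h4]
        have h5 : 0 ≤ (2 : ℝ) ^ (28 + c) * rateBound n d t :=
          mul_nonneg (by positivity) (by linarith)
        nlinarith

/-- Markov's inequality: the threshold exceeds the bound `B` on the mean by a factor of at least
`n^(c+1)`. One power of `n` is reserved for the union over `k`. -/
theorem measure_certThreshold_lt {c k : ℕ} (hn : 2 ≤ n) (hk : 1 ≤ k) (hd : d ≤ n) :
    gaussianVectors n d {a | certThreshold c n d k < (certMatrix a k ^ Nat.clog 2 n).trace} ≤
      ENNReal.ofReal (1 / (n : ℝ) ^ (c + 1)) := by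
  set p := Nat.clog 2 n with hp
  have hp1 : 1 ≤ p := Nat.clog_pos (by norm_num) hn
  have hnp : n ≤ 2 ^ p := Nat.le_pow_clog (by norm_num) n
  have hE := lintegral_trace_smul_prodGram_pow_le hk hp1 hd hnp
  set B : ℝ := (((2 * k).factorial : ℝ) ^ 2 * (2 ^ 27 * certRate n d p k) ^ k) ^ p with hB
  have hrate : 0 < certRate n d p k := by
    unfold certRate
    have : (0 : ℝ) < n := by exact_mod_cast (by omega : 0 < n)
    positivity
  have hB0 : 0 < B := by positivity
  have hn0 : (0 : ℝ) < n := by exact_mod_cast (by omega : 0 < n)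
  have hBt : (n : ℝ) ^ (c + 1) * B ≤ certThreshold c n d k := by
    have h1 : certThreshold c n d k = ((2 ^ (c + 1)) ^ k) ^ p * B := by
      rw [hB, certThreshold, ← hp, certBase, ← hp, ← mul_pow, show 28 + c = c + 1 + 27 by ring,
        pow_add 2 (c + 1) 27, mul_assoc (2 ^ (c + 1)), mul_pow (2 ^ (c + 1))]
      congr 1
      ring
    rw [h1]
    refine mul_le_mul_of_nonneg_right ?_ hB0.le
    calc (n : ℝ) ^ (c + 1) ≤ (2 ^ p) ^ (c + 1) := by
          gcongr
          exact_mod_cast hnp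
      _ = ((2 : ℝ) ^ (c + 1)) ^ p := pow_right_comm _ _ _
      _ ≤ _ := by
          gcongr
          exact le_self_pow₀ (one_le_pow₀ (by norm_num)) (by omega)
  have hmeas : Measurable fun a : Fin n → Fin d → ℝ => (certMatrix a k ^ p).trace := by
    simp only [certMatrix, smul_pow, trace_smul, smul_eq_mul]
    exact (measurable_trace_prodGram_pow _ _ _ _ _).const_mul _
  have hθ0 : 0 < certThreshold c n d k := lt_of_lt_of_le (by positivity) hBt
  have hM := meas_ge_le_lintegral_div (μ := gaussianVectors n d) hmeas.ennreal_ofReal.aemeasurable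
    (ε := ENNReal.ofReal (certThreshold c n d k)) (ENNReal.ofReal_pos.2 hθ0).ne'
    ENNReal.ofReal_ne_top
  calc _ ≤ gaussianVectors n d {a | ENNReal.ofReal (certThreshold c n d k) ≤
          ENNReal.ofReal ((certMatrix a k ^ p).trace)} :=
        measure_mono fun a ha => ENNReal.ofReal_le_ofReal (le_of_lt ha)
    _ ≤ _ := hM
    _ ≤ ENNReal.ofReal B / ENNReal.ofReal (certThreshold c n d k) := by
        gcongr
        exact hE
    _ = ENNReal.ofReal (B / certThreshold c n d k) := (ENNReal.ofReal_div_of_pos hθ0).symm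
    _ ≤ _ := by
        refine ENNReal.ofReal_le_ofReal ?_
        rw [div_le_div_iff₀ hθ0 (by positivity)]
        linarith

theorem measure_not_certHolds_le {c t : ℕ} (ht : 1 ≤ t) (htd : t ≤ d) (hd : d ≤ n) :
    gaussianVectors n d {a | ¬ CertHolds c n d t a} ≤ ENNReal.ofReal (1 / (n : ℝ) ^ c) := by
  rcases Nat.lt_or_ge n 2 with hn | hn
  · obtain rfl : n = 1 := by omega
    have : IsProbabilityMeasure (gaussianVectors 1 d) := by unfold gaussianVectors; infer_instance
    simpa using prob_le_one
  have hn0 : (0 : ℝ) < n := by exact_mod_cast (by omega : 0 < n)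
  have hsub : {a | ¬ CertHolds c n d t a} ⊆ ⋃ k ∈ Finset.Icc 1 t,
      {a | certThreshold c n d k < (certMatrix a k ^ Nat.clog 2 n).trace} := by
    intro a ha
    simp only [Set.mem_ofPred_eq, CertHolds, hn, true_and, not_forall, not_le] at ha
    obtain ⟨k, hk, h⟩ := ha
    simp only [Set.mem_iUnion]
    exact ⟨k, hk, h⟩
  calc _ ≤ _ := measure_mono hsub
    _ ≤ ∑ k ∈ Finset.Icc 1 t, _ := measure_biUnion_finset_le _ _
    _ ≤ ∑ k ∈ Finset.Icc 1 t, ENNReal.ofReal (1 / (n : ℝ) ^ (c + 1)) :=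
        Finset.sum_le_sum fun k hk => measure_certThreshold_lt hn (Finset.mem_Icc.1 hk).1 hd
    _ = ENNReal.ofReal (t * (1 / (n : ℝ) ^ (c + 1))) := by
        rw [Finset.sum_const, Nat.card_Icc, Nat.add_sub_cancel, nsmul_eq_mul,
          ← ENNReal.ofReal_natCast, ← ENNReal.ofReal_mul (by positivity)]
    _ ≤ _ := by
        refine ENNReal.ofReal_le_ofReal ?_
        have : (t : ℝ) ≤ n := by exact_mod_cast htd.trans hd
        rw [pow_succ, mul_one_div, div_le_div_iff₀ (by positivity) (by positivity)]
        nlinarith [pow_pos hn0 c]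

end Certificate

/-! ### A calculus of functions that real RAM programs compute in polynomial time -/

namespace RealRAM

/-- Agreement of two stores on the first `f` registers of either kind and on the real memory. -/
def Agree (f : ℕ) (s s' : Store) : Prop :=
  (∀ j < f, s'.ireg j = s.ireg j) ∧ (∀ j < f, s'.rreg j = s.rreg j) ∧ s'.rmem = s.rmem

theorem Agree.trans {f : ℕ} {s₁ s₂ s₃ : Store} (h : Agree f s₁ s₂) (h' : Agree f s₂ s₃) :
    Agree f s₁ s₃ :=
  ⟨fun j hj => (h'.1 j hj).trans (h.1 j hj), fun j hj => (h'.2.1 j hj).trans (h.2.1 j hj),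
    h'.2.2.trans h.2.2⟩

theorem Agree.mono {f g : ℕ} {s s' : Store} (h : Agree g s s') (hf : f ≤ g) : Agree f s s' :=
  ⟨fun j hj => h.1 j (by omega), fun j hj => h.2.1 j (by omega), h.2.2⟩

/-- The program `P` leads from `s` to `s'` in at most `T` steps. -/
def Runs (P : Prog) (s s' : Store) (T : ℕ) : Prop := ∃ k, Exec P s s' k ∧ k ≤ T

theorem Runs.mono {P : Prog} {s s' : Store} {T T' : ℕ} (h : Runs P s s' T) (hT : T ≤ T') :
    Runs P s s' T' := let ⟨k, h1, h2⟩ := h; ⟨k, h1, h2.trans hT⟩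

theorem Runs.instr (a : Instr) (s : Store) : Runs (.instr a) s (a.eval s) 1 :=
  ⟨1, .instr a s, le_rfl⟩

theorem Runs.seq {P Q : Prog} {s₁ s₂ s₃ : Store} {T T' : ℕ} (h : Runs P s₁ s₂ T)
    (h' : Runs Q s₂ s₃ T') : Runs (.seq P Q) s₁ s₃ (T + T') :=
  let ⟨_, h1, h2⟩ := h; let ⟨_, h3, h4⟩ := h'; ⟨_, .seq h1 h3, add_le_add h2 h4⟩

theorem Runs.iteTrue {b : Test} {P Q : Prog} {s s' : Store} {T : ℕ} (hb : b.Holds s)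
    (h : Runs P s s' T) : Runs (.ite b P Q) s s' (T + 1) :=
  let ⟨_, h1, h2⟩ := h; ⟨_, .iteTrue hb h1, by omega⟩

theorem Runs.iteFalse {b : Test} {P Q : Prog} {s s' : Store} {T : ℕ} (hb : ¬ b.Holds s)
    (h : Runs Q s s' T) : Runs (.ite b P Q) s s' (T + 1) :=
  let ⟨_, h1, h2⟩ := h; ⟨_, .iteFalse hb h1, by omega⟩

/-- `I i` is the invariant before the `i`-th round; the test succeeds for the first `N` rounds and
fails after them. -/
theorem Runs.while {b : Test} {P : Prog} (N τ : ℕ) (I : ℕ → Store → Prop)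
    (hstep : ∀ i < N, ∀ s, I i s → b.Holds s ∧ ∃ s', Runs P s s' τ ∧ I (i + 1) s')
    (hend : ∀ s, I N s → ¬ b.Holds s) {s : Store} (h0 : I 0 s) :
    ∃ s', Runs (.while b P) s s' (N * (τ + 1) + 1) ∧ I N s' := by
  have key : ∀ j i s, i + j = N → I i s →
      ∃ s', Runs (.while b P) s s' (j * (τ + 1) + 1) ∧ I N s' := by
    intro j
    induction j with
    | zero =>
      intro i s hi h
      obtain rfl : i = N := by omega
      exact ⟨s, ⟨1, .whileFalse (hend s h), by omega⟩, h⟩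
    | succ j ih =>
      intro i s hi h
      obtain ⟨hb, s₁, ⟨k, h1, hk⟩, h2⟩ := hstep i (by omega) s h
      obtain ⟨s₂, ⟨l, h3, hl⟩, h4⟩ := ih (i + 1) s₁ (by omega) h2
      refine ⟨s₂, ⟨_, .whileTrue hb h1 h3, ?_⟩, h4⟩
      rw [add_mul]
      omega
  exact key N 0 s (by omega) h0

/-- An evaluation context: values that can be read off from the registers below `f` and from the
real memory, and a measure of the size of these values. -/
structure Ctx (β : Type) where
  f : ℕ
  π : Store → β
  μ : Store → ℕ
  two_le : ∀ s, 2 ≤ μ s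
  inv : ∀ s s', Agree f s s' → π s' = π s ∧ μ s' = μ s

variable {β : Type}

/-- The context with a further natural number, kept in the register `f + e`. -/
def Ctx.extI (γ : Ctx β) (e : ℕ) : Ctx (β × ℕ) where
  f := γ.f + e + 1
  π s := (γ.π s, s.ireg (γ.f + e))
  -- The stored number counts towards the measure, so it is itself polynomially bounded. Reals have
  -- unit cost and are not counted in `extR`.
  μ s := γ.μ s + s.ireg (γ.f + e)
  two_le s := (γ.two_le s).trans (Nat.le_add_right _ _)
  inv s s' h := by
    have h1 := γ.inv s s' (h.mono (by omega))
    rw [h1.1, h1.2, h.1 (γ.f + e) (by omega)]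
    exact ⟨rfl, rfl⟩

/-- The context with a further real number, kept in the register `f + e`. -/
def Ctx.extR (γ : Ctx β) (e : ℕ) : Ctx (β × ℝ) where
  f := γ.f + e + 1
  π s := (γ.π s, s.rreg (γ.f + e))
  μ s := γ.μ s
  two_le := γ.two_le
  inv s s' h := by
    have h1 := γ.inv s s' (h.mono (by omega))
    rw [h1.1, h1.2, h.2.1 (γ.f + e) (by omega)]
    exact ⟨rfl, rfl⟩

def Ctx.Bounded (γ : Ctx β) (T : Store → ℕ) : Prop := ∃ c, ∀ s, T s ≤ γ.μ s ^ c

section Bounded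

variable {γ : Ctx β} {T T' : Store → ℕ}

theorem Ctx.one_le (γ : Ctx β) (s : Store) : 1 ≤ γ.μ s := one_le_two.trans (γ.two_le s)

theorem Ctx.Bounded.mono (h : γ.Bounded T) (hT : ∀ s, T' s ≤ T s) : γ.Bounded T' :=
  let ⟨c, hc⟩ := h; ⟨c, fun s => (hT s).trans (hc s)⟩

theorem Ctx.Bounded.self_pow (γ : Ctx β) (c : ℕ) : γ.Bounded fun s => γ.μ s ^ c :=
  ⟨c, fun _ => le_rfl⟩

theorem Ctx.Bounded.const (γ : Ctx β) (j : ℕ) : γ.Bounded fun _ => j :=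
  ⟨j, fun s => Nat.lt_two_pow_self.le.trans (Nat.pow_le_pow_left (γ.two_le s) j)⟩

theorem Ctx.Bounded.mul (h : γ.Bounded T) (h' : γ.Bounded T') : γ.Bounded fun s => T s * T' s :=
  let ⟨c, hc⟩ := h; let ⟨c', hc'⟩ := h'
  ⟨c + c', fun s => by rw [pow_add]; exact Nat.mul_le_mul (hc s) (hc' s)⟩

theorem Ctx.Bounded.add (h : γ.Bounded T) (h' : γ.Bounded T') : γ.Bounded fun s => T s + T' s := by
  obtain ⟨c, hc⟩ := h
  obtain ⟨c', hc'⟩ := h'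
  refine ⟨c + c' + 1, fun s => ?_⟩
  have h1 : 1 ≤ γ.μ s ^ c := Nat.one_le_pow _ _ (γ.one_le s)
  have h2 : 1 ≤ γ.μ s ^ c' := Nat.one_le_pow _ _ (γ.one_le s)
  calc T s + T' s ≤ γ.μ s ^ c + γ.μ s ^ c' := add_le_add (hc s) (hc' s)
    _ ≤ γ.μ s ^ c * γ.μ s ^ c' * 2 := by nlinarith
    _ ≤ γ.μ s ^ c * γ.μ s ^ c' * γ.μ s := Nat.mul_le_mul_left _ (γ.two_le s)
    _ = _ := by ring

theorem Ctx.Bounded.pow (h : γ.Bounded T) (j : ℕ) : γ.Bounded fun s => T s ^ j :=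
  let ⟨c, hc⟩ := h
  ⟨c * j, fun s => by rw [pow_mul]; exact Nat.pow_le_pow_left (hc s) j⟩

theorem Ctx.Bounded.extI (h : γ.Bounded T) (e : ℕ) : (γ.extI e).Bounded T :=
  let ⟨c, hc⟩ := h
  ⟨c, fun s => (hc s).trans (Nat.pow_le_pow_left (Nat.le_add_right _ _) c)⟩

end Bounded

/-- The natural-number valued function `F` is polynomially bounded, and there are programs that
compute it in polynomial time without touching the context, for every possible target register. -/
def IComputes (γ : Ctx β) (F : β → ℕ) : Prop :=
  γ.Bounded (fun s => F (γ.π s)) ∧ ∀ e, ∃ (P : Prog) (c : ℕ), ∀ s, ∃ s',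
    Runs P s s' (γ.μ s ^ c) ∧ Agree (γ.f + e) s s' ∧ s'.ireg (γ.f + e) = F (γ.π s)

/-- The analogue of `IComputes` for real-valued functions. -/
def RComputes (γ : Ctx β) (F : β → ℝ) : Prop :=
  ∀ e, ∃ (P : Prog) (c : ℕ), ∀ s, ∃ s',
    Runs P s s' (γ.μ s ^ c) ∧ Agree (γ.f + e) s s' ∧ s'.rreg (γ.f + e) = F (γ.π s)

theorem Ctx.inv_of_agree (γ : Ctx β) {e : ℕ} {s s' : Store} (h : Agree (γ.f + e) s s') :
    γ.π s' = γ.π s ∧ γ.μ s' = γ.μ s := γ.inv s s' (h.mono (Nat.le_add_right _ _))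

section Closure

variable {γ : Ctx β}

theorem IComputes.extI {F : β → ℕ} (h : IComputes γ F) (e : ℕ) :
    IComputes (γ.extI e) fun z => F z.1 := by
  refine ⟨h.1.extI e, fun e' => ?_⟩
  obtain ⟨P, c, hP⟩ := h.2 (e + 1 + e')
  refine ⟨P, c, fun s => ?_⟩
  obtain ⟨s', h1, h2, h3⟩ := hP s
  have e1 : γ.f + (e + 1 + e') = (γ.extI e).f + e' := by simp only [Ctx.extI]; omega
  rw [e1] at h2 h3
  exact ⟨s', h1.mono (Nat.pow_le_pow_left (Nat.le_add_right _ _) c), h2, h3⟩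

theorem RComputes.extI {F : β → ℝ} (h : RComputes γ F) (e : ℕ) :
    RComputes (γ.extI e) fun z => F z.1 := by
  intro e'
  obtain ⟨P, c, hP⟩ := h (e + 1 + e')
  refine ⟨P, c, fun s => ?_⟩
  obtain ⟨s', h1, h2, h3⟩ := hP s
  have e1 : γ.f + (e + 1 + e') = (γ.extI e).f + e' := by simp only [Ctx.extI]; omega
  rw [e1] at h2 h3
  exact ⟨s', h1.mono (Nat.pow_le_pow_left (Nat.le_add_right _ _) c), h2, h3⟩

theorem RComputes.extR {F : β → ℝ} (h : RComputes γ F) (e : ℕ) :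
    RComputes (γ.extR e) fun z => F z.1 := by
  intro e'
  obtain ⟨P, c, hP⟩ := h (e + 1 + e')
  refine ⟨P, c, fun s => ?_⟩
  obtain ⟨s', h1, h2, h3⟩ := hP s
  have e1 : γ.f + (e + 1 + e') = (γ.extR e).f + e' := by simp only [Ctx.extR]; omega
  rw [e1] at h2 h3
  exact ⟨s', h1, h2, h3⟩

theorem agree_ireg (s : Store) (g v : ℕ) :
    Agree g s { s with ireg := Function.update s.ireg g v } :=
  ⟨fun j hj => Function.update_of_ne (by omega) _ _, fun _ _ => rfl, rfl⟩

theorem agree_rreg (s : Store) (g : ℕ) (v : ℝ) :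
    Agree g s { s with rreg := Function.update s.rreg g v } :=
  ⟨fun _ _ => rfl, fun j hj => Function.update_of_ne (by omega) _ _, rfl⟩

theorem IComputes.const (γ : Ctx β) (j : ℕ) : IComputes γ fun _ => j :=
  ⟨Ctx.Bounded.const γ j, fun e => ⟨.instr (.iconst (γ.f + e) j), 0, fun s =>
    ⟨_, Runs.instr _ s, agree_ireg s _ _, Function.update_self _ _ _⟩⟩⟩

/-- A register that belongs to the context can be read. -/
theorem IComputes.of_reg (γ : Ctx β) {F : β → ℕ} (r : ℕ) (hr : r < γ.f)
    (hF : ∀ s, s.ireg r = F (γ.π s)) (hb : γ.Bounded fun s => F (γ.π s)) : IComputes γ F := by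
  refine ⟨hb, fun e => ?_⟩
  obtain ⟨c, hc⟩ := Ctx.Bounded.const γ 2
  -- There is no move instruction; copying is addition to zero.
  refine ⟨.seq (.instr (.iconst (γ.f + e) 0)) (.instr (.iadd (γ.f + e) (γ.f + e) r)), c, fun s =>
    ⟨_, ((Runs.instr _ _).seq (Runs.instr _ _)).mono (hc s),
      (agree_ireg _ _ _).trans (agree_ireg _ _ _), ?_⟩⟩
  simp [Instr.eval, ← hF, Function.update_of_ne (by omega : r ≠ γ.f + e)]

theorem RComputes.of_reg (γ : Ctx β) {F : β → ℝ} (r : ℕ) (hr : r < γ.f)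
    (hF : ∀ s, s.rreg r = F (γ.π s)) : RComputes γ F := by
  intro e
  obtain ⟨c, hc⟩ := Ctx.Bounded.const γ 3
  refine ⟨.seq (.seq (.instr (.iconst (γ.f + e) 0)) (.instr (.rcast (γ.f + e) (γ.f + e))))
    (.instr (.radd (γ.f + e) (γ.f + e) r)), c, fun s =>
    ⟨_, (((Runs.instr _ _).seq (Runs.instr _ _)).seq (Runs.instr _ _)).mono (hc s),
      ((agree_ireg _ _ _).trans (agree_rreg _ _ _)).trans (agree_rreg _ _ _), ?_⟩⟩
  simp [Instr.eval, ← hF, Function.update_of_ne (by omega : r ≠ γ.f + e)]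

theorem IComputes.snd (γ : Ctx β) (e : ℕ) : IComputes (γ.extI e) fun z => z.2 :=
  .of_reg _ (γ.f + e) (Nat.lt_succ_self _) (fun _ => rfl)
    ⟨1, fun s => by rw [pow_one]; exact Nat.le_add_left _ _⟩

theorem RComputes.snd (γ : Ctx β) (e : ℕ) : RComputes (γ.extR e) fun z => z.2 :=
  .of_reg _ (γ.f + e) (Nat.lt_succ_self _) (fun _ => rfl)

/-- Evaluation of two natural-number valued functions into consecutive registers. -/
theorem IComputes.pair {F G : β → ℕ} (hF : IComputes γ F) (hG : IComputes γ G) (e : ℕ) :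
    ∃ (P : Prog) (c : ℕ), ∀ s, ∃ s', Runs P s s' (γ.μ s ^ c) ∧ Agree (γ.f + e) s s' ∧
      s'.ireg (γ.f + e) = F (γ.π s) ∧ s'.ireg (γ.f + e + 1) = G (γ.π s) := by
  obtain ⟨P, c, hP⟩ := hF.2 e
  -- Evaluating `G` one register higher preserves the value of `F`.
  obtain ⟨Q, c', hQ⟩ := hG.2 (e + 1)
  obtain ⟨C, hC⟩ := (Ctx.Bounded.self_pow γ c).add (Ctx.Bounded.self_pow γ c')
  refine ⟨.seq P Q, C, fun s => ?_⟩
  obtain ⟨s₁, h1, h2, h3⟩ := hP s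
  obtain ⟨s₂, h4, h5, h6⟩ := hQ s₁
  have hi := γ.inv_of_agree h2
  rw [hi.2] at h4
  rw [hi.1] at h6
  exact ⟨s₂, (h1.seq h4).mono (hC s), h2.trans (h5.mono (by omega)),
    (h5.1 _ (by omega)).trans h3, h6⟩

theorem RComputes.pair {F G : β → ℝ} (hF : RComputes γ F) (hG : RComputes γ G) (e : ℕ) :
    ∃ (P : Prog) (c : ℕ), ∀ s, ∃ s', Runs P s s' (γ.μ s ^ c) ∧ Agree (γ.f + e) s s' ∧
      s'.rreg (γ.f + e) = F (γ.π s) ∧ s'.rreg (γ.f + e + 1) = G (γ.π s) := by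
  obtain ⟨P, c, hP⟩ := hF e
  obtain ⟨Q, c', hQ⟩ := hG (e + 1)
  obtain ⟨C, hC⟩ := (Ctx.Bounded.self_pow γ c).add (Ctx.Bounded.self_pow γ c')
  refine ⟨.seq P Q, C, fun s => ?_⟩
  obtain ⟨s₁, h1, h2, h3⟩ := hP s
  obtain ⟨s₂, h4, h5, h6⟩ := hQ s₁
  have hi := γ.inv_of_agree h2
  rw [hi.2] at h4
  rw [hi.1] at h6
  exact ⟨s₂, (h1.seq h4).mono (hC s), h2.trans (h5.mono (by omega)),
    (h5.2.1 _ (by omega)).trans h3, h6⟩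

theorem IComputes.instr₂ {F G : β → ℕ} (hF : IComputes γ F) (hG : IComputes γ G)
    (op : ℕ → ℕ → ℕ) (I : ℕ → Instr)
    (hI : ∀ g s, (I g).eval s =
      { s with ireg := Function.update s.ireg g (op (s.ireg g) (s.ireg (g + 1))) })
    (hb : γ.Bounded fun s => op (F (γ.π s)) (G (γ.π s))) :
    IComputes γ fun b => op (F b) (G b) := by
  refine ⟨hb, fun e => ?_⟩
  obtain ⟨P, c, hP⟩ := hF.pair hG e
  obtain ⟨C, hC⟩ := (Ctx.Bounded.self_pow γ c).add (Ctx.Bounded.const γ 1)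
  refine ⟨.seq P (.instr (I (γ.f + e))), C, fun s => ?_⟩
  obtain ⟨s₁, h1, h2, h3, h4⟩ := hP s
  refine ⟨_, (h1.seq (Runs.instr _ _)).mono (hC s), ?_, ?_⟩
  · rw [hI]
    exact h2.trans (agree_ireg _ _ _)
  · simp [hI, h3, h4]

theorem RComputes.instr₂ {F G : β → ℝ} (hF : RComputes γ F) (hG : RComputes γ G)
    (op : ℝ → ℝ → ℝ) (I : ℕ → Instr)
    (hI : ∀ g s, (I g).eval s =
      { s with rreg := Function.update s.rreg g (op (s.rreg g) (s.rreg (g + 1))) }) :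
    RComputes γ fun b => op (F b) (G b) := by
  intro e
  obtain ⟨P, c, hP⟩ := hF.pair hG e
  obtain ⟨C, hC⟩ := (Ctx.Bounded.self_pow γ c).add (Ctx.Bounded.const γ 1)
  refine ⟨.seq P (.instr (I (γ.f + e))), C, fun s => ?_⟩
  obtain ⟨s₁, h1, h2, h3, h4⟩ := hP s
  refine ⟨_, (h1.seq (Runs.instr _ _)).mono (hC s), ?_, ?_⟩
  · rw [hI]
    exact h2.trans (agree_rreg _ _ _)
  · simp [hI, h3, h4]

theorem IComputes.add {F G : β → ℕ} (hF : IComputes γ F) (hG : IComputes γ G) :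
    IComputes γ fun b => F b + G b :=
  hF.instr₂ hG (· + ·) (fun g => .iadd g g (g + 1)) (fun _ _ => rfl) (hF.1.add hG.1)

theorem IComputes.sub {F G : β → ℕ} (hF : IComputes γ F) (hG : IComputes γ G) :
    IComputes γ fun b => F b - G b :=
  hF.instr₂ hG (· - ·) (fun g => .isub g g (g + 1)) (fun _ _ => rfl)
    (hF.1.mono fun _ => Nat.sub_le _ _)

theorem RComputes.add {F G : β → ℝ} (hF : RComputes γ F) (hG : RComputes γ G) :
    RComputes γ fun b => F b + G b :=
  hF.instr₂ hG (· + ·) (fun g => .radd g g (g + 1)) fun _ _ => rfl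

theorem RComputes.sub {F G : β → ℝ} (hF : RComputes γ F) (hG : RComputes γ G) :
    RComputes γ fun b => F b - G b :=
  hF.instr₂ hG (· - ·) (fun g => .rsub g g (g + 1)) fun _ _ => rfl

theorem RComputes.mul {F G : β → ℝ} (hF : RComputes γ F) (hG : RComputes γ G) :
    RComputes γ fun b => F b * G b :=
  hF.instr₂ hG (· * ·) (fun g => .rmul g g (g + 1)) fun _ _ => rfl

theorem RComputes.div {F G : β → ℝ} (hF : RComputes γ F) (hG : RComputes γ G) :
    RComputes γ fun b => F b / G b :=
  hF.instr₂ hG (· / ·) (fun g => .rdiv g g (g + 1)) fun _ _ => rfl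

theorem IComputes.cast {F : β → ℕ} (hF : IComputes γ F) : RComputes γ fun b => (F b : ℝ) := by
  intro e
  obtain ⟨P, c, hP⟩ := hF.2 e
  obtain ⟨C, hC⟩ := (Ctx.Bounded.self_pow γ c).add (Ctx.Bounded.const γ 1)
  refine ⟨.seq P (.instr (.rcast (γ.f + e) (γ.f + e))), C, fun s => ?_⟩
  obtain ⟨s₁, h1, h2, h3⟩ := hP s
  refine ⟨_, (h1.seq (Runs.instr _ _)).mono (hC s), h2.trans (agree_rreg _ _ _), ?_⟩
  simp [Instr.eval, h3]

/-- The function `m` of the context is the real memory. -/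
def Ctx.HasMem (γ : Ctx β) (m : β → ℕ → ℝ) : Prop := ∀ s, m (γ.π s) = s.rmem

theorem IComputes.load {m : β → ℕ → ℝ} (hm : γ.HasMem m) {F : β → ℕ} (hF : IComputes γ F) :
    RComputes γ fun b => m b (F b) := by
  intro e
  obtain ⟨P, c, hP⟩ := hF.2 e
  obtain ⟨C, hC⟩ := (Ctx.Bounded.self_pow γ c).add (Ctx.Bounded.const γ 1)
  refine ⟨.seq P (.instr (.rload (γ.f + e) (γ.f + e))), C, fun s => ?_⟩
  obtain ⟨s₁, h1, h2, h3⟩ := hP s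
  refine ⟨_, (h1.seq (Runs.instr _ _)).mono (hC s), h2.trans (agree_rreg _ _ _), ?_⟩
  simp [Instr.eval, h3, hm s, h2.2.2]

theorem IComputes.ite_lt {A B F G : β → ℕ} (hA : IComputes γ A) (hB : IComputes γ B)
    (hF : IComputes γ F) (hG : IComputes γ G) :
    IComputes γ fun b => if A b < B b then F b else G b := by
  refine ⟨(hF.1.add hG.1).mono fun s => by dsimp only; split_ifs <;> omega, fun e => ?_⟩
  obtain ⟨P, c, hP⟩ := hA.pair hB e
  obtain ⟨Q, c₁, hQ⟩ := hF.2 e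
  obtain ⟨R, c₂, hR⟩ := hG.2 e
  obtain ⟨C, hC⟩ := (Ctx.Bounded.self_pow γ c).add
    (((Ctx.Bounded.self_pow γ c₁).add (Ctx.Bounded.self_pow γ c₂)).add (Ctx.Bounded.const γ 1))
  refine ⟨.seq P (.ite (.ilt (γ.f + e) (γ.f + e + 1)) Q R), C, fun s => ?_⟩
  obtain ⟨s₁, h1, h2, h3, h4⟩ := hP s
  have hi := γ.inv_of_agree h2
  have hT : Test.Holds (.ilt (γ.f + e) (γ.f + e + 1)) s₁ ↔ A (γ.π s) < B (γ.π s) := by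
    simp [Test.Holds, h3, h4]
  by_cases h : A (γ.π s) < B (γ.π s)
  · obtain ⟨s₂, h5, h6, h7⟩ := hQ s₁
    rw [hi.2] at h5
    rw [hi.1] at h7
    refine ⟨s₂, (h1.seq (Runs.iteTrue (hT.2 h) h5)).mono (le_trans ?_ (hC s)), h2.trans h6, ?_⟩
    · simp only; omega
    · exact h7.trans (if_pos h).symm
  · obtain ⟨s₂, h5, h6, h7⟩ := hR s₁
    rw [hi.2] at h5
    rw [hi.1] at h7
    refine ⟨s₂, (h1.seq (Runs.iteFalse (fun h' => h (hT.1 h')) h5)).mono (le_trans ?_ (hC s)),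
      h2.trans h6, ?_⟩
    · simp only; omega
    · exact h7.trans (if_neg h).symm

theorem RComputes.ite_lt {A B : β → ℕ} {F G : β → ℝ} (hA : IComputes γ A) (hB : IComputes γ B)
    (hF : RComputes γ F) (hG : RComputes γ G) :
    RComputes γ fun b => if A b < B b then F b else G b := by
  intro e
  obtain ⟨P, c, hP⟩ := hA.pair hB e
  obtain ⟨Q, c₁, hQ⟩ := hF e
  obtain ⟨R, c₂, hR⟩ := hG e
  obtain ⟨C, hC⟩ := (Ctx.Bounded.self_pow γ c).add
    (((Ctx.Bounded.self_pow γ c₁).add (Ctx.Bounded.self_pow γ c₂)).add (Ctx.Bounded.const γ 1))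
  refine ⟨.seq P (.ite (.ilt (γ.f + e) (γ.f + e + 1)) Q R), C, fun s => ?_⟩
  obtain ⟨s₁, h1, h2, h3, h4⟩ := hP s
  have hi := γ.inv_of_agree h2
  have hT : Test.Holds (.ilt (γ.f + e) (γ.f + e + 1)) s₁ ↔ A (γ.π s) < B (γ.π s) := by
    simp [Test.Holds, h3, h4]
  by_cases h : A (γ.π s) < B (γ.π s)
  · obtain ⟨s₂, h5, h6, h7⟩ := hQ s₁
    rw [hi.2] at h5
    rw [hi.1] at h7
    refine ⟨s₂, (h1.seq (Runs.iteTrue (hT.2 h) h5)).mono (le_trans ?_ (hC s)), h2.trans h6, ?_⟩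
    · simp only; omega
    · exact h7.trans (if_pos h).symm
  · obtain ⟨s₂, h5, h6, h7⟩ := hR s₁
    rw [hi.2] at h5
    rw [hi.1] at h7
    refine ⟨s₂, (h1.seq (Runs.iteFalse (fun h' => h (hT.1 h')) h5)).mono (le_trans ?_ (hC s)),
      h2.trans h6, ?_⟩
    · simp only; omega
    · exact h7.trans (if_neg h).symm

open Classical in
theorem IComputes.ite_le {A B : β → ℝ} {F G : β → ℕ} (hA : RComputes γ A) (hB : RComputes γ B)
    (hF : IComputes γ F) (hG : IComputes γ G) :
    IComputes γ fun b => if A b ≤ B b then F b else G b := by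
  refine ⟨(hF.1.add hG.1).mono fun s => by dsimp only; split_ifs <;> omega, fun e => ?_⟩
  obtain ⟨P, c, hP⟩ := hA.pair hB e
  obtain ⟨Q, c₁, hQ⟩ := hF.2 e
  obtain ⟨R, c₂, hR⟩ := hG.2 e
  obtain ⟨C, hC⟩ := (Ctx.Bounded.self_pow γ c).add
    (((Ctx.Bounded.self_pow γ c₁).add (Ctx.Bounded.self_pow γ c₂)).add (Ctx.Bounded.const γ 1))
  refine ⟨.seq P (.ite (.rle (γ.f + e) (γ.f + e + 1)) Q R), C, fun s => ?_⟩
  obtain ⟨s₁, h1, h2, h3, h4⟩ := hP s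
  have hi := γ.inv_of_agree h2
  have hT : Test.Holds (.rle (γ.f + e) (γ.f + e + 1)) s₁ ↔ A (γ.π s) ≤ B (γ.π s) := by
    simp [Test.Holds, h3, h4]
  by_cases h : A (γ.π s) ≤ B (γ.π s)
  · obtain ⟨s₂, h5, h6, h7⟩ := hQ s₁
    rw [hi.2] at h5
    rw [hi.1] at h7
    refine ⟨s₂, (h1.seq (Runs.iteTrue (hT.2 h) h5)).mono (le_trans ?_ (hC s)), h2.trans h6, ?_⟩
    · simp only; omega
    · exact h7.trans (if_pos h).symm
  · obtain ⟨s₂, h5, h6, h7⟩ := hR s₁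
    rw [hi.2] at h5
    rw [hi.1] at h7
    refine ⟨s₂, (h1.seq (Runs.iteFalse (fun h' => h (hT.1 h')) h5)).mono (le_trans ?_ (hC s)),
      h2.trans h6, ?_⟩
    · simp only; omega
    · exact h7.trans (if_neg h).symm

end Closure

end RealRAM

/-! ### Loops, integer arithmetic, finite sums and products, digits. -/

namespace RealRAM

/-- Primitive recursion, as a non-dependent function. -/
def precIter {α : Type*} (z : α) (S : ℕ → α → α) : ℕ → α
  | 0 => z
  | i + 1 => S i (precIter z S i)

variable {β : Type} {γ : Ctx β}

theorem agree_ireg_of_le (s : Store) {g r : ℕ} (h : g ≤ r) (v : ℕ) :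
    Agree g s { s with ireg := Function.update s.ireg r v } := (agree_ireg s r v).mono h

theorem agree_rreg_of_le (s : Store) {g r : ℕ} (h : g ≤ r) (v : ℝ) :
    Agree g s { s with rreg := Function.update s.rreg r v } := (agree_rreg s r v).mono h

/-- A counting loop. The bound `hb` on all intermediate values is needed because the running time of
the step is measured with the accumulator included. -/
theorem IComputes.prec {N Z : β → ℕ} {S : β → ℕ → ℕ → ℕ} (hN : IComputes γ N) (hZ : IComputes γ Z)
    (hS : ∀ e e', IComputes ((γ.extI e).extI e') fun z => S z.1.1 z.1.2 z.2)
    (hb : ∃ c, ∀ s, ∀ i ≤ N (γ.π s), precIter (Z (γ.π s)) (S (γ.π s)) i ≤ γ.μ s ^ c) :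
    IComputes γ fun b => precIter (Z b) (S b) (N b) := by
  obtain ⟨cb, hcb⟩ := hb
  refine ⟨⟨cb, fun s => hcb s _ le_rfl⟩, fun e => ?_⟩
  obtain ⟨PN, cN, hPN⟩ := hN.2 e
  obtain ⟨PZ, cZ, hPZ⟩ := hZ.2 (e + 2)
  obtain ⟨PS, cS, hPS⟩ := (hS (e + 1) 0).2 0
  obtain ⟨C, hC⟩ := (((Ctx.Bounded.self_pow γ cN).add (Ctx.Bounded.const γ 1)).add
    (Ctx.Bounded.self_pow γ cZ)).add (((hN.1.mul (((((((Ctx.Bounded.self_pow γ 1).add hN.1).add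
      (Ctx.Bounded.self_pow γ cb)).pow cS).add (Ctx.Bounded.const γ 2)).add
      (Ctx.Bounded.const γ 2)).add (Ctx.Bounded.const γ 1))).add (Ctx.Bounded.const γ 1)).add
      (Ctx.Bounded.const γ 2))
  obtain ⟨g, hg⟩ : ∃ g, g = γ.f + e := ⟨_, rfl⟩
  have hg2 : γ.f + (e + 2) = g + 2 := by omega
  have hi : ∀ s, ((γ.extI (e + 1)).extI 0).π s = ((γ.π s, s.ireg (g + 1)), s.ireg (g + 2)) := by
    intro s; subst hg; rfl
  have hμ : ∀ s, ((γ.extI (e + 1)).extI 0).μ s = γ.μ s + s.ireg (g + 1) + s.ireg (g + 2) := by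
    intro s; subst hg; rfl
  have hf : ((γ.extI (e + 1)).extI 0).f + 0 = g + 3 := by subst hg; rfl
  simp only [hi, hμ, hf] at hPS
  simp only [hg2] at hPZ
  simp only [← hg] at hPN ⊢
  have hγ : ∀ {s s'}, Agree g s s' → γ.π s' = γ.π s ∧ γ.μ s' = γ.μ s := fun h => by
    subst hg; exact γ.inv_of_agree h
  -- Registers: `g` holds the number of rounds, `g + 1` the counter, `g + 2` the accumulator, `g +
  -- 3` the result of the step, `g + 4` a constant for copying and incrementing.
  refine ⟨.seq (.seq (.seq PN (.instr (.iconst (g + 1) 0))) PZ)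
    (.seq (.while (.ilt (g + 1) g)
      (.seq (.seq PS (.seq (.instr (.iconst (g + 4) 0)) (.instr (.iadd (g + 2) (g + 3) (g + 4)))))
        (.seq (.instr (.iconst (g + 4) 1)) (.instr (.iadd (g + 1) (g + 1) (g + 4))))))
      (.seq (.instr (.iconst (g + 1) 0)) (.instr (.iadd g (g + 2) (g + 1))))), C, fun s => ?_⟩
  obtain ⟨s₁, r1, a1, v1⟩ := hPN s
  set s₂ : Store := Instr.eval (.iconst (g + 1) 0) s₁ with hs₂
  have a2 : Agree (g + 1) s₁ s₂ := agree_ireg _ _ _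
  obtain ⟨s₃, r3, a3, v3⟩ := hPZ s₂
  have a12 : Agree g s s₂ := a1.trans (a2.mono (by omega))
  rw [(hγ a12).2] at r3
  rw [(hγ a12).1] at v3
  set n := N (γ.π s) with hn
  have hloop := Runs.while (b := .ilt (g + 1) g)
    (P := .seq (.seq PS (.seq (.instr (.iconst (g + 4) 0))
      (.instr (.iadd (g + 2) (g + 3) (g + 4)))))
        (.seq (.instr (.iconst (g + 4) 1)) (.instr (.iadd (g + 1) (g + 1) (g + 4))))) n
    ((γ.μ s ^ 1 + n + γ.μ s ^ cb) ^ cS + 2 + 2)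
    (fun i s' => Agree g s s' ∧ s'.ireg g = n ∧ s'.ireg (g + 1) = i ∧
      s'.ireg (g + 2) = precIter (Z (γ.π s)) (S (γ.π s)) i)
  obtain ⟨s₄, r4, a4, v4⟩ : ∃ s₄, _ ∧ _ := by
    refine hloop ?_ ?_ (s := s₃) ⟨a12.trans (a3.mono (by omega)), ?_, ?_, v3⟩
    · rintro i hin s' ⟨b1, b2, b3, b4⟩
      refine ⟨by simp only [Test.Holds, b2, b3]; exact hin, ?_⟩
      obtain ⟨s'', q1, q2, q3⟩ := hPS s'
      rw [(hγ b1).2, b3, b4] at q1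
      rw [(hγ b1).1, b3, b4] at q3
      have hle : (γ.μ s + i + precIter (Z (γ.π s)) (S (γ.π s)) i) ^ cS ≤
          (γ.μ s ^ 1 + n + γ.μ s ^ cb) ^ cS := by
        refine Nat.pow_le_pow_left ?_ cS
        have := hcb s i hin.le
        rw [pow_one]
        omega
      refine ⟨_, ((q1.mono hle).seq ((Runs.instr _ _).seq (Runs.instr _ _))).seq
        ((Runs.instr _ _).seq (Runs.instr _ _)), ?_, ?_, ?_, ?_⟩
      · exact b1.trans ((q2.mono (by omega)).trans
          (((agree_ireg_of_le _ (by omega) _).trans (agree_ireg_of_le _ (by omega) _)).trans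
            ((agree_ireg_of_le _ (by omega) _).trans (agree_ireg_of_le _ (by omega) _))))
      · have := q2.1 g (by omega)
        simp [Instr.eval, this, b2]
      · have := q2.1 (g + 1) (by omega)
        simp [Instr.eval, this, b3]
      · simp [Instr.eval, q3, precIter]
    · rintro s' ⟨b1, b2, b3, b4⟩
      simp [Test.Holds, b2, b3]
    · rw [a3.1 g (by omega), a2.1 g (by omega), v1]
    · rw [a3.1 (g + 1) (by omega)]
      simp [hs₂, Instr.eval]
  refine ⟨_, (((r1.seq (Runs.instr _ _)).seq r3).seq
    (r4.seq ((Runs.instr _ _).seq (Runs.instr _ _)))).mono (hC s), ?_, ?_⟩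
  · exact a4.trans (((agree_ireg _ _ _).mono (by omega : g ≤ g + 1)).trans (agree_ireg _ _ _))
  · simp [Instr.eval, v4.2.2]

theorem RComputes.prec {N : β → ℕ} {Z : β → ℝ} {S : β → ℕ → ℝ → ℝ} (hN : IComputes γ N)
    (hZ : RComputes γ Z)
    (hS : ∀ e e', RComputes ((γ.extI e).extR e') fun z => S z.1.1 z.1.2 z.2) :
    RComputes γ fun b => precIter (Z b) (S b) (N b) := by
  intro e
  obtain ⟨PN, cN, hPN⟩ := hN.2 e
  obtain ⟨PZ, cZ, hPZ⟩ := hZ (e + 2)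
  obtain ⟨PS, cS, hPS⟩ := hS (e + 1) 0 0
  obtain ⟨C, hC⟩ := (((Ctx.Bounded.self_pow γ cN).add (Ctx.Bounded.const γ 1)).add
    (Ctx.Bounded.self_pow γ cZ)).add (((hN.1.mul ((((((Ctx.Bounded.self_pow γ 1).add hN.1).pow cS).add
      (Ctx.Bounded.const γ 3)).add (Ctx.Bounded.const γ 2)).add (Ctx.Bounded.const γ 1))).add (Ctx.Bounded.const γ 1)).add
      (Ctx.Bounded.const γ 3))
  obtain ⟨g, hg⟩ : ∃ g, g = γ.f + e := ⟨_, rfl⟩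
  have hg2 : γ.f + (e + 2) = g + 2 := by omega
  have hi : ∀ s, ((γ.extI (e + 1)).extR 0).π s = ((γ.π s, s.ireg (g + 1)), s.rreg (g + 2)) := by
    intro s; subst hg; rfl
  have hμ : ∀ s, ((γ.extI (e + 1)).extR 0).μ s = γ.μ s + s.ireg (g + 1) := by
    intro s; subst hg; rfl
  have hf : ((γ.extI (e + 1)).extR 0).f + 0 = g + 3 := by subst hg; rfl
  simp only [hi, hμ, hf] at hPS
  simp only [hg2] at hPZ
  simp only [← hg] at hPN ⊢
  have hγ : ∀ {s s'}, Agree g s s' → γ.π s' = γ.π s ∧ γ.μ s' = γ.μ s := fun h => by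
    subst hg; exact γ.inv_of_agree h
  refine ⟨.seq (.seq (.seq PN (.instr (.iconst (g + 1) 0))) PZ)
    (.seq (.while (.ilt (g + 1) g)
      (.seq (.seq PS (.seq (.seq (.instr (.iconst (g + 4) 0)) (.instr (.rcast (g + 4) (g + 4))))
        (.instr (.radd (g + 2) (g + 3) (g + 4)))))
        (.seq (.instr (.iconst (g + 4) 1)) (.instr (.iadd (g + 1) (g + 1) (g + 4))))))
      (.seq (.seq (.instr (.iconst (g + 1) 0)) (.instr (.rcast (g + 1) (g + 1))))
        (.instr (.radd g (g + 2) (g + 1))))), C, fun s => ?_⟩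
  obtain ⟨s₁, r1, a1, v1⟩ := hPN s
  set s₂ : Store := Instr.eval (.iconst (g + 1) 0) s₁ with hs₂
  have a2 : Agree (g + 1) s₁ s₂ := agree_ireg _ _ _
  obtain ⟨s₃, r3, a3, v3⟩ := hPZ s₂
  have a12 : Agree g s s₂ := a1.trans (a2.mono (by omega))
  rw [(hγ a12).2] at r3
  rw [(hγ a12).1] at v3
  set n := N (γ.π s) with hn
  have hloop := Runs.while (b := .ilt (g + 1) g)
    (P := .seq (.seq PS (.seq (.seq (.instr (.iconst (g + 4) 0)) (.instr (.rcast (g + 4) (g + 4))))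
      (.instr (.radd (g + 2) (g + 3) (g + 4)))))
        (.seq (.instr (.iconst (g + 4) 1)) (.instr (.iadd (g + 1) (g + 1) (g + 4))))) n
    ((γ.μ s ^ 1 + n) ^ cS + 3 + 2)
    (fun i s' => Agree g s s' ∧ s'.ireg g = n ∧ s'.ireg (g + 1) = i ∧
      s'.rreg (g + 2) = precIter (Z (γ.π s)) (S (γ.π s)) i)
  obtain ⟨s₄, r4, a4, v4⟩ : ∃ s₄, _ ∧ _ := by
    refine hloop ?_ ?_ (s := s₃) ⟨a12.trans (a3.mono (by omega)), ?_, ?_, v3⟩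
    · rintro i hin s' ⟨b1, b2, b3, b4⟩
      refine ⟨by simp only [Test.Holds, b2, b3]; exact hin, ?_⟩
      obtain ⟨s'', q1, q2, q3⟩ := hPS s'
      rw [(hγ b1).2, b3] at q1
      rw [(hγ b1).1, b3, b4] at q3
      have hle : (γ.μ s + i) ^ cS ≤ (γ.μ s ^ 1 + n) ^ cS := by
        rw [pow_one]
        exact Nat.pow_le_pow_left (by omega) cS
      refine ⟨_, ((q1.mono hle).seq (((Runs.instr _ _).seq (Runs.instr _ _)).seq (Runs.instr _ _))).seq
        ((Runs.instr _ _).seq (Runs.instr _ _)), ?_, ?_, ?_, ?_⟩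
      · exact b1.trans ((q2.mono (by omega)).trans
          ((((agree_ireg_of_le _ (by omega) _).trans (agree_rreg_of_le _ (by omega) _)).trans
            (agree_rreg_of_le _ (by omega) _)).trans
            ((agree_ireg_of_le _ (by omega) _).trans (agree_ireg_of_le _ (by omega) _))))
      · have := q2.1 g (by omega)
        simp [Instr.eval, this, b2]
      · have := q2.1 (g + 1) (by omega)
        simp [Instr.eval, this, b3]
      · simp [Instr.eval, q3, precIter]
    · rintro s' ⟨b1, b2, b3, b4⟩
      simp [Test.Holds, b2, b3]
    · rw [a3.1 g (by omega), a2.1 g (by omega), v1]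
    · rw [a3.1 (g + 1) (by omega)]
      simp [hs₂, Instr.eval]
  refine ⟨_, (((r1.seq (Runs.instr _ _)).seq r3).seq
    (r4.seq (((Runs.instr _ _).seq (Runs.instr _ _)).seq (Runs.instr _ _)))).mono (hC s), ?_, ?_⟩
  · exact a4.trans (((agree_ireg_of_le _ (by omega) _).trans
      (agree_rreg_of_le _ (by omega) _)).trans (agree_rreg_of_le _ le_rfl _))
  · simp [Instr.eval, v4.2.2]

theorem precIter_add {M : Type*} [AddCommMonoid M] (G : ℕ → M) (n : ℕ) :
    precIter 0 (fun i acc => acc + G i) n = ∑ i ∈ Finset.range n, G i := by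
  induction n with
  | zero => rfl
  | succ n ih => rw [Finset.sum_range_succ, ← ih]; rfl

theorem precIter_mul {M : Type*} [CommMonoid M] (G : ℕ → M) (n : ℕ) :
    precIter 1 (fun i acc => acc * G i) n = ∏ i ∈ Finset.range n, G i := by
  induction n with
  | zero => rfl
  | succ n ih => rw [Finset.prod_range_succ, ← ih]; rfl

theorem precIter_const {α : Type*} (z : α) (h : α → α) (n : ℕ) :
    precIter z (fun _ acc => h acc) n = h^[n] z := by
  induction n with
  | zero => rfl
  | succ n ih => rw [Function.iterate_succ_apply', ← ih]; rfl

/-- The bound holds in every store, in particular after the extra register has been overwritten by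
an arbitrary `i`. -/
theorem Ctx.Bounded.extI_apply {G : β → ℕ → ℕ} {e : ℕ}
    (h : (γ.extI e).Bounded fun s => G ((γ.extI e).π s).1 ((γ.extI e).π s).2) :
    ∃ c, ∀ s i, G (γ.π s) i ≤ (γ.μ s + i) ^ c := by
  obtain ⟨c, hc⟩ := h
  refine ⟨c, fun s i => ?_⟩
  have h1 := γ.inv_of_agree (agree_ireg s (γ.f + e) i)
  have h2 := hc { s with ireg := Function.update s.ireg (γ.f + e) i }
  simpa [Ctx.extI, h1.1, h1.2] using h2

theorem IComputes.sum {N : β → ℕ} {G : β → ℕ → ℕ} (hN : IComputes γ N)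
    (hG : ∀ e, IComputes (γ.extI e) fun z => G z.1 z.2) :
    IComputes γ fun b => ∑ i ∈ Finset.range (N b), G b i := by
  have h := hN.prec (S := fun b i acc => acc + G b i) (.const γ 0)
    (fun e e' => (IComputes.snd _ e').add ((hG e).extI e')) ?_
  · simpa only [precIter_add] using h
  · obtain ⟨c, hc⟩ := Ctx.Bounded.extI_apply (hG 0).1
    obtain ⟨C, hC⟩ := hN.1.mul (((Ctx.Bounded.self_pow γ 1).add hN.1).pow c)
    refine ⟨C, fun s i hi => ?_⟩
    rw [precIter_add]
    refine le_trans ?_ (hC s)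
    calc _ ≤ ∑ j ∈ Finset.range i, (γ.μ s ^ 1 + N (γ.π s)) ^ c :=
          Finset.sum_le_sum fun j hj => (hc s j).trans (Nat.pow_le_pow_left (by
            have := Finset.mem_range.1 hj
            rw [pow_one]
            omega) c)
      _ ≤ _ := by
          rw [Finset.sum_const, Finset.card_range, smul_eq_mul]
          exact Nat.mul_le_mul_right _ hi

theorem IComputes.mul {F G : β → ℕ} (hF : IComputes γ F) (hG : IComputes γ G) :
    IComputes γ fun b => F b * G b := by
  have := hF.sum (G := fun b _ => G b) fun e => hG.extI e
  simpa using this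

/-- The machine has no integer division; a quotient is obtained by counting positive multiples of
`b` up to `a`. -/
theorem div_eq_sum (a : ℕ) {b : ℕ} (hb : 0 < b) :
    a / b = ∑ i ∈ Finset.range a, if a < (i + 1) * b then 0 else 1 := by
  have h : ∀ i, (if a < (i + 1) * b then 0 else 1) = if i < a / b then 1 else 0 := by
    intro i
    have : a < (i + 1) * b ↔ ¬ i < a / b := by
      rw [not_lt, ← Nat.lt_succ_iff, Nat.div_lt_iff_lt_mul hb]
    by_cases h : i < a / b <;> simp [this, h]
  simp only [h]
  rw [Finset.sum_boole, Nat.cast_id]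
  have : (Finset.range a).filter (· < a / b) = Finset.range (a / b) := by
    ext i
    simp only [Finset.mem_filter, Finset.mem_range]
    have := Nat.div_le_self a b
    omega
  rw [this, Finset.card_range]

theorem IComputes.div {F G : β → ℕ} (hF : IComputes γ F) (hG : IComputes γ G) :
    IComputes γ fun b => F b / G b := by
  have h := (IComputes.const γ 0).ite_lt hG
    (hF.sum (G := fun b i => if F b < (i + 1) * G b then 0 else 1) fun e =>
      (hF.extI e).ite_lt (((IComputes.snd γ e).add (.const _ 1)).mul (hG.extI e))
        (.const _ 0) (.const _ 1)) (.const γ 0)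
  convert h using 2 with b
  split_ifs with hb
  · exact div_eq_sum _ hb
  · rw [show G b = 0 by omega, Nat.div_zero]

theorem IComputes.mod {F G : β → ℕ} (hF : IComputes γ F) (hG : IComputes γ G) :
    IComputes γ fun b => F b % G b := by
  simpa only [Nat.mod_def] using hF.sub (hG.mul (hF.div hG))

theorem IComputes.pow {F E : β → ℕ} (hF : IComputes γ F) (hE : IComputes γ E)
    (hb : γ.Bounded fun s => F (γ.π s) ^ E (γ.π s)) : IComputes γ fun b => F b ^ E b := by
  have h := hE.prec (S := fun b _ acc => acc * F b) (.const γ 1)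
    (fun e e' => (IComputes.snd _ e').mul ((hF.extI e).extI e')) ?_
  · simpa only [precIter_mul, Finset.prod_const, Finset.card_range] using h
  · obtain ⟨C, hC⟩ := hb.add (Ctx.Bounded.const γ 1)
    refine ⟨C, fun s i hi => ?_⟩
    rw [precIter_mul (fun _ => F (γ.π s)), Finset.prod_const, Finset.card_range]
    refine le_trans ?_ (hC s)
    rcases Nat.eq_zero_or_pos (F (γ.π s)) with h0 | h0
    · rw [h0]
      exact (show 0 ^ i ≤ 1 by rcases i with _ | i <;> simp).trans (Nat.le_add_left _ _)
    · exact (Nat.pow_le_pow_right h0 hi).trans (Nat.le_add_right _ _)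

theorem IComputes.min {F G : β → ℕ} (hF : IComputes γ F) (hG : IComputes γ G) :
    IComputes γ fun b => min (F b) (G b) := by
  simpa only [Nat.sub_sub_eq_min] using hF.sub (hF.sub hG)

theorem RComputes.sum {N : β → ℕ} {G : β → ℕ → ℝ} (hN : IComputes γ N)
    (hG : ∀ e, RComputes (γ.extI e) fun z => G z.1 z.2) :
    RComputes γ fun b => ∑ i ∈ Finset.range (N b), G b i := by
  have h := RComputes.prec (S := fun b i acc => acc + G b i) hN (IComputes.const γ 0).cast
    (fun e e' => (RComputes.snd _ e').add ((hG e).extR e'))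
  simpa only [Nat.cast_zero, precIter_add] using h

theorem RComputes.prod {N : β → ℕ} {G : β → ℕ → ℝ} (hN : IComputes γ N)
    (hG : ∀ e, RComputes (γ.extI e) fun z => G z.1 z.2) :
    RComputes γ fun b => ∏ i ∈ Finset.range (N b), G b i := by
  have h := RComputes.prec (S := fun b i acc => acc * G b i) hN (IComputes.const γ 1).cast
    (fun e e' => (RComputes.snd _ e').mul ((hG e).extR e'))
  simpa only [Nat.cast_one, precIter_mul] using h

theorem RComputes.pow {F : β → ℝ} {E : β → ℕ} (hF : RComputes γ F) (hE : IComputes γ E) :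
    RComputes γ fun b => F b ^ E b := by
  have := RComputes.prod (G := fun b _ => F b) hE fun e => hF.extI e
  simpa using this

theorem RComputes.ite_eq {A B : β → ℕ} {F G : β → ℝ} (hA : IComputes γ A) (hB : IComputes γ B)
    (hF : RComputes γ F) (hG : RComputes γ G) :
    RComputes γ fun b => if A b = B b then F b else G b := by
  have h := RComputes.ite_lt hA hB hG (RComputes.ite_lt hB hA hG hF)
  convert h using 2 with b
  split_ifs <;> first | rfl | omega

/-- The `r`-th digit of `c` in base `B`. -/
def digit (B c r : ℕ) : ℕ := (· / B)^[r] c % B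

theorem iterate_div_eq (B c r : ℕ) : (· / B)^[r] c = c / B ^ r := by
  induction r with
  | zero => simp
  | succ r ih => rw [Function.iterate_succ_apply', ih, Nat.div_div_eq_div_mul, pow_succ]

/-- Repeated division keeps all intermediate values below `c`, whereas `B ^ r` itself need not be
polynomially bounded. -/
theorem IComputes.digit {B c r : β → ℕ} (hB : IComputes γ B) (hc : IComputes γ c)
    (hr : IComputes γ r) : IComputes γ fun b => digit (B b) (c b) (r b) := by
  have h := hr.prec (S := fun b _ acc => acc / B b) hc
    (fun e e' => (IComputes.snd _ e').div ((hB.extI e).extI e')) ?_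
  · have h' : IComputes γ fun b => (· / B b)^[r b] (c b) := by
      refine Eq.mp ?_ h
      congr 1
      funext b
      exact precIter_const (c b) (· / B b) (r b)
    exact h'.mod hB
  · obtain ⟨C, hC⟩ := hc.1
    refine ⟨C, fun s i _ => le_trans ?_ (hC s)⟩
    have := precIter_const (c (γ.π s)) (· / B (γ.π s)) i
    refine (le_of_eq this).trans ?_
    rw [iterate_div_eq]
    exact Nat.div_le_self _ _

end RealRAM

/-! ### The functions that make up the certificate program -/

namespace RealRAM

/-- The indicator that the first `K` digits of `c` in base `B` are distinct. -/
noncomputable def distinctDigits (B K c : ℕ) : ℝ :=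
  ∏ r ∈ Finset.range K, ∏ r' ∈ Finset.range r, if digit B c r = digit B c r' then 0 else 1

noncomputable def entryForm (m : ℕ → ℝ) (d j x y : ℕ) : ℝ :=
  m (j * d + x) * m (j * d + y) - if x = y then 1 else 0

/-- Here `I` codes a `K`-tuple of vectors, `u` a multi-index, and `w` a self-map of `2K` points; the
factor `distinctDigits` keeps the permutations among the self-maps. -/
noncomputable def jetCode (m : ℕ → ℝ) (n d K I u : ℕ) : ℝ :=
  ∑ w ∈ Finset.range ((2 * K) ^ (2 * K)), distinctDigits (2 * K) (2 * K) w *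
    ∏ r ∈ Finset.range K, entryForm m d (digit n I r) (digit d u (digit (2 * K) w (r * 2)))
      (digit d u (digit (2 * K) w (r * 2 + 1)))

/-- The sum is over ordered tuples of distinct vectors, so each set is counted `K!` times, which is
the factorial in `certMatrix`. -/
noncomputable def gramCode (m : ℕ → ℝ) (n d K u v : ℕ) : ℝ :=
  ∑ I ∈ Finset.range (n ^ K), distinctDigits n K I * (jetCode m n d K I u * jetCode m n d K I v)

noncomputable def clogCode (n : ℕ) : ℕ :=
  open Classical in ∑ j ∈ Finset.range n, if (n : ℝ) ≤ 2 ^ j then 0 else 1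

/-- The address of the `(u, v)` entry of the `s + 1`-st power of the `k + 1`-st matrix. -/
def cellAddr (p N k s u v : ℕ) : ℕ := ((k * p + s) * N + u) * N + v

/-- A higher power reads the preceding power and the first power from cells already filled. The cap
by `t` keeps the ranges of summation polynomially bounded for every argument `k`. -/
noncomputable def powerCode (m : ℕ → ℝ) (n d t p N k s u v : ℕ) : ℝ :=
  if s = 0 then gramCode m n d (min (k + 1) t) u v else
    ∑ g ∈ Finset.range (d ^ (2 * min (k + 1) t)),
      m (n * d + cellAddr p N k (s - 1) u g) * m (n * d + cellAddr p N k 0 g v)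

noncomputable def cellCode (m : ℕ → ℝ) (n d t i : ℕ) : ℝ :=
  powerCode m n d t (clogCode n) (d ^ (2 * t)) (i / (d ^ (2 * t) * d ^ (2 * t)) / clogCode n)
    (i / (d ^ (2 * t) * d ^ (2 * t)) % clogCode n) (i / d ^ (2 * t) % d ^ (2 * t))
    (i % d ^ (2 * t))

noncomputable def traceCode (m : ℕ → ℝ) (n d t p N k : ℕ) : ℝ :=
  ∑ u ∈ Finset.range (d ^ (2 * min (k + 1) t)), m (n * d + cellAddr p N k (p - 1) u u)

noncomputable def thresholdCode (c n d p K : ℕ) : ℝ :=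
  ((∏ l ∈ Finset.range (2 * K), ((l + 1 : ℕ) : ℝ)) ^ 2 *
    (((2 ^ (28 + c) : ℕ) : ℝ) * ((n : ℝ) + (p : ℝ) * (d : ℝ) ^ 2 / (K : ℝ) + (p : ℝ) ^ 3 * (K : ℝ)))
      ^ K) ^ p

noncomputable def verdictCode (c : ℕ) (m : ℕ → ℝ) (n d t : ℕ) : ℕ :=
  open Classical in
  if n < 2 then 0 else
    if ∑ k ∈ Finset.range t, (if traceCode m n d t (clogCode n) (d ^ (2 * t)) k ≤
      thresholdCode c n d (clogCode n) (k + 1) then 0 else 1) < 1 then 1 else 0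

variable {β : Type} {γ : Ctx β}

/-- The context knows the parameters `n`, `d`, `t` and the real memory, and its measure is at
least a power of `(n + d + t + 2) ^ (t + 1)`. -/
structure Frame (γ : Ctx β) (n d t : β → ℕ) (m : β → ℕ → ℝ) : Prop where
  computes_n : IComputes γ n
  computes_d : IComputes γ d
  computes_t : IComputes γ t
  mem : γ.HasMem m
  pow : γ.Bounded fun s => (n (γ.π s) + d (γ.π s) + t (γ.π s) + 2) ^ (t (γ.π s) + 1)

variable {n d t : β → ℕ} {m : β → ℕ → ℝ}

theorem Frame.extI (h : Frame γ n d t m) (e : ℕ) :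
    Frame (γ.extI e) (fun z => n z.1) (fun z => d z.1) (fun z => t z.1) (fun z => m z.1) :=
  ⟨h.computes_n.extI e, h.computes_d.extI e, h.computes_t.extI e, fun s => h.mem s, h.pow.extI e⟩

theorem Frame.bounded_pow (h : Frame γ n d t m) (F E : β → ℕ)
    (hF : ∀ b, F b ≤ 2 * (n b + d b + t b + 2)) (hE : ∀ b, E b ≤ 2 * t b) :
    γ.Bounded fun s => F (γ.π s) ^ E (γ.π s) := by
  refine (h.pow.pow 4).mono fun s => ?_
  generalize γ.π s = b
  have h1 : 2 * (n b + d b + t b + 2) ≤ (n b + d b + t b + 2) ^ 2 := by nlinarith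
  calc F b ^ E b ≤ ((n b + d b + t b + 2) ^ 2) ^ E b := Nat.pow_le_pow_left ((hF b).trans h1) _
    _ ≤ ((n b + d b + t b + 2) ^ 2) ^ (2 * t b) := Nat.pow_le_pow_right (by positivity) (hE b)
    _ = (n b + d b + t b + 2) ^ (4 * t b) := by rw [← pow_mul]; congr 1; ring
    _ ≤ (n b + d b + t b + 2) ^ ((t b + 1) * 4) := Nat.pow_le_pow_right (by omega) (by omega)
    _ = _ := pow_mul _ _ _

theorem computes_distinctDigits {B K c : β → ℕ} (hB : IComputes γ B) (hK : IComputes γ K)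
    (hc : IComputes γ c) : RComputes γ fun b => distinctDigits (B b) (K b) (c b) := by
  refine RComputes.prod (G := fun b r => ∏ r' ∈ Finset.range r,
    if digit (B b) (c b) r = digit (B b) (c b) r' then 0 else 1) hK fun e => ?_
  refine RComputes.prod (G := fun (z : β × ℕ) r' =>
    if digit (B z.1) (c z.1) z.2 = digit (B z.1) (c z.1) r' then 0 else 1) (.snd γ e) fun e' => ?_
  have h0 := (IComputes.const ((γ.extI e).extI e') 0).cast
  have h1 := (IComputes.const ((γ.extI e).extI e') 1).cast
  simp only [Nat.cast_zero, Nat.cast_one] at h0 h1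
  exact RComputes.ite_eq
    (((hB.extI e).extI e').digit ((hc.extI e).extI e') ((IComputes.snd γ e).extI e'))
    (((hB.extI e).extI e').digit ((hc.extI e).extI e') (IComputes.snd _ e')) h0 h1

theorem Frame.entryForm (h : Frame γ n d t m) {j x y : β → ℕ} (hj : IComputes γ j)
    (hx : IComputes γ x) (hy : IComputes γ y) :
    RComputes γ fun b => entryForm (m b) (d b) (j b) (x b) (y b) := by
  have h0 := (IComputes.const γ 0).cast
  have h1 := (IComputes.const γ 1).cast
  simp only [Nat.cast_zero, Nat.cast_one] at h0 h1
  exact ((((hj.mul h.computes_d).add hx).load h.mem).mul (((hj.mul h.computes_d).add hy).load h.mem)).sub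
    (RComputes.ite_eq hx hy h1 h0)

theorem Frame.jetCode (h : Frame γ n d t m) {K I u : β → ℕ} (hK : IComputes γ K)
    (hKt : ∀ b, K b ≤ t b) (hI : IComputes γ I) (hu : IComputes γ u) :
    RComputes γ fun b => jetCode (m b) (n b) (d b) (K b) (I b) (u b) := by
  have h2K := (IComputes.const γ 2).mul hK
  refine RComputes.sum (N := fun b => (2 * K b) ^ (2 * K b)) (G := fun b w =>
    distinctDigits (2 * K b) (2 * K b) w * ∏ r ∈ Finset.range (K b),
      RealRAM.entryForm (m b) (d b) (digit (n b) (I b) r)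
        (digit (d b) (u b) (digit (2 * K b) w (r * 2)))
        (digit (d b) (u b) (digit (2 * K b) w (r * 2 + 1))))
    (h2K.pow h2K (h.bounded_pow (fun b => 2 * K b) (fun b => 2 * K b) (fun b => ?_) fun b => ?_)) fun e => ?_
  · have := hKt b; omega
  · have := hKt b; omega
  refine (computes_distinctDigits (h2K.extI e) (h2K.extI e) (.snd γ e)).mul ?_
  refine RComputes.prod (G := fun (z : β × ℕ) r =>
      RealRAM.entryForm (m z.1) (d z.1) (digit (n z.1) (I z.1) r)
        (digit (d z.1) (u z.1) (digit (2 * K z.1) z.2 (r * 2)))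
        (digit (d z.1) (u z.1) (digit (2 * K z.1) z.2 (r * 2 + 1)))) (hK.extI e) fun e' => ?_
  have hr := IComputes.snd (γ.extI e) e'
  have hw := (IComputes.snd γ e).extI e'
  have hr2 := hr.mul (.const _ 2)
  exact ((h.extI e).extI e').entryForm (((h.computes_n.extI e).extI e').digit ((hI.extI e).extI e') hr)
    (((h.computes_d.extI e).extI e').digit ((hu.extI e).extI e')
      (((h2K.extI e).extI e').digit hw hr2))
    (((h.computes_d.extI e).extI e').digit ((hu.extI e).extI e')
      (((h2K.extI e).extI e').digit hw (hr2.add (.const _ 1))))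

theorem Frame.gramCode (h : Frame γ n d t m) {K u v : β → ℕ} (hK : IComputes γ K)
    (hKt : ∀ b, K b ≤ t b) (hu : IComputes γ u) (hv : IComputes γ v) :
    RComputes γ fun b => gramCode (m b) (n b) (d b) (K b) (u b) (v b) := by
  refine RComputes.sum (N := fun b => n b ^ K b) (G := fun b I =>
    distinctDigits (n b) (K b) I * (RealRAM.jetCode (m b) (n b) (d b) (K b) I (u b) *
      RealRAM.jetCode (m b) (n b) (d b) (K b) I (v b)))
    (h.computes_n.pow hK (h.bounded_pow n K (fun b => ?_) fun b => ?_)) fun e => ?_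
  · omega
  · have := hKt b; omega
  exact (computes_distinctDigits (h.computes_n.extI e) (hK.extI e) (.snd γ e)).mul
    (((h.extI e).jetCode (hK.extI e) (fun z => hKt z.1) (.snd γ e) (hu.extI e)).mul
      ((h.extI e).jetCode (hK.extI e) (fun z => hKt z.1) (.snd γ e) (hv.extI e)))

theorem IComputes.clogCode (hn : IComputes γ n) : IComputes γ fun b => clogCode (n b) := by
  classical
  refine IComputes.sum (G := fun b j => if (n b : ℝ) ≤ 2 ^ j then 0 else 1) hn fun e => ?_
  have h2 := (IComputes.const (γ.extI e) 2).cast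
  rw [Nat.cast_ofNat] at h2
  exact IComputes.ite_le (hn.extI e).cast (h2.pow (.snd γ e)) (.const _ 0) (.const _ 1)

theorem IComputes.cellAddr {p N k s u v : β → ℕ} (hp : IComputes γ p) (hN : IComputes γ N)
    (hk : IComputes γ k) (hs : IComputes γ s) (hu : IComputes γ u) (hv : IComputes γ v) :
    IComputes γ fun b => cellAddr (p b) (N b) (k b) (s b) (u b) (v b) :=
  (((((hk.mul hp).add hs).mul hN).add hu).mul hN).add hv

theorem Frame.load (h : Frame γ n d t m) {A : β → ℕ} (hA : IComputes γ A) :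
    RComputes γ fun b => m b (n b * d b + A b) :=
  ((h.computes_n.mul h.computes_d).add hA).load h.mem

theorem Frame.capped (h : Frame γ n d t m) {k : β → ℕ} (hk : IComputes γ k) :
    IComputes γ fun b => min (k b + 1) (t b) := (hk.add (.const γ 1)).min h.computes_t

theorem Frame.dPow (h : Frame γ n d t m) {K : β → ℕ} (hK : IComputes γ K)
    (hKt : ∀ b, K b ≤ t b) : IComputes γ fun b => d b ^ (2 * K b) :=
  h.computes_d.pow ((IComputes.const γ 2).mul hK)
    (h.bounded_pow d (fun b => 2 * K b) (fun b => by omega) fun b => by have := hKt b; omega)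

theorem Frame.powerCode (h : Frame γ n d t m) {p N k s u v : β → ℕ} (hp : IComputes γ p)
    (hN : IComputes γ N) (hk : IComputes γ k) (hs : IComputes γ s) (hu : IComputes γ u)
    (hv : IComputes γ v) :
    RComputes γ fun b => powerCode (m b) (n b) (d b) (t b) (p b) (N b) (k b) (s b) (u b) (v b) := by
  refine RComputes.ite_eq hs (.const γ 0)
    (h.gramCode (h.capped hk) (fun b => Nat.min_le_right _ _) hu hv) ?_
  refine RComputes.sum (N := fun b => d b ^ (2 * min (k b + 1) (t b))) (G := fun b g =>
    m b (n b * d b + RealRAM.cellAddr (p b) (N b) (k b) (s b - 1) (u b) g) *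
      m b (n b * d b + RealRAM.cellAddr (p b) (N b) (k b) 0 g (v b)))
    (h.dPow (h.capped hk) fun b => Nat.min_le_right _ _) fun e => ?_
  exact ((h.extI e).load (.cellAddr (hp.extI e) (hN.extI e) (hk.extI e)
    ((hs.sub (.const γ 1)).extI e) (hu.extI e) (.snd γ e))).mul
    ((h.extI e).load (.cellAddr (hp.extI e) (hN.extI e) (hk.extI e)
      (.const _ 0) (.snd γ e) (hv.extI e)))

theorem Frame.cellCode (h : Frame γ n d t m) {i : β → ℕ} (hi : IComputes γ i) :
    RComputes γ fun b => cellCode (m b) (n b) (d b) (t b) (i b) := by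
  have hN := h.dPow h.computes_t fun _ => le_rfl
  have hp := h.computes_n.clogCode
  exact h.powerCode hp hN ((hi.div (hN.mul hN)).div hp) ((hi.div (hN.mul hN)).mod hp)
    ((hi.div hN).mod hN) (hi.mod hN)

theorem Frame.traceCode (h : Frame γ n d t m) {p N k : β → ℕ} (hp : IComputes γ p)
    (hN : IComputes γ N) (hk : IComputes γ k) :
    RComputes γ fun b => traceCode (m b) (n b) (d b) (t b) (p b) (N b) (k b) := by
  refine RComputes.sum (N := fun b => d b ^ (2 * min (k b + 1) (t b))) (G := fun b u =>
    m b (n b * d b + RealRAM.cellAddr (p b) (N b) (k b) (p b - 1) u u))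
    (h.dPow (h.capped hk) fun b => Nat.min_le_right _ _) fun e => ?_
  exact (h.extI e).load (.cellAddr (hp.extI e) (hN.extI e) (hk.extI e)
    ((hp.sub (.const γ 1)).extI e) (.snd γ e) (.snd γ e))

theorem computes_thresholdCode (c : ℕ) {p K : β → ℕ} (hn : IComputes γ n) (hd : IComputes γ d)
    (hp : IComputes γ p) (hK : IComputes γ K) :
    RComputes γ fun b => thresholdCode c (n b) (d b) (p b) (K b) := by
  have hfac : RComputes γ fun b => ∏ l ∈ Finset.range (2 * K b), ((l + 1 : ℕ) : ℝ) :=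
    RComputes.prod (G := fun _ l => ((l + 1 : ℕ) : ℝ)) ((IComputes.const γ 2).mul hK) fun e =>
      ((IComputes.snd γ e).add (.const _ 1)).cast
  exact ((hfac.pow (.const γ 2)).mul (((IComputes.const γ (2 ^ (28 + c))).cast.mul
    ((hn.cast.add ((hp.cast.mul (hd.cast.pow (.const γ 2))).div hK.cast)).add
      ((hp.cast.pow (.const γ 3)).mul hK.cast))).pow hK)).pow hp

theorem Frame.verdictCode (c : ℕ) (h : Frame γ n d t m) :
    IComputes γ fun b => verdictCode c (m b) (n b) (d b) (t b) := by
  classical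
  have hN := h.dPow h.computes_t fun _ => le_rfl
  have hp := h.computes_n.clogCode
  refine IComputes.ite_lt h.computes_n (.const γ 2) (.const γ 0) (IComputes.ite_lt
    (IComputes.sum (G := fun b k => if RealRAM.traceCode (m b) (n b) (d b) (t b)
      (RealRAM.clogCode (n b)) (d b ^ (2 * t b)) k ≤
      thresholdCode c (n b) (d b) (RealRAM.clogCode (n b)) (k + 1) then 0 else 1) h.computes_t fun e => ?_)
    (.const γ 1) (.const γ 1) (.const γ 0))
  exact IComputes.ite_le ((h.extI e).traceCode (hp.extI e) (hN.extI e) (.snd γ e))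
    (computes_thresholdCode c (h.computes_n.extI e) (h.computes_d.extI e) (hp.extI e)
      ((IComputes.snd γ e).add (.const _ 1))) (.const _ 0) (.const _ 1)

end RealRAM

/-! ### The program: tabulation of the matrix powers and the verdict. -/

namespace RealRAM

/-- The context of the three input registers and the real memory. -/
def rootCtx : Ctx (ℕ × ℕ × ℕ × (ℕ → ℝ)) where
  f := 3
  π s := (s.ireg 0, s.ireg 1, s.ireg 2, s.rmem)
  -- The exponent is built in so that polynomial in the measure means `n^O(t)` when `1 ≤ t ≤ d ≤ n`
  -- and `n ≥ 2`.
  μ s := (s.ireg 0 + s.ireg 1 + s.ireg 2 + 2) ^ (s.ireg 2 + 1)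
  two_le s := le_trans (by omega) (Nat.le_self_pow (Nat.succ_ne_zero _) _)
  inv s s' h := by
    rw [h.1 0 (by omega), h.1 1 (by omega), h.1 2 (by omega), h.2.2]
    exact ⟨rfl, rfl⟩

theorem frame_rootCtx :
    Frame rootCtx (fun b => b.1) (fun b => b.2.1) (fun b => b.2.2.1) (fun b => b.2.2.2) := by
  have hb : ∀ r < 3, rootCtx.Bounded fun s => s.ireg r := fun r hr => by
    refine ⟨1, fun s => ?_⟩
    rw [pow_one]
    refine le_trans ?_ (Nat.le_self_pow (Nat.succ_ne_zero _) _)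
    interval_cases r <;> dsimp only <;> omega
  exact ⟨.of_reg _ 0 (by decide) (fun _ => rfl) (hb 0 (by omega)),
    .of_reg _ 1 (by decide) (fun _ => rfl) (hb 1 (by omega)),
    .of_reg _ 2 (by decide) (fun _ => rfl) (hb 2 (by omega)), fun _ => rfl,
    .mono (.self_pow _ 1) fun s => by rw [pow_one]; rfl⟩

/-- The memory after the first `i` cells have been computed. -/
noncomputable def fillMem (m : ℕ → ℝ) (n d t : ℕ) : ℕ → ℕ → ℝ :=
  precIter m fun i M => Function.update M (n * d + i) (cellCode M n d t i)

noncomputable def cellCount (n d t : ℕ) : ℕ :=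
  t * clogCode n * (d ^ (2 * t) * d ^ (2 * t))

/-- The programs of the calculus leave the real memory unchanged, so the one store instruction of
the whole program is in this loop. -/
theorem exists_fill_program : ∃ (P : Prog) (C : ℕ), ∀ s, ∃ s',
    Runs P s s' (rootCtx.μ s ^ C) ∧ s'.ireg 0 = s.ireg 0 ∧ s'.ireg 1 = s.ireg 1 ∧
      s'.ireg 2 = s.ireg 2 ∧
      s'.rmem = fillMem s.rmem (s.ireg 0) (s.ireg 1) (s.ireg 2)
        (cellCount (s.ireg 0) (s.ireg 1) (s.ireg 2)) := by
  have hF := frame_rootCtx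
  have hN := hF.dPow hF.computes_t fun _ => le_rfl
  have hT : IComputes rootCtx fun b => cellCount b.1 b.2.1 b.2.2.1 :=
    (hF.computes_t.mul hF.computes_n.clogCode).mul (hN.mul hN)
  have hF1 := hF.extI 0
  have hi := IComputes.snd rootCtx 0
  obtain ⟨PT, cT, hPT⟩ := hT.2 1
  obtain ⟨PV, cV, hPV⟩ := hF1.cellCode hi 1
  obtain ⟨PA, cA, hPA⟩ := ((hF1.computes_n.mul hF1.computes_d).add hi).2 2
  have hπ : ∀ s, (rootCtx.extI 0).π s = ((s.ireg 0, s.ireg 1, s.ireg 2, s.rmem), s.ireg 3) :=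
    fun _ => rfl
  have hμ : ∀ s, (rootCtx.extI 0).μ s = rootCtx.μ s + s.ireg 3 := fun _ => rfl
  have e1 : rootCtx.f + 1 = 4 := rfl
  have e2 : (rootCtx.extI 0).f + 1 = 5 := rfl
  have e3 : (rootCtx.extI 0).f + 2 = 6 := rfl
  have hμ0 : ∀ s s' : Store, s'.ireg 0 = s.ireg 0 → s'.ireg 1 = s.ireg 1 →
      s'.ireg 2 = s.ireg 2 → rootCtx.μ s' = rootCtx.μ s := fun s s' h0 h1 h2 => by
    simp only [rootCtx, h0, h1, h2]
  simp only [hπ, hμ, e1, e2, e3] at hPT hPV hPA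
  obtain ⟨C, hC⟩ := ((Ctx.Bounded.self_pow rootCtx cT).add (Ctx.Bounded.const _ 1)).add
    ((hT.1.mul ((((((Ctx.Bounded.self_pow rootCtx 1).add hT.1).pow cV).add
      (((Ctx.Bounded.self_pow rootCtx 1).add hT.1).pow cA)).add
      (Ctx.Bounded.const rootCtx 3)).add (Ctx.Bounded.const rootCtx 1))).add
      (Ctx.Bounded.const rootCtx 1))
  -- Integer register `3` is the counter, `4` the number of cells and `6` the address; real register
  -- `5` holds the value, which the evaluation of the address leaves intact.
  refine ⟨.seq (.seq PT (.instr (.iconst 3 0))) (.while (.ilt 3 4)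
    (.seq (.seq PV PA) (.seq (.instr (.rstore 6 5))
      (.seq (.instr (.iconst 5 1)) (.instr (.iadd 3 3 5)))))), C, fun s => ?_⟩
  obtain ⟨s₁, r1, a1, v1⟩ := hPT s
  set T := cellCount (s.ireg 0) (s.ireg 1) (s.ireg 2) with hTdef
  replace v1 : s₁.ireg 4 = T := v1
  have hloop := Runs.while (b := .ilt 3 4) (P := .seq (.seq PV PA) (.seq (.instr (.rstore 6 5))
      (.seq (.instr (.iconst 5 1)) (.instr (.iadd 3 3 5))))) T
    ((rootCtx.μ s ^ 1 + T) ^ cV + (rootCtx.μ s ^ 1 + T) ^ cA + 3)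
    (fun i s' => s'.ireg 0 = s.ireg 0 ∧ s'.ireg 1 = s.ireg 1 ∧ s'.ireg 2 = s.ireg 2 ∧
      s'.ireg 3 = i ∧ s'.ireg 4 = T ∧
      s'.rmem = fillMem s.rmem (s.ireg 0) (s.ireg 1) (s.ireg 2) i)
  obtain ⟨s₂, r2, b0, b1, b2, -, -, b5⟩ : ∃ s₂, _ ∧ _ := by
    refine hloop ?_ ?_ (s := (Instr.iconst 3 0).eval s₁) ⟨?_, ?_, ?_, ?_, ?_, ?_⟩
    · rintro i hi s' ⟨h0, h1, h2, h3, h4, h5⟩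
      refine ⟨by simp only [Test.Holds, h3, h4]; exact hi, ?_⟩
      obtain ⟨s₃, r3, a3, v3⟩ := hPV s'
      obtain ⟨s₄, r4, a4, v4⟩ := hPA s₃
      rw [hμ0 s s' h0 h1 h2, h3] at r3
      rw [hμ0 s s₃ ((a3.1 0 (by omega)).trans h0) ((a3.1 1 (by omega)).trans h1)
        ((a3.1 2 (by omega)).trans h2), a3.1 3 (by omega), h3] at r4
      have hle : ∀ c, (rootCtx.μ s + i) ^ c ≤ (rootCtx.μ s ^ 1 + T) ^ c := fun c => by
        rw [pow_one]
        exact Nat.pow_le_pow_left (by omega) c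
      have k0 := (a4.1 0 (by omega)).trans ((a3.1 0 (by omega)).trans h0)
      have k1 := (a4.1 1 (by omega)).trans ((a3.1 1 (by omega)).trans h1)
      have k2 := (a4.1 2 (by omega)).trans ((a3.1 2 (by omega)).trans h2)
      have k3 := (a4.1 3 (by omega)).trans ((a3.1 3 (by omega)).trans h3)
      have k4 := (a4.1 4 (by omega)).trans ((a3.1 4 (by omega)).trans h4)
      have k5 := a4.2.2.trans (a3.2.2.trans h5)
      have k6 : s₄.rreg 5 = _ := (a4.2.1 5 (by omega)).trans v3
      simp only [a3.1 0 (by omega), a3.1 1 (by omega), a3.1 3 (by omega), h0, h1, h3] at v4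
      simp only [h0, h1, h2, h3, h5] at k6
      refine ⟨_, ((r3.mono (hle _)).seq (r4.mono (hle _))).seq ((Runs.instr _ _).seq
        ((Runs.instr _ _).seq (Runs.instr _ _))), ?_, ?_, ?_, ?_, ?_, ?_⟩
      · simp [Instr.eval, k0]
      · simp [Instr.eval, k1]
      · simp [Instr.eval, k2]
      · simp [Instr.eval, k3]
      · simp [Instr.eval, k4]
      · simp only [Instr.eval, k5, k6, v4]
        rfl
    · rintro s' ⟨-, -, -, h3, h4, -⟩
      simp [Test.Holds, h3, h4]
    · simp [Instr.eval, a1.1 0]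
    · simp [Instr.eval, a1.1 1]
    · simp [Instr.eval, a1.1 2]
    · simp [Instr.eval]
    · simp [Instr.eval, v1]
    · exact a1.2.2
  exact ⟨s₂, ((r1.seq (Runs.instr _ _)).seq r2).mono (hC s), b0, b1, b2, b5⟩

theorem exists_program (c : ℕ) : ∃ (P : Prog) (C : ℕ), ∀ s, ∃ s',
    Runs P s s' (rootCtx.μ s ^ C) ∧ s'.ireg 0 =
      verdictCode c (fillMem s.rmem (s.ireg 0) (s.ireg 1) (s.ireg 2)
        (cellCount (s.ireg 0) (s.ireg 1) (s.ireg 2))) (s.ireg 0) (s.ireg 1) (s.ireg 2) := by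
  obtain ⟨P, cP, hP⟩ := exists_fill_program
  obtain ⟨Q, cQ, hQ⟩ := (frame_rootCtx.verdictCode c).2 0
  obtain ⟨C, hC⟩ := ((Ctx.Bounded.self_pow rootCtx cP).add
    (Ctx.Bounded.self_pow rootCtx cQ)).add (Ctx.Bounded.const _ 2)
  refine ⟨.seq (.seq P Q) (.seq (.instr (.iconst 4 0)) (.instr (.iadd 0 3 4))), C, fun s => ?_⟩
  obtain ⟨s₁, r1, h0, h1, h2, h3⟩ := hP s
  obtain ⟨s₂, r2, -, v2⟩ := hQ s₁
  have hμ : rootCtx.μ s₁ = rootCtx.μ s := by simp only [rootCtx, h0, h1, h2]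
  rw [hμ] at r2
  replace v2 : s₂.ireg 3 = _ := v2
  refine ⟨_, ((r1.seq r2).seq ((Runs.instr _ _).seq (Runs.instr _ _))).mono (hC s), ?_⟩
  simp [Instr.eval, v2, rootCtx, h0, h1, h2, h3]

end RealRAM

/-! ### Correctness of the certificate program -/

namespace RealRAM

open MvPolynomial Matrix

theorem digit_finFunctionFinEquiv {B m : ℕ} (φ : Fin m → Fin B) {r : ℕ} (hr : r < m) :
    digit B (finFunctionFinEquiv φ) r = φ ⟨r, hr⟩ := by
  rw [digit, iterate_div_eq, ← finFunctionFinEquiv_symm_apply_val (finFunctionFinEquiv φ) ⟨r, hr⟩,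
    Equiv.symm_apply_apply]

theorem sum_range_pow_eq {M : Type*} [AddCommMonoid M] (B m : ℕ) (F : ℕ → M) :
    ∑ u ∈ Finset.range (B ^ m), F u = ∑ φ : Fin m → Fin B, F (finFunctionFinEquiv φ) := by
  rw [Finset.sum_range, ← finFunctionFinEquiv.sum_comp]

open Classical in
theorem distinctDigits_finFunctionFinEquiv {B m : ℕ} (φ : Fin m → Fin B) :
    distinctDigits B m (finFunctionFinEquiv φ) = if Function.Injective φ then 1 else 0 := by
  have hd : ∀ r r', r < m → r' < r → (digit B (finFunctionFinEquiv φ) r =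
      digit B (finFunctionFinEquiv φ) r' → ∃ x y : Fin m, x ≠ y ∧ φ x = φ y) := by
    intro r r' hr hr' h
    rw [digit_finFunctionFinEquiv φ hr, digit_finFunctionFinEquiv φ (hr'.trans hr)] at h
    exact ⟨⟨r, hr⟩, ⟨r', hr'.trans hr⟩, by simp [Fin.ext_iff, hr'.ne'], Fin.ext h⟩
  split_ifs with hφ
  · refine Finset.prod_eq_one fun r hr => Finset.prod_eq_one fun r' hr' => if_neg fun h => ?_
    obtain ⟨x, y, hxy, h⟩ := hd r r' (Finset.mem_range.1 hr) (Finset.mem_range.1 hr') h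
    exact hxy (hφ h)
  · have key : ∀ x y : Fin m, y < x → φ x = φ y → distinctDigits B m (finFunctionFinEquiv φ) = 0 :=
      fun x y hyx h => Finset.prod_eq_zero (Finset.mem_range.2 x.2)
        (Finset.prod_eq_zero (Finset.mem_range.2 hyx) (if_pos (by
          rw [digit_finFunctionFinEquiv φ x.2, digit_finFunctionFinEquiv φ y.2, Fin.eta, Fin.eta,
            h])))
    simp only [Function.Injective, not_forall] at hφ
    obtain ⟨x, y, h, hxy⟩ := hφ
    rcases lt_or_gt_of_ne hxy with h' | h'
    · exact key y x h' h.symm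
    · exact key x y h' h

open Classical in
theorem sum_injective_eq_sum_perm {κ : Type*} [Fintype κ] [DecidableEq κ] (G : (κ → κ) → ℝ) :
    ∑ φ : κ → κ, (if Function.Injective φ then 1 else 0) * G φ = ∑ π : Equiv.Perm κ, G π := by
  simp only [ite_mul, one_mul, zero_mul]
  rw [← Finset.sum_filter]
  symm
  refine Finset.sum_nbij (fun π => (π : κ → κ)) (fun π _ => ?_) (fun π _ π' _ h => ?_)
    (fun φ hφ => ?_) fun _ _ => rfl
  · simpa using π.injective
  · exact DFunLike.coe_injective h
  · have hφ : Function.Injective φ := by simpa using hφ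
    exact ⟨Equiv.ofBijective φ (Finite.injective_iff_bijective.1 hφ), by simp, rfl⟩

open Classical in
theorem card_injective_image_eq {n K : ℕ} {S : Finset (Fin n)} (hS : S.card = K) :
    (Finset.univ.filter fun φ : Fin K → Fin n =>
      Function.Injective φ ∧ Finset.univ.image φ = S).card = K.factorial := by
  have e0 : Fin K ≃ S := (S.equivFinOfCardEq hS).symm
  have h : (Finset.univ : Finset (Equiv.Perm (Fin K))).card = K.factorial := by
    rw [Finset.card_univ, Fintype.card_perm, Fintype.card_fin]
  rw [← h]
  symm
  refine Finset.card_nbij (fun π r => (e0 (π r) : Fin n)) (fun π _ => ?_) (fun π _ π' _ h => ?_)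
    fun φ hφ => ?_
  · simp only [Finset.coe_filter, Finset.mem_univ, true_and, Set.mem_ofPred_eq]
    refine ⟨fun r r' h => π.injective (e0.injective (Subtype.ext h)), ?_⟩
    ext x
    simp only [Finset.mem_image, Finset.mem_univ, true_and]
    exact ⟨fun ⟨r, hr⟩ => hr ▸ (e0 (π r)).2, fun hx => ⟨π.symm (e0.symm ⟨x, hx⟩), by simp⟩⟩
  · exact Equiv.ext fun r => e0.injective (Subtype.ext (congrFun h r))
  · simp only [Finset.coe_filter, Finset.mem_univ, true_and, Set.mem_ofPred_eq] at hφ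
    have hm : ∀ r, φ r ∈ S := fun r => hφ.2 ▸ Finset.mem_image_of_mem φ (Finset.mem_univ r)
    have hinj : Function.Injective fun r => e0.symm ⟨φ r, hm r⟩ := fun r r' h => by
      have := congrArg Subtype.val (e0.symm.injective h)
      exact hφ.1 this
    exact ⟨Equiv.ofBijective _ (Finite.injective_iff_bijective.1 hinj), by simp, by
      funext r; simp⟩

open Classical in
-- A set of `K` elements is the image of exactly `K!` injective tuples.
theorem sum_injective_image {n K : ℕ} (H : Finset (Fin n) → ℝ) :
    ∑ φ : Fin K → Fin n, (if Function.Injective φ then 1 else 0) * H (Finset.univ.image φ) =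
      K.factorial * ∑ S ∈ Finset.univ.powersetCard K, H S := by
  simp only [ite_mul, one_mul, zero_mul]
  rw [← Finset.sum_filter, ← Finset.sum_fiberwise_of_maps_to (t := Finset.univ.powersetCard K)
    (g := fun φ : Fin K → Fin n => Finset.univ.image φ), Finset.mul_sum]
  · refine Finset.sum_congr rfl fun S hS => ?_
    rw [Finset.filter_filter, Finset.sum_congr rfl fun φ hφ => by
      rw [(Finset.mem_filter.1 hφ).2.2], Finset.sum_const, nsmul_eq_mul,
      card_injective_image_eq (Finset.mem_powersetCard.1 hS).2]
  · intro φ hφ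
    rw [Finset.mem_powersetCard, Finset.card_image_of_injective _ (Finset.mem_filter.1 hφ).2]
    simp

variable {n d : ℕ} {a : Fin n → Fin d → ℝ}

/-- The memory contains the vectors `a` in its first cells. -/
def Holds (a : Fin n → Fin d → ℝ) (m : ℕ → ℝ) : Prop :=
  ∀ (j : Fin n) (x : Fin d), m (j * d + x) = a j x

theorem jet_prod_quadForm_eq (K m : ℕ) (hm : m = K * 2) (v : Fin K → Fin d → ℝ)
    (α : Fin m → Fin d) :
    jet m (∏ r, quadForm (v r)) α = ∑ π : Equiv.Perm (Fin m), ∏ r : Fin K,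
      (v r (α (π ⟨r * 2, by omega⟩)) * v r (α (π ⟨r * 2 + 1, by omega⟩)) -
        if α (π ⟨r * 2, by omega⟩) = α (π ⟨r * 2 + 1, by omega⟩) then 1 else 0) := by
  subst hm
  rw [jet_prod_quadForm_apply]
  have h0 : ∀ r : Fin K, finProdFinEquiv (r, (0 : Fin 2)) = ⟨r * 2, by omega⟩ := fun r =>
    Fin.ext (by simp [mul_comm])
  have h1 : ∀ r : Fin K, finProdFinEquiv (r, (1 : Fin 2)) = ⟨r * 2 + 1, by omega⟩ := fun r =>
    Fin.ext (by simp [mul_comm, add_comm])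
  simp only [h0, h1]

theorem jetCode_eq {m : ℕ → ℝ} (hm : Holds a m) {K : ℕ} (ι : Fin K → Fin n)
    (α : Fin (2 * K) → Fin d) :
    jetCode m n d K (finFunctionFinEquiv ι) (finFunctionFinEquiv α) =
      jet (2 * K) (∏ r, quadForm (a (ι r))) α := by
  rw [jet_prod_quadForm_eq K (2 * K) (by ring), jetCode, sum_range_pow_eq]
  simp only [distinctDigits_finFunctionFinEquiv, Finset.prod_range]
  have h : ∀ (φ : Fin (2 * K) → Fin (2 * K)) (r : Fin K),
      entryForm m d (digit n (finFunctionFinEquiv ι) r)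
        (digit d (finFunctionFinEquiv α) (digit (2 * K) (finFunctionFinEquiv φ) (r * 2)))
        (digit d (finFunctionFinEquiv α) (digit (2 * K) (finFunctionFinEquiv φ) (r * 2 + 1))) =
      a (ι r) (α (φ ⟨r * 2, by omega⟩)) * a (ι r) (α (φ ⟨r * 2 + 1, by omega⟩)) -
        if α (φ ⟨r * 2, by omega⟩) = α (φ ⟨r * 2 + 1, by omega⟩) then 1 else 0 := by
    intro φ r
    rw [digit_finFunctionFinEquiv ι r.2, digit_finFunctionFinEquiv φ (by omega : r * 2 < 2 * K),
      digit_finFunctionFinEquiv φ (by omega : r * 2 + 1 < 2 * K),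
      digit_finFunctionFinEquiv α (Fin.is_lt _), digit_finFunctionFinEquiv α (Fin.is_lt _),
      entryForm, hm, hm]
    simp only [Fin.eta, Fin.ext_iff]
  simp only [h]
  exact sum_injective_eq_sum_perm fun φ => ∏ r : Fin K,
    (a (ι r) (α (φ ⟨r * 2, by omega⟩)) * a (ι r) (α (φ ⟨r * 2 + 1, by omega⟩)) -
        if α (φ ⟨r * 2, by omega⟩) = α (φ ⟨r * 2 + 1, by omega⟩) then 1 else 0)

theorem gramCode_eq {m : ℕ → ℝ} (hm : Holds a m) {K : ℕ} (α β : Fin (2 * K) → Fin d) :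
    gramCode m n d K (finFunctionFinEquiv α) (finFunctionFinEquiv β) = certMatrix a K α β := by
  classical
  rw [gramCode, sum_range_pow_eq]
  simp only [distinctDigits_finFunctionFinEquiv, jetCode_eq hm]
  have h : ∀ ι : Fin K → Fin n, (if Function.Injective ι then (1 : ℝ) else 0) *
      (jet (2 * K) (∏ r, quadForm (a (ι r))) α * jet (2 * K) (∏ r, quadForm (a (ι r))) β) =
      (if Function.Injective ι then 1 else 0) *
        (jet (2 * K) (quadProd a (Finset.univ.image ι)) α *
          jet (2 * K) (quadProd a (Finset.univ.image ι)) β) := by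
    intro ι
    split_ifs with hι
    · rw [quadProd, Finset.prod_image fun x _ y _ h => hι h]
    · simp
  simp only [h]
  rw [sum_injective_image fun S => jet (2 * K) (quadProd a S) α * jet (2 * K) (quadProd a S) β]
  simp [certMatrix, prodGram, jetGram, Matrix.sum_apply, vecMulVec_apply, quadProd]

theorem clogCode_eq (n : ℕ) : clogCode n = Nat.clog 2 n := by
  classical
  have h : ∀ j, (if (n : ℝ) ≤ 2 ^ j then 0 else 1) = if j < Nat.clog 2 n then 1 else 0 := by
    intro j
    have : (n : ℝ) ≤ 2 ^ j ↔ ¬ j < Nat.clog 2 n := by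
      rw [Nat.lt_clog_iff_pow_lt one_lt_two, not_lt]
      exact_mod_cast Iff.rfl
    by_cases h : j < Nat.clog 2 n <;> simp [this, h]
  have h2 : Nat.clog 2 n ≤ n :=
    (Nat.clog_le_iff_le_pow one_lt_two).2 Nat.lt_two_pow_self.le
  rw [clogCode, Finset.sum_congr rfl fun j _ => h j, Finset.sum_boole, Nat.cast_id]
  have : (Finset.range n).filter (· < Nat.clog 2 n) = Finset.range (Nat.clog 2 n) := by
    ext i
    simp only [Finset.mem_filter, Finset.mem_range]
    omega
  rw [this, Finset.card_range]

/-- The write position only increases, so every cell below it is final. -/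
theorem fillMem_of_lt (m : ℕ → ℝ) (n d t : ℕ) {x i j : ℕ} (hx : x < n * d + j) (hij : j ≤ i) :
    fillMem m n d t i x = fillMem m n d t j x := by
  induction i, hij using Nat.le_induction with
  | base => rfl
  | succ i hij ih =>
    rw [← ih]
    exact Function.update_of_ne (by omega) _ _

theorem fillMem_cell (m : ℕ → ℝ) (n d t : ℕ) {i j : ℕ} (hij : i < j) :
    fillMem m n d t j (n * d + i) = cellCode (fillMem m n d t i) n d t i := by
  rw [fillMem_of_lt m n d t (by omega : n * d + i < n * d + (i + 1)) hij]
  exact Function.update_self _ _ _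

theorem Holds.fillMem {m : ℕ → ℝ} (hm : Holds a m) (t i : ℕ) : Holds a (fillMem m n d t i) := by
  intro j x
  rw [fillMem_of_lt m n d t (j := 0) ?_ (Nat.zero_le i)]
  · exact hm j x
  · have h1 := j.2
    have h2 := x.2
    nlinarith

theorem cellCode_cellAddr (m : ℕ → ℝ) (n d t : ℕ) {k s u v : ℕ} (hs : s < clogCode n)
    (hu : u < d ^ (2 * t)) (hv : v < d ^ (2 * t)) :
    cellCode m n d t (cellAddr (clogCode n) (d ^ (2 * t)) k s u v) =
      powerCode m n d t (clogCode n) (d ^ (2 * t)) k s u v := by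
  set p := clogCode n
  set N := d ^ (2 * t)
  have hN : 0 < N := by omega
  have hp : 0 < p := by omega
  have h1 : cellAddr p N k s u v / N = (k * p + s) * N + u := by
    rw [cellAddr, mul_comm _ N, Nat.mul_add_div hN, Nat.div_eq_of_lt hv, add_zero]
  have h2 : ((k * p + s) * N + u) / N = k * p + s := by
    rw [mul_comm _ N, Nat.mul_add_div hN, Nat.div_eq_of_lt hu, add_zero]
  rw [cellCode, ← Nat.div_div_eq_div_mul, h1, h2]
  congr 1
  · rw [mul_comm k, Nat.mul_add_div hp, Nat.div_eq_of_lt hs, add_zero]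
  · rw [mul_comm k, Nat.mul_add_mod, Nat.mod_eq_of_lt hs]
  · rw [mul_comm _ N, Nat.mul_add_mod, Nat.mod_eq_of_lt hu]
  · rw [cellAddr, mul_comm _ N, Nat.mul_add_mod, Nat.mod_eq_of_lt hv]

theorem cellAddr_lt {p N k s u v q : ℕ} (hu : u < N) (hv : v < N) (hq : k * p + s < q) :
    cellAddr p N k s u v < q * (N * N) := by
  have h1 : (k * p + s) * N + u + 1 ≤ q * N := by
    calc (k * p + s) * N + u + 1 ≤ (k * p + s) * N + N := by omega
      _ = (k * p + s + 1) * N := by ring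
      _ ≤ q * N := Nat.mul_le_mul_right _ hq
  calc cellAddr p N k s u v < ((k * p + s) * N + u) * N + N := by unfold cellAddr; omega
    _ = ((k * p + s) * N + u + 1) * N := by ring
    _ ≤ q * N * N := Nat.mul_le_mul_right _ h1
    _ = _ := mul_assoc _ _ _

theorem le_cellAddr (p N k s u v : ℕ) : (k * p + s) * (N * N) ≤ cellAddr p N k s u v := by
  unfold cellAddr
  rw [← mul_assoc]
  exact (Nat.mul_le_mul_right N (Nat.le_add_right _ u)).trans (Nat.le_add_right _ v)

/-- Induction on the power. Addresses are ordered by `(k, s)` first, so both factors of a matrix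
product lie in blocks written earlier. For small `k` some cells of a block are not codes of
multi-indices of length `2(k + 1)`; they are never read. -/
theorem fillMem_cellAddr {m : ℕ → ℝ} (hm : Holds a m) {t k : ℕ} (hk : k < t) (s : ℕ)
    (hs : s < clogCode n) (α β : Fin (2 * (k + 1)) → Fin d) {j : ℕ}
    (hj : cellAddr (clogCode n) (d ^ (2 * t)) k s (finFunctionFinEquiv α) (finFunctionFinEquiv β)
      < j) :
    fillMem m n d t j (n * d + cellAddr (clogCode n) (d ^ (2 * t)) k s (finFunctionFinEquiv α)
      (finFunctionFinEquiv β)) = (certMatrix a (k + 1) ^ (s + 1)) α β := by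
  have hcode : ∀ φ : Fin (2 * (k + 1)) → Fin d, (finFunctionFinEquiv φ : ℕ) < d ^ (2 * t) := by
    intro φ
    have hd : 0 < d := lt_of_le_of_lt (Nat.zero_le _) (φ ⟨0, by omega⟩).2
    exact (finFunctionFinEquiv φ).2.trans_le (Nat.pow_le_pow_right hd (by omega))
  induction s generalizing α β j with
  | zero =>
    rw [fillMem_cell m n d t hj, cellCode_cellAddr _ n d t hs (hcode α) (hcode β), powerCode,
      if_pos rfl, min_eq_left (by omega), gramCode_eq (hm.fillMem t _), zero_add, pow_one]
  | succ s ih =>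
    rw [fillMem_cell m n d t hj, cellCode_cellAddr _ n d t hs (hcode α) (hcode β), powerCode,
      if_neg (Nat.succ_ne_zero s), min_eq_left (by omega), sum_range_pow_eq, pow_succ,
      Matrix.mul_apply]
    refine Finset.sum_congr rfl fun g _ => ?_
    have hlow := le_cellAddr (clogCode n) (d ^ (2 * t)) k (s + 1) (finFunctionFinEquiv α)
      (finFunctionFinEquiv β)
    rw [Nat.add_sub_cancel, ih (by omega) α g
      ((cellAddr_lt (hcode α) (hcode g) (by omega)).trans_le hlow)]
    congr 1
    have h0 := cellAddr_lt (p := clogCode n) (k := k) (s := 0) (q := k * clogCode n + (s + 1))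
      (hcode g) (hcode β) (by omega)
    rw [fillMem_cell m n d t (h0.trans_le hlow), cellCode_cellAddr _ n d t (by omega) (hcode g)
      (hcode β), powerCode, if_pos rfl, min_eq_left (by omega), gramCode_eq (hm.fillMem t _)]

theorem traceCode_fillMem {m : ℕ → ℝ} (hm : Holds a m) {t k : ℕ} (hk : k < t)
    (hn : 2 ≤ n) :
    traceCode (fillMem m n d t (cellCount n d t)) n d t (clogCode n) (d ^ (2 * t)) k =
      (certMatrix a (k + 1) ^ Nat.clog 2 n).trace := by
  have hp : 0 < clogCode n := by rw [clogCode_eq]; exact Nat.clog_pos one_lt_two hn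
  rw [traceCode, min_eq_left (by omega), sum_range_pow_eq, Matrix.trace]
  refine Finset.sum_congr rfl fun α _ => ?_
  have hcode : (finFunctionFinEquiv α : ℕ) < d ^ (2 * t) := by
    have hd : 0 < d := lt_of_le_of_lt (Nat.zero_le _) (α ⟨0, by omega⟩).2
    exact (finFunctionFinEquiv α).2.trans_le (Nat.pow_le_pow_right hd (by omega))
  have hlast : clogCode n - 1 < clogCode n := by omega
  rw [fillMem_cellAddr hm hk (clogCode n - 1) hlast α α, Nat.sub_add_cancel hp, clogCode_eq,
    Matrix.diag_apply]
  refine cellAddr_lt hcode hcode ?_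
  calc k * clogCode n + (clogCode n - 1) < (k + 1) * clogCode n := by rw [add_mul]; omega
    _ ≤ _ := Nat.mul_le_mul_right _ hk

theorem thresholdCode_eq (c n d K : ℕ) :
    thresholdCode c n d (clogCode n) K = certThreshold c n d K := by
  rw [thresholdCode, certThreshold, certBase, certRate, clogCode_eq, ← Nat.cast_prod,
    Finset.prod_range_add_one_eq_factorial]
  push_cast
  rfl

theorem verdictCode_fillMem {m : ℕ → ℝ} (hm : Holds a m) (c t : ℕ) :
    verdictCode c (fillMem m n d t (cellCount n d t)) n d t = 1 ↔ CertHolds c n d t a := by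
  classical
  rw [verdictCode, CertHolds]
  by_cases hn : n < 2
  · simp only [hn, if_true]
    exact ⟨fun h => absurd h (by norm_num), fun h => absurd h.1 (by omega)⟩
  rw [if_neg hn]
  have hn2 : 2 ≤ n := by omega
  simp only [hn2, true_and, ite_eq_left_iff, zero_ne_one, imp_false, not_not, Nat.lt_one_iff,
    Finset.sum_eq_zero_iff, Finset.mem_range, thresholdCode_eq, one_ne_zero, not_not]
  constructor
  · intro h k hk
    obtain ⟨h1, h2⟩ := Finset.mem_Icc.1 hk
    obtain ⟨k, rfl⟩ : ∃ k', k = k' + 1 := ⟨k - 1, by omega⟩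
    rw [← traceCode_fillMem hm (show k < t by omega) hn2]
    exact h k (by omega)
  · intro h k hk
    rw [traceCode_fillMem hm hk hn2]
    exact h (k + 1) (Finset.mem_Icc.2 ⟨by omega, by omega⟩)

theorem holds_input (t : ℕ) (a : Fin n → Fin d → ℝ) : Holds a (input n d t a).rmem := by
  intro j x
  have hd : 0 < d := lt_of_le_of_lt (Nat.zero_le _) x.2
  have h1 : (j * d + x : ℕ) / d = j := by
    rw [mul_comm, Nat.mul_add_div hd, Nat.div_eq_of_lt x.2, add_zero]
  have h2 : (j * d + x : ℕ) % d = x := by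
    rw [mul_comm, Nat.mul_add_mod, Nat.mod_eq_of_lt x.2]
  simp only [input, h1, h2, j.2, x.2, and_self, dif_pos, Fin.eta]

theorem accepts_iff {P : Prog} {n d t : ℕ} {a : Fin n → Fin d → ℝ} {s : Store} {T : ℕ}
    (h : Runs P (input n d t a) s T) : Accepts P n d t a ↔ s.ireg 0 = 1 := by
  obtain ⟨k, hk, -⟩ := h
  exact ⟨fun ⟨s', k', h', h1⟩ => (hk.unique h').1 ▸ h1, fun h1 => ⟨s, k, hk, h1⟩⟩

/-- For `n = 1` all parameters are one and a power of `n` cannot absorb the constant, whence the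
factor `5^(2C)`. For `n ≥ 2` one has `n + d + t + 2 ≤ n⁴`. -/
theorem rootCtx_measure_le {n d t : ℕ} (C : ℕ) (ht : 1 ≤ t) (htd : t ≤ d) (hd : d ≤ n) :
    ((n + d + t + 2) ^ (t + 1)) ^ C ≤ 5 ^ (2 * C) * n ^ ((5 ^ (2 * C) + 8 * C) * t) := by
  rcases Nat.lt_or_ge n 2 with hn | hn
  · obtain rfl : n = 1 := by omega
    obtain rfl : d = 1 := by omega
    obtain rfl : t = 1 := by omega
    rw [one_pow, mul_one, ← pow_mul]
  · calc ((n + d + t + 2) ^ (t + 1)) ^ C ≤ ((n ^ 4) ^ (2 * t)) ^ C := by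
          have h1 : n + d + t + 2 ≤ n ^ 4 := by
            calc n + d + t + 2 ≤ 2 ^ 3 * n := by omega
              _ ≤ n ^ 3 * n := Nat.mul_le_mul_right _ (Nat.pow_le_pow_left hn 3)
              _ = n ^ 4 := by ring
          refine Nat.pow_le_pow_left ((Nat.pow_le_pow_left h1 _).trans ?_) C
          exact Nat.pow_le_pow_right (by positivity) (by omega)
      _ = n ^ (8 * C * t) := by rw [← pow_mul, ← pow_mul]; congr 1; ring
      _ ≤ n ^ ((5 ^ (2 * C) + 8 * C) * t) :=
          Nat.pow_le_pow_right (by omega) (Nat.mul_le_mul_right _ (Nat.le_add_left _ _))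
      _ ≤ _ := Nat.le_mul_of_pos_left _ (by positivity)

end RealRAM

theorem lemma3p5 (c : ℕ) :
    ∃ (p : RealRAM.Prog) (C K : ℕ), ∀ n d t : ℕ,
      1 ≤ t → t ≤ d → d ≤ n →
      (t : ℝ) * Real.log (n : ℝ) ^ 6 ≤ rateBound n d t →
      -- the running time, on every input
      (∀ a : Fin n → Fin d → ℝ, RealRAM.HaltsWithin p n d t a (K * n ^ (K * t))) ∧
      -- acceptance is a proof of the bound, on every input
      (∀ a : Fin n → Fin d → ℝ, RealRAM.Accepts p n d t a →
        ∀ x : EuclideanSpace ℝ (Fin d), ‖x‖ = 1 →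
          distinctProducts t a x ≤ ((C : ℝ) * rateBound n d t) ^ t) ∧
      -- Gaussian vectors are accepted except with probability at most `1 / n ^ c`
      gaussianVectors n d {a | ¬ RealRAM.Accepts p n d t a} ≤
        ENNReal.ofReal (1 / (n : ℝ) ^ c) := by
  obtain ⟨P, C, hP⟩ := RealRAM.exists_program c
  -- The last number serves both as the factor and in the exponent of the running time, so it has to
  -- dominate both constants of `rootCtx_measure_le`.
  refine ⟨P, 2 ^ (40 + c), 5 ^ (2 * C) + 8 * C, fun n d t ht htd hd hr => ?_⟩
  have hacc : ∀ a : Fin n → Fin d → ℝ, RealRAM.Accepts P n d t a ↔ CertHolds c n d t a := by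
    intro a
    obtain ⟨s, hs, hv⟩ := hP (RealRAM.input n d t a)
    rw [RealRAM.accepts_iff hs, hv]
    exact RealRAM.verdictCode_fillMem (RealRAM.holds_input t a) c t
  refine ⟨fun a => ?_, fun a ha x hx => ((hacc a).1 ha).distinctProducts_le ht hr x hx, ?_⟩
  · obtain ⟨s, ⟨k, hk, hkC⟩, -⟩ := hP (RealRAM.input n d t a)
    refine ⟨s, k, hk, hkC.trans ((RealRAM.rootCtx_measure_le C ht htd hd).trans ?_)⟩
    exact Nat.mul_le_mul_right _ (Nat.le_add_right _ _)
  · simp only [hacc]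
    exact measure_not_certHolds_le ht htd hd
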